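/- Let $\mathfrak M$ be a $W^*$-algebra and $p_0\in\mathfrak M$ an orthogonal projection. **The groupoid.** Write $|x|=(x^*x)^{1/2}$, and let $l(x)$, $r(x)$ be the left and right supports of $x$, i.e. the smallest projections with $l(x)x=x$ and $xr(x)=x$. An element $x$ is *partially invertible* if $|x|$ is invertible in $p\mathfrak Mp$, where $p$ is the support of $|x|$; then $x^{-1}:=|x|^{-1}u^*$, where $x=u|x|$ is the polar decomposition. Let $\mathcal G(\mathfrak M)$ be the set of partially invertible elements, $\mathcal L_{p_0}(\mathfrak M)=\{l(x): x\in\mathcal G(\mathfrak M),\ r(x)=p_0\}$ and $\mathcal G_{p_0}(\mathfrak M)=\{x\in\mathcal G(\mathfrak M): l(x),r(x)\in\mathcal L_{p_0}(\mathfrak M)\}$. With target $l$, source $r$, the product of $\mathfrak M$ (for $r(x)=l(y)$), the inverse $x^{-1}$ and the projections as units this is a groupoid $\mathcal G_{p_0}(\mathfrak M)\rightrightarrows\mathcal L_{p_0}(\mathfrak M)$. For a projection $p$ let $\Pi_p$ be the set of projections $q$ with $\mathfrak M=q\mathfrak M\oplus(1-p)\mathfrak M$; write $p=\sigma_p(q)-\varphi_p(q)$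 according to this splitting. For $p,\tilde p\in\mathcal L_{p_0}(\mathfrak M)$ the maps $\varphi_p:\Pi_p\to(1-p)\mathfrak Mp$ and $$x\mapsto\bigl(\varphi_{\tilde p}(l(x)),\ \sigma_{\tilde p}(l(x))^{-1}x\,\sigma_p(r(x)),\ \varphi_p(r(x))\bigr)\in(1-\tilde p)\mathfrak M\tilde p\oplus\tilde p\mathfrak Mp\oplus(1-p)\mathfrak Mp,\qquad l(x)\in\Pi_{\tilde p},\ r(x)\in\Pi_p,$$ are the charts of $\mathcal L_{p_0}(\mathfrak M)$ and of $\mathcal G_{p_0}(\mathfrak M)$. **The gauge groupoid.** Let $P_0=\{\eta\in\mathcal G_{p_0}(\mathfrak M): r(\eta)=p_0\}\subset\mathfrak Mp_0$ and let $G_0$ be the group of invertible elements of $p_0\mathfrak Mp_0$. It acts on $P_0$ by $\eta\mapsto\eta g$, on $P_0\times P_0$ by $(\eta,\xi)\mapsto(\eta g,\xi g)$ and on $TP_0$ (whose fibres are $\mathfrak Mp_0$) by $(\vartheta,\eta)\mapsto(\vartheta g,\eta g)$; write $[\eta]$, $\langle\eta,\xi\rangle$, $[(\vartheta,\eta)]$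 for the classes in the quotients. The gauge groupoid $\frac{P_0\times P_0}{G_0}\rightrightarrows P_0/G_0$ has source $\langle\eta,\xi\rangle\mapsto[\xi]$, target $\langle\eta,\xi\rangle\mapsto[\eta]$, units $[\eta]\mapsto\langle\eta,\eta\rangle$, inverse $\langle\eta,\xi\rangle^{-1}=\langle\xi,\eta\rangle$ and product $\langle\eta,\xi\rangle\langle\xi,\kappa\rangle=\langle\eta,\kappa\rangle$. **Theorem.** 1. With the above charts $\mathcal G_{p_0}(\mathfrak M)\rightrightarrows\mathcal L_{p_0}(\mathfrak M)$ is a transitive complex analytic Banach–Lie groupoid. The set $P_0$ is open in the Banach space $\mathfrak Mp_0$, and $P_0/G_0$, $(P_0\times P_0)/G_0$ and $TP_0/G_0$ carry quotient manifold structures, i.e. complex Banach manifold structures for which the quotient maps are submersions. 2. With any such structures, the gauge groupoid is a complex analytic Banach–Lie groupoid, and $$\phi:\tfrac{P_0\times P_0}{G_0}\ni\langle\eta,\xi\rangle\mapsto\eta\xi^{-1}\in\mathcal G_{p_0}(\mathfrak M),\qquad \varphi:P_0/G_0\ni[\eta]\mapsto\eta\eta^{-1}\in\mathcal L_{p_0}(\mathfrak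 M)$$ are well defined and form an isomorphism of Banach–Lie groupoids (biholomorphic on arrows and on objects, and compatible with source, target, units, inversion and product). 3. Let $\mathcal A_{p_0}(\mathfrak M)$ be the algebroid of $\mathcal G_{p_0}(\mathfrak M)\rightrightarrows\mathcal L_{p_0}(\mathfrak M)$: the vectors at the units tangent to the fibres of $r$, with anchor $Tl$ and with the bracket of sections given by the Lie bracket of the right invariant vector fields. Let $TP_0/G_0$ be the Atiyah algebroid, whose anchor is induced by the tangent map of $P_0\to P_0/G_0$ and whose sections are the $G_0$-invariant vector fields on $P_0$, with their Lie bracket. The map sending $[(\vartheta,\eta)]$ to the image of $\vartheta$ under the tangent map at $\eta$ of $\xi\mapsto\xi\eta^{-1}$ is well defined and is an isomorphism $TP_0/G_0\cong\mathcal A_{p_0}(\mathfrak M)$ of Banach–Lie algebroids over $\varphi$: it is biholomorphic and linear on the fibres, intertwines the anchors, and over every open subset of $\mathcal L_{p_0}(\mathfrak M)$ identifies the real $C^\infty$ sections and their brackets, the sections being closed under the brackets. -/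

import Mathlib

open scoped Topology ContDiff

universe u

/-! ## Complex analytic Banach manifolds

The components of the manifolds below are modelled on Banach spaces that need not be isomorphic to
each other, so that a manifold structure is given by an atlas whose charts take values in a family
of Banach spaces. -/

/-- Data of a family of charts on `X` with values in complex Banach spaces, with a preferred chart
at each point.  The value of `chart i` outside `source i` is irrelevant.  The axioms of a complex
Banach manifold are in `IsBanachManifold`. -/
structure BanachAtlas (X : Type u) where
  ι : Type u
  E : ι → Type u
  [normedAddCommGroup : ∀ i, NormedAddCommGroup (E i)]
  [normedSpace : ∀ i, NormedSpace ℂ (E i)]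
  [completeSpace : ∀ i, CompleteSpace (E i)]
  source : ι → Set X
  chart : ∀ i, X → E i
  chartAt : X → ι

attribute [instance] BanachAtlas.normedAddCommGroup BanachAtlas.normedSpace
  BanachAtlas.completeSpace

namespace BanachAtlas

/-- Open sets of the topology defined by the atlas. -/
def IsOpenSet {X : Type u} (𝒜 : BanachAtlas X) (U : Set X) : Prop :=
  ∀ i, IsOpen (𝒜.chart i '' (U ∩ 𝒜.source i))

/-- `𝒜` is an atlas of a (Hausdorff) complex analytic Banach manifold. -/
structure IsBanachManifold {X : Type u} (𝒜 : BanachAtlas X) : Prop where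
  mem_source_chartAt : ∀ x, x ∈ 𝒜.source (𝒜.chartAt x)
  injOn : ∀ i, Set.InjOn (𝒜.chart i) (𝒜.source i)
  isOpen_image : ∀ i j, IsOpen (𝒜.chart i '' (𝒜.source i ∩ 𝒜.source j))
  transition : ∀ i j, ∃ g : 𝒜.E i → 𝒜.E j,
    AnalyticOnNhd ℂ g (𝒜.chart i '' (𝒜.source i ∩ 𝒜.source j)) ∧
      ∀ x ∈ 𝒜.source i ∩ 𝒜.source j, g (𝒜.chart i x) = 𝒜.chart j x
  t2 : ∀ x y, x ≠ y → ∃ U V, 𝒜.IsOpenSet U ∧ 𝒜.IsOpenSet V ∧ x ∈ U ∧ y ∈ V ∧ Disjoint U V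

/-- In the charts `i` around `x` and `j` around `f x`, the map `g` between the model spaces
represents the restriction of `f` to `S` near `x`. -/
def Represents {X Y : Type u} (𝒜 : BanachAtlas X) (ℬ : BanachAtlas Y) (f : X → Y) (S : Set X)
    (x : X) (i : 𝒜.ι) (j : ℬ.ι) (g : 𝒜.E i → ℬ.E j) : Prop :=
  x ∈ 𝒜.source i ∧ f x ∈ ℬ.source j ∧
    ∃ N ∈ 𝓝 (𝒜.chart i x), ∀ x' ∈ 𝒜.source i ∩ S, 𝒜.chart i x' ∈ N →
      f x' ∈ ℬ.source j ∧ g (𝒜.chart i x') = ℬ.chart j (f x')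

/-- Holomorphic maps on a subset `S`: near each point of `S` the restriction of `f` to `S` extends
to a complex analytic map on a neighbourhood in the ambient manifold.  For open `S` this is
analyticity, for a (split) submanifold `S` it is analyticity on the manifold `S`. -/
def HolomorphicOn {X Y : Type u} (𝒜 : BanachAtlas X) (ℬ : BanachAtlas Y) (f : X → Y)
    (S : Set X) : Prop :=
  ∀ x ∈ S, ∃ i j, ∃ g : 𝒜.E i → ℬ.E j,
    Represents 𝒜 ℬ f S x i j g ∧ AnalyticAt ℂ g (𝒜.chart i x)

def Holomorphic {X Y : Type u} (𝒜 : BanachAtlas X) (ℬ : BanachAtlas Y) (f : X → Y) : Prop :=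
  HolomorphicOn 𝒜 ℬ f Set.univ

/-- Maps that are `C^∞` for the underlying real manifolds, on an open set `S`. -/
def RealSmoothOn {X Y : Type u} (𝒜 : BanachAtlas X) (ℬ : BanachAtlas Y) (f : X → Y)
    (S : Set X) : Prop :=
  ∀ x ∈ S, ∃ i j, ∃ g : 𝒜.E i → ℬ.E j,
    Represents 𝒜 ℬ f S x i j g ∧ ContDiffAt ℝ ∞ g (𝒜.chart i x)

/-- Bijective maps that are holomorphic together with their inverse. -/
def Biholomorphic {X Y : Type u} (𝒜 : BanachAtlas X) (ℬ : BanachAtlas Y) (f : X → Y) : Prop :=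
  Holomorphic 𝒜 ℬ f ∧
    ∃ g : Y → X, Function.LeftInverse g f ∧ Function.RightInverse g f ∧ Holomorphic ℬ 𝒜 g

/-- The expression `(chart j) ∘ f ∘ (chart i)⁻¹` of `f` in charts (extended by zero). -/
noncomputable def localExpr {X Y : Type u} (𝒜 : BanachAtlas X) (ℬ : BanachAtlas Y) (f : X → Y)
    (i : 𝒜.ι) (j : ℬ.ι) : 𝒜.E i → ℬ.E j :=
  Function.extend (fun x : 𝒜.source i => 𝒜.chart i x) (fun x => ℬ.chart j (f x)) 0

/-- The tangent space at `x`, seen in the preferred chart at `x`. -/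
abbrev TangentAt {X : Type u} (𝒜 : BanachAtlas X) (x : X) : Type u := 𝒜.E (𝒜.chartAt x)

/-- The tangent map of `f` at `x`, in the preferred charts at `x` and at `f x`. -/
noncomputable def tangentMap {X Y : Type u} (𝒜 : BanachAtlas X) (ℬ : BanachAtlas Y) (f : X → Y)
    (x : X) : 𝒜.TangentAt x →L[ℂ] ℬ.TangentAt (f x) :=
  fderiv ℂ (localExpr 𝒜 ℬ f (𝒜.chartAt x) (ℬ.chartAt (f x))) (𝒜.chart (𝒜.chartAt x) x)

/-- The total space of the tangent bundle. -/
abbrev TangentTotal {X : Type u} (𝒜 : BanachAtlas X) : Type u := Σ x : X, 𝒜.TangentAt x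

/-- The tangent map between the total spaces. -/
noncomputable def tangentTotalMap {X Y : Type u} (𝒜 : BanachAtlas X) (ℬ : BanachAtlas Y)
    (f : X → Y) (t : 𝒜.TangentTotal) : ℬ.TangentTotal :=
  ⟨f t.1, tangentMap 𝒜 ℬ f t.1 t.2⟩

/-- The expression in the chart `i` of a tangent vector at `x`. -/
noncomputable def tangentCoord {X : Type u} (𝒜 : BanachAtlas X) (i : 𝒜.ι) (x : X)
    (v : 𝒜.TangentAt x) : 𝒜.E i :=
  fderiv ℂ (localExpr 𝒜 𝒜 id (𝒜.chartAt x) i) (𝒜.chart (𝒜.chartAt x) x) v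

/-- The atlas of the tangent bundle. -/
noncomputable def tangentAtlas {X : Type u} (𝒜 : BanachAtlas X) : BanachAtlas 𝒜.TangentTotal where
  ι := 𝒜.ι
  E i := 𝒜.E i × 𝒜.E i
  source i := {t | t.1 ∈ 𝒜.source i}
  chart i t := (𝒜.chart i t.1, 𝒜.tangentCoord i t.1 t.2)
  chartAt t := 𝒜.chartAt t.1

/-- The atlas of a product. -/
noncomputable def prodAtlas {X Y : Type u} (𝒜 : BanachAtlas X) (ℬ : BanachAtlas Y) : BanachAtlas (X × Y) where
  ι := 𝒜.ι × ℬ.ι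
  E i := 𝒜.E i.1 × ℬ.E i.2
  source i := 𝒜.source i.1 ×ˢ ℬ.source i.2
  chart i x := (𝒜.chart i.1 x.1, ℬ.chart i.2 x.2)
  chartAt x := (𝒜.chartAt x.1, ℬ.chartAt x.2)

/-- Holomorphic submersions: the tangent maps are surjective with complemented kernel, that is,
they have continuous linear right inverses. -/
def IsSubmersion {X Y : Type u} (𝒜 : BanachAtlas X) (ℬ : BanachAtlas Y) (f : X → Y) : Prop :=
  Holomorphic 𝒜 ℬ f ∧
    ∀ x, ∃ s : ℬ.TangentAt (f x) →L[ℂ] 𝒜.TangentAt x, ∀ w, tangentMap 𝒜 ℬ f x (s w) = w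

/-- `𝒬` is the quotient manifold structure on the quotient of `(X, 𝒜)` by an equivalence relation:
a manifold structure for which the quotient map is a submersion (there is at most one, up to
equivalence of atlases). -/
def IsQuotientManifold {X : Type u} (𝒜 : BanachAtlas X) (s : Setoid X)
    (𝒬 : BanachAtlas (Quotient s)) : Prop :=
  𝒬.IsBanachManifold ∧ IsSubmersion 𝒜 𝒬 (Quotient.mk s)

/-- The expression of a vector field in the chart `i` (extended by zero). -/
noncomputable def fieldExpr {X : Type u} (𝒜 : BanachAtlas X) (ξ : ∀ x, 𝒜.TangentAt x) (i : 𝒜.ι) :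
    𝒜.E i → 𝒜.E i :=
  Function.extend (fun x : 𝒜.source i => 𝒜.chart i x) (fun x => 𝒜.tangentCoord i x (ξ x)) 0

/-- The Lie bracket of (real) vector fields, computed at `x` in the preferred chart at `x`. -/
noncomputable def fieldBracket {X : Type u} (𝒜 : BanachAtlas X) (ξ ζ : ∀ x, 𝒜.TangentAt x)
    (x : X) : 𝒜.TangentAt x :=
  VectorField.lieBracket ℝ (𝒜.fieldExpr ξ (𝒜.chartAt x)) (𝒜.fieldExpr ζ (𝒜.chartAt x))
    (𝒜.chart (𝒜.chartAt x) x)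

end BanachAtlas

/-! ## Banach-Lie groupoids and their algebroids -/

/-- The structure maps of a groupoid `G ⇉ B`. The product `mul g h` is meaningful when
`src g = tgt h`; its other values are irrelevant.  The axioms are in `IsGroupoid`. -/
structure GroupoidMaps (B G : Type u) where
  src : G → B
  tgt : G → B
  unit : B → G
  inv : G → G
  mul : G → G → G

namespace GroupoidMaps

open BanachAtlas

structure IsGroupoid {B G : Type u} (S : GroupoidMaps B G) : Prop where
  src_unit : ∀ b, S.src (S.unit b) = b
  tgt_unit : ∀ b, S.tgt (S.unit b) = b
  src_mul : ∀ g h, S.src g = S.tgt h → S.src (S.mul g h) = S.src h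
  tgt_mul : ∀ g h, S.src g = S.tgt h → S.tgt (S.mul g h) = S.tgt g
  mul_assoc : ∀ g h k, S.src g = S.tgt h → S.src h = S.tgt k →
    S.mul (S.mul g h) k = S.mul g (S.mul h k)
  unit_mul : ∀ g, S.mul (S.unit (S.tgt g)) g = g
  mul_unit : ∀ g, S.mul g (S.unit (S.src g)) = g
  src_inv : ∀ g, S.src (S.inv g) = S.tgt g
  tgt_inv : ∀ g, S.tgt (S.inv g) = S.src g
  mul_inv : ∀ g, S.mul g (S.inv g) = S.unit (S.tgt g)
  inv_mul : ∀ g, S.mul (S.inv g) g = S.unit (S.src g)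

/-- Any two objects are joined by an arrow. -/
def IsTransitive {B G : Type u} (S : GroupoidMaps B G) : Prop :=
  ∀ a b, ∃ g, S.src g = a ∧ S.tgt g = b

/-- Complex analytic Banach-Lie groupoids. -/
structure IsBanachLieGroupoid {B G : Type u} (S : GroupoidMaps B G) (ℬ : BanachAtlas B)
    (𝒢 : BanachAtlas G) : Prop where
  isGroupoid : S.IsGroupoid
  base_manifold : ℬ.IsBanachManifold
  arrow_manifold : 𝒢.IsBanachManifold
  src_submersion : IsSubmersion 𝒢 ℬ S.src
  tgt_submersion : IsSubmersion 𝒢 ℬ S.tgt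
  unit_holomorphic : Holomorphic ℬ 𝒢 S.unit
  inv_holomorphic : Holomorphic 𝒢 𝒢 S.inv
  mul_holomorphic : HolomorphicOn (prodAtlas 𝒢 𝒢) 𝒢 (fun x => S.mul x.1 x.2)
    {x | S.src x.1 = S.tgt x.2}

/-- `(φ, φ₀)` is an isomorphism of Banach-Lie groupoids, `φ` on arrows and `φ₀` on objects. -/
structure IsIso {B G B' G' : Type u} (S : GroupoidMaps B G) (ℬ : BanachAtlas B)
    (𝒢 : BanachAtlas G) (S' : GroupoidMaps B' G') (ℬ' : BanachAtlas B') (𝒢' : BanachAtlas G')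
    (φ : G → G') (φ₀ : B → B') : Prop where
  arrow_biholomorphic : Biholomorphic 𝒢 𝒢' φ
  base_biholomorphic : Biholomorphic ℬ ℬ' φ₀
  map_src : ∀ g, S'.src (φ g) = φ₀ (S.src g)
  map_tgt : ∀ g, S'.tgt (φ g) = φ₀ (S.tgt g)
  map_unit : ∀ b, φ (S.unit b) = S'.unit (φ₀ b)
  map_inv : ∀ g, φ (S.inv g) = S'.inv (φ g)
  map_mul : ∀ g h, S.src g = S.tgt h → φ (S.mul g h) = S'.mul (φ g) (φ h)

/-- The total space of the algebroid of `G ⇉ B`: the vectors tangent to the source fibres at the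
units.  It is considered with the structure of a submanifold of the tangent bundle of `G`; its
projection to `B` is `t ↦ S.tgt t.1` and its anchor is the restriction of the tangent map of the
target map. -/
def algebroid {B G : Type u} (S : GroupoidMaps B G) (ℬ : BanachAtlas B) (𝒢 : BanachAtlas G) :
    Set 𝒢.TangentTotal :=
  {t | t.1 ∈ Set.range S.unit ∧ tangentMap 𝒢 ℬ S.src t.1 t.2 = 0}

/-- The tangent map at the unit `1 = unit (tgt g)` of the right translation `h ↦ h g`, which is
defined on the source fibre `src h = tgt g`.  (In charts: the derivative within the image of this
fibre, whose value on the vectors tangent to the fibre is uniquely determined.) -/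
noncomputable def rightTranslate {B G : Type u} (S : GroupoidMaps B G) (𝒢 : BanachAtlas G) (g : G)
    (v : 𝒢.TangentAt (S.unit (S.tgt g))) : 𝒢.TangentAt g :=
  fderivWithin ℂ
    (localExpr 𝒢 𝒢 (fun h => S.mul h g) (𝒢.chartAt (S.unit (S.tgt g))) (𝒢.chartAt g))
    (𝒢.chart (𝒢.chartAt (S.unit (S.tgt g))) ''
      {h | h ∈ 𝒢.source (𝒢.chartAt (S.unit (S.tgt g))) ∧ S.src h = S.tgt g})
    (𝒢.chart (𝒢.chartAt (S.unit (S.tgt g))) (S.unit (S.tgt g))) v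

/-- The right invariant vector field on `G` defined by a section of the algebroid. -/
noncomputable def rightInvariantField {B G : Type u} (S : GroupoidMaps B G) (𝒢 : BanachAtlas G)
    (X : ∀ b, 𝒢.TangentAt (S.unit b)) (g : G) : 𝒢.TangentAt g :=
  S.rightTranslate 𝒢 g (X (S.tgt g))

/-- The bracket of sections of the algebroid: the Lie bracket of the right invariant vector
fields, at the units. -/
noncomputable def algebroidBracket {B G : Type u} (S : GroupoidMaps B G) (𝒢 : BanachAtlas G)
    (X Y : ∀ b, 𝒢.TangentAt (S.unit b)) (b : B) : 𝒢.TangentAt (S.unit b) :=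
  𝒢.fieldBracket (S.rightInvariantField 𝒢 X) (S.rightInvariantField 𝒢 Y) (S.unit b)

end GroupoidMaps

/-! ## Partially invertible elements -/

namespace PartialInv

open BanachAtlas

variable {M : Type u} [CStarAlgebra M]

/-- `|x| = (x* x)^{1/2}`. -/
noncomputable def absVal (x : M) : M := cfc Real.sqrt (star x * x)

/-- `p` is the smallest projection with `x p = x`. -/
def IsRightSupport (x p : M) : Prop :=
  IsStarProjection p ∧ x * p = x ∧ ∀ e, IsStarProjection e → x * e = x → p * e = p

/-- `q` is the smallest projection with `q x = x`. -/
def IsLeftSupport (x q : M) : Prop :=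
  IsStarProjection q ∧ q * x = x ∧ ∀ e, IsStarProjection e → e * x = x → e * q = q

open Classical in
/-- The right support (in a `W*`-algebra every element has one). -/
noncomputable def rightSupport (x : M) : M := if h : ∃ p, IsRightSupport x p then h.choose else 0

open Classical in
/-- The left support (in a `W*`-algebra every element has one). -/
noncomputable def leftSupport (x : M) : M := if h : ∃ q, IsLeftSupport x q then h.choose else 0

/-- The closed subspace `a M b`, for projections `a` and `b`. -/
def corner (a b : M) : Submodule ℂ M where
  carrier := {x | a * x = x ∧ x * b = x}
  add_mem' := by
    rintro x y ⟨h1, h2⟩ ⟨h3, h4⟩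
    exact ⟨by rw [mul_add, h1, h3], by rw [add_mul, h2, h4]⟩
  zero_mem' := by simp
  smul_mem' := by
    rintro c x ⟨h1, h2⟩
    exact ⟨by rw [mul_smul_comm, h1], by rw [smul_mul_assoc, h2]⟩

theorem mem_corner {a b x : M} : x ∈ corner a b ↔ a * x = x ∧ x * b = x := Iff.rfl

theorem mem_corner_iff_exists {a b : M} (ha : IsIdempotentElem a) (hb : IsIdempotentElem b)
    {x : M} : x ∈ corner a b ↔ ∃ m, x = a * m * b := by
  constructor
  · rintro ⟨h1, h2⟩
    exact ⟨x, by rw [h1, h2]⟩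
  · rintro ⟨m, rfl⟩
    refine ⟨?_, ?_⟩
    · rw [← mul_assoc, ← mul_assoc, ha.eq]
    · rw [mul_assoc, hb.eq]

instance completeSpace_corner (a b : M) : CompleteSpace (corner a b) := by
  have h : IsClosed ((corner a b : Submodule ℂ M) : Set M) := by
    have h1 : IsClosed {x : M | a * x = x} := isClosed_eq (by fun_prop) continuous_id
    have h2 : IsClosed {x : M | x * b = x} := isClosed_eq (by fun_prop) continuous_id
    exact h1.inter h2
  exact h.completeSpace_coe

/-- `x` is partially invertible: `|x|` is invertible in the algebra `p M p`, where `p` is the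
support of `|x|`. -/
def PartiallyInvertible (x : M) : Prop :=
  ∃ p, IsRightSupport (absVal x) p ∧
    ∃ w ∈ corner p p, w * absVal x = p ∧ absVal x * w = p

/-- The inverse of `|x|` in the algebra `p M p`, where `p` is the support of `|x|`. -/
noncomputable def absInv (x : M) (h : PartiallyInvertible x) : M := h.choose_spec.2.choose

open Classical in
/-- `x⁻¹ = |x|⁻¹ u*` where `x = u |x|`, `u = x |x|⁻¹`, is the polar decomposition. -/
noncomputable def pinv (x : M) : M :=
  if h : PartiallyInvertible x then absInv x h * star (x * absInv x h) else 0

/-- `y` is the inverse of `x`, which has right support `p` and left support `q`. -/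
structure IsInverse (x y p q : M) : Prop where
  hp : IsStarProjection p
  hq : IsStarProjection q
  yx : y * x = p
  xy : x * y = q
  xp : x * p = x
  py : p * y = y

theorem IsRightSupport.unique {x p p' : M} (h : IsRightSupport x p) (h' : IsRightSupport x p') :
    p = p' := by
  have h1 : p * p' = p := h.2.2 p' h'.1 h'.2.1
  have h2 : p' * p = p' := h'.2.2 p h.1 h.2.1
  have h3 := congrArg star h1
  rw [star_mul, h.1.isSelfAdjoint.star_eq, h'.1.isSelfAdjoint.star_eq] at h3
  rw [← h3, h2]

theorem IsLeftSupport.unique {x p p' : M} (h : IsLeftSupport x p) (h' : IsLeftSupport x p') :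
    p = p' := by
  have h1 : p' * p = p := h.2.2 p' h'.1 h'.2.1
  have h2 : p * p' = p' := h'.2.2 p h.1 h.2.1
  have h3 := congrArg star h1
  rw [star_mul, h.1.isSelfAdjoint.star_eq, h'.1.isSelfAdjoint.star_eq] at h3
  rw [← h3, h2]

theorem rightSupport_eq {x p : M} (h : IsRightSupport x p) : rightSupport x = p := by
  have h' : ∃ p, IsRightSupport x p := ⟨p, h⟩
  unfold rightSupport
  rw [dif_pos h']
  exact h'.choose_spec.unique h

theorem leftSupport_eq {x p : M} (h : IsLeftSupport x p) : leftSupport x = p := by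
  have h' : ∃ p, IsLeftSupport x p := ⟨p, h⟩
  unfold leftSupport
  rw [dif_pos h']
  exact h'.choose_spec.unique h

theorem absVal_isSelfAdjoint (x : M) : IsSelfAdjoint (absVal x) :=
  cfc_predicate Real.sqrt (star x * x)

theorem absVal_mul_absVal (x : M) : absVal x * absVal x = star x * x := by
  have hsa : IsSelfAdjoint (star x * x) := IsSelfAdjoint.star_mul_self x
  unfold absVal
  rw [← cfc_mul Real.sqrt Real.sqrt (star x * x)]
  conv_rhs => rw [← cfc_id ℝ (star x * x)]
  apply cfc_congr
  intro t ht
  exact Real.mul_self_sqrt (spectrum_star_mul_self_nonneg t ht)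

namespace IsInverse

variable {x y p q x' y' p' q' : M}

theorem qx (h : IsInverse x y p q) : q * x = x := by rw [← h.xy, mul_assoc, h.yx, h.xp]

theorem yq (h : IsInverse x y p q) : y * q = y := by rw [← h.xy, ← mul_assoc, h.yx, h.py]

theorem symm (h : IsInverse x y p q) : IsInverse y x q p :=
  ⟨h.hq, h.hp, h.xy, h.yx, h.yq, h.qx⟩

theorem mul (h : IsInverse x y p q) (h' : IsInverse x' y' p' p) :
    IsInverse (x * x') (y' * y) p' q where
  hp := h'.hp
  hq := h.hq
  yx := by rw [mul_assoc, ← mul_assoc y, h.yx, h'.qx, h'.yx]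
  xy := by rw [mul_assoc, ← mul_assoc x', h'.xy, h.py, h.xy]
  xp := by rw [mul_assoc, h'.xp]
  py := by rw [← mul_assoc, h'.py]

theorem of_isStarProjection (hp : IsStarProjection p) : IsInverse p p p p :=
  ⟨hp, hp, hp.isIdempotentElem.eq, hp.isIdempotentElem.eq, hp.isIdempotentElem.eq,
    hp.isIdempotentElem.eq⟩

theorem isRightSupport (h : IsInverse x y p q) : IsRightSupport x p :=
  ⟨h.hp, h.xp, fun e _ he => by rw [← h.yx, mul_assoc, he]⟩

theorem isLeftSupport (h : IsInverse x y p q) : IsLeftSupport x q :=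
  ⟨h.hq, h.qx, fun e _ he => by rw [← h.xy, ← mul_assoc, he]⟩

theorem rightSupport_eq (h : IsInverse x y p q) : rightSupport x = p :=
  PartialInv.rightSupport_eq h.isRightSupport

theorem leftSupport_eq (h : IsInverse x y p q) : leftSupport x = q :=
  PartialInv.leftSupport_eq h.isLeftSupport

theorem unique (h : IsInverse x y p q) (h' : IsInverse x y' p q) : y = y' := by
  rw [← h.yq, ← h'.xy, ← mul_assoc, h.yx, h'.py]

theorem partiallyInvertible (h : IsInverse x y p q) : PartiallyInvertible x := by
  have hps : star p = p := h.hp.isSelfAdjoint.star_eq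
  have hpp : p * p = p := h.hp.isIdempotentElem.eq
  have has : star (absVal x) = absVal x := (absVal_isSelfAdjoint x).star_eq
  have haa := absVal_mul_absVal x
  set a := absVal x with ha
  obtain ⟨v, hv⟩ : ∃ v, v = y * star y := ⟨_, rfl⟩
  have hpx : p * star x = star x := by
    have := congrArg star h.xp
    rwa [star_mul, hps] at this
  have hap : a * p = a := by
    have h1 : star (a - a * p) * (a - a * p) = 0 := by
      have h2 : (a - a * p) = a * (1 - p) := by rw [mul_sub, mul_one]
      have h3 : x * (1 - p) = 0 := by rw [mul_sub, mul_one, h.xp, sub_self]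
      rw [h2, star_mul, has, mul_assoc, ← mul_assoc a a, haa, mul_assoc (star x), h3, mul_zero,
        mul_zero]
    exact (sub_eq_zero.1 ((CStarRing.star_mul_self_eq_zero_iff _).1 h1)).symm
  have hpa : p * a = a := by
    have := congrArg star hap
    rwa [star_mul, hps, has] at this
  have hpv : p * v = v := by rw [hv, ← mul_assoc, h.py]
  have hvp : v * p = v := by
    have := congrArg star hpv
    rwa [star_mul, hps, hv, star_mul, star_star, ← hv] at this
  have haav : a * a * v = p := by
    rw [haa, hv, mul_assoc, ← mul_assoc x, h.xy]
    have h1 : star y * star x = q := by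
      rw [← star_mul, h.xy, h.hq.isSelfAdjoint.star_eq]
    have h2 : star x * star y = p := by
      rw [← star_mul, h.yx, hps]
    have h3 : q * star y = star y * (star x * star y) := by rw [← mul_assoc, h1]
    rw [h3, ← mul_assoc, h2, hpp]
  have hvaa : v * (a * a) = p := by
    have h1 := congrArg star haav
    rw [star_mul, star_mul, has, hps] at h1
    have hvs : star v = v := by rw [hv, star_mul, star_star]
    rw [hvs] at h1
    exact h1
  have hcomm : a * v = v * a := by
    calc a * v = p * (a * v) := by rw [← mul_assoc, hpa]
      _ = v * a * (a * a * v) := by rw [← hvaa]; simp only [mul_assoc]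
      _ = v * a := by rw [haav, mul_assoc, hap]
  refine ⟨p, ⟨h.hp, hap, ?_⟩, a * v, ⟨?_, ?_⟩, ?_, ?_⟩
  · intro e _ he
    rw [← hvaa, mul_assoc, mul_assoc, ha, he]
  · rw [← mul_assoc, hpa]
  · rw [mul_assoc, hvp]
  · rw [mul_assoc, ← hcomm, ← mul_assoc, haav]
  · rw [← mul_assoc, haav]

end IsInverse

theorem absInv_spec (x : M) (h : PartiallyInvertible x) :
    ∃ p, IsRightSupport (absVal x) p ∧ absInv x h ∈ corner p p ∧
      absInv x h * absVal x = p ∧ absVal x * absInv x h = p :=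
  ⟨h.choose, h.choose_spec.1, h.choose_spec.2.choose_spec⟩

theorem absInv_polar (x : M) (h : PartiallyInvertible x) :
    x * absInv x h * absVal x = x ∧
      IsInverse (x * absInv x h) (star (x * absInv x h)) (absInv x h * absVal x)
        (x * absInv x h * star (x * absInv x h)) := by
  obtain ⟨p, hp, hw, hwa, haw⟩ := absInv_spec x h
  have hps : star p = p := hp.1.isSelfAdjoint.star_eq
  have hpp : p * p = p := hp.1.isIdempotentElem.eq
  have has : star (absVal x) = absVal x := (absVal_isSelfAdjoint x).star_eq
  have haa := absVal_mul_absVal x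
  set a := absVal x with ha
  set w := absInv x h with hwdef
  have hxp : x * p = x := by
    have h1 : star (x - x * p) * (x - x * p) = 0 := by
      have h2 : (x - x * p) = x * (1 - p) := by rw [mul_sub, mul_one]
      have h3 : a * (1 - p) = 0 := by rw [mul_sub, mul_one, hp.2.1, sub_self]
      rw [h2, star_mul, mul_assoc, ← mul_assoc (star x), ← haa, mul_assoc a, h3, mul_zero,
        mul_zero]
    exact (sub_eq_zero.1 ((CStarRing.star_mul_self_eq_zero_iff _).1 h1)).symm
  have hwa' : star w * a = p := by
    have := congrArg star haw
    rwa [star_mul, has, hps] at this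
  have huu : star (x * w) * (x * w) = p := by
    rw [star_mul, mul_assoc, ← mul_assoc (star x), ← haa, mul_assoc a, haw, ← mul_assoc, hwa', hpp]
  have hup : x * w * p = x * w := by rw [mul_assoc, hw.2]
  have hpu : p * star (x * w) = star (x * w) := by
    have := congrArg star hup
    rwa [star_mul, hps] at this
  refine ⟨by rw [mul_assoc, hwa, hxp], ?_⟩
  rw [hwa]
  refine ⟨hp.1, ⟨?_, ?_⟩, huu, rfl, hup, hpu⟩
  · change x * w * star (x * w) * (x * w * star (x * w)) = x * w * star (x * w)
    rw [mul_assoc, ← mul_assoc (star (x * w)), huu, hpu]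
  · rw [isSelfAdjoint_iff, star_mul, star_star]

theorem isInverse_pinv {x : M} (h : PartiallyInvertible x) :
    IsInverse x (pinv x) (rightSupport x) (leftSupport x) := by
  obtain ⟨h1, h2⟩ := absInv_polar x h
  obtain ⟨p, hp, hw, hwa, haw⟩ := absInv_spec x h
  have key : IsInverse x (pinv x) p (x * absInv x h * star (x * absInv x h)) := by
    have hpin : pinv x = absInv x h * star (x * absInv x h) := by
      unfold pinv
      rw [dif_pos h]
    rw [hwa] at h2
    refine ⟨h2.hp, h2.hq, ?_, ?_, ?_, ?_⟩
    · rw [hpin]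
      have h3 : star (x * absInv x h) * x = p * absVal x := by
        rw [← h2.yx, mul_assoc (star (x * absInv x h)), h1]
      rw [mul_assoc, h3, ← mul_assoc, hw.2, hwa]
    · rw [hpin, ← mul_assoc]
    · have h3 : x * absInv x h * absVal x * p = x * absInv x h * absVal x := by
        rw [mul_assoc, hp.2.1]
      rwa [h1] at h3
    · rw [hpin, ← mul_assoc, hw.1]
  rw [key.rightSupport_eq, key.leftSupport_eq]
  exact key

/-! ## The transitive groupoid of partially invertible elements -/

/-- The orbit of `p₀`: the left supports of the partially invertible elements with right
support `p₀`. -/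
def orbit (p₀ : M) : Set M :=
  {q | ∃ x, PartiallyInvertible x ∧ rightSupport x = p₀ ∧ leftSupport x = q}

/-- The partially invertible elements whose left and right supports are in the orbit of `p₀`. -/
def arrows (p₀ : M) : Set M :=
  {x | PartiallyInvertible x ∧ leftSupport x ∈ orbit p₀ ∧ rightSupport x ∈ orbit p₀}

/-- The elements of the groupoid with right support `p₀`. -/
def bundle (p₀ : M) : Set M := {η | η ∈ arrows p₀ ∧ rightSupport η = p₀}

/-- The group of invertible elements of the algebra `p₀ M p₀`. -/
def unitGroup (p₀ : M) : Set M :=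
  {g | g ∈ corner p₀ p₀ ∧ ∃ h ∈ corner p₀ p₀, g * h = p₀ ∧ h * g = p₀}

theorem isStarProjection_of_mem_orbit {p₀ q : M} (h : q ∈ orbit p₀) : IsStarProjection q := by
  obtain ⟨x, hx, -, rfl⟩ := h
  exact (isInverse_pinv hx).hq

theorem IsInverse.mem_arrows {x y p q p₀ : M} (h : IsInverse x y p q) (hp : p ∈ orbit p₀)
    (hq : q ∈ orbit p₀) : x ∈ arrows p₀ :=
  ⟨h.partiallyInvertible, by rwa [h.leftSupport_eq], by rwa [h.rightSupport_eq]⟩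

open Classical in
/-- The groupoid of partially invertible elements over the orbit of `p₀`: the target and source
are the left and right supports, the product is the product of `M` restricted to the composable
pairs, and the inverse is `pinv`. -/
noncomputable def groupoid (p₀ : M) : GroupoidMaps (orbit p₀) (arrows p₀) where
  src x := ⟨rightSupport x.1, x.2.2.2⟩
  tgt x := ⟨leftSupport x.1, x.2.2.1⟩
  unit q := ⟨q.1, (IsInverse.of_isStarProjection
    (isStarProjection_of_mem_orbit q.2)).mem_arrows q.2 q.2⟩
  inv x := ⟨pinv x.1, (isInverse_pinv x.2.1).symm.mem_arrows x.2.2.1 x.2.2.2⟩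
  mul x y := if h : rightSupport x.1 = leftSupport y.1 then
      ⟨x.1 * y.1, ((isInverse_pinv x.2.1).mul (h ▸ isInverse_pinv y.2.1)).mem_arrows
        y.2.2.2 x.2.2.1⟩
    else x

/-! ### The atlases -/

/-- The right ideal `q M`. -/
noncomputable def rightIdeal (q : M) : Submodule ℂ M := LinearMap.range (LinearMap.mulLeft ℂ q)

/-- The set `Π_p`: the splitting `M = q M ⊕ (1 - p) M` holds. -/
def Splits (p q : M) : Prop := IsCompl (rightIdeal q) (rightIdeal (1 - p))

open Classical in
/-- The component `σ_p(q)` in `q M` of `p`, for `q` in `Π_p`. -/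
noncomputable def sigma (p q : M) : M :=
  if h : Splits p q then (rightIdeal q).projection (rightIdeal (1 - p)) h p else 0

theorem sigma_spec {p q : M} (hp : IsStarProjection p) (hq : IsStarProjection q)
    (h : Splits p q) : IsInverse (sigma p q) (p * q) p q ∧ p * sigma p q = p := by
  have hpp : p * p = p := hp.isIdempotentElem.eq
  have hqq : q * q = q := hq.isIdempotentElem.eq
  have hs : sigma p q = (rightIdeal q).projection (rightIdeal (1 - p)) h p := by
    unfold sigma
    rw [dif_pos h]
  have h1 : sigma p q ∈ rightIdeal q := by
    rw [hs]
    exact Submodule.projection_apply_mem h p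
  have h2 : sigma p q - p ∈ rightIdeal (1 - p) := by
    rw [hs]
    refine (Submodule.projection_apply_eq_zero_iff h).1 ?_
    rw [map_sub, sub_eq_zero]
    exact Submodule.projection_apply_of_mem_left h (Submodule.projection_apply_mem h p)
  have hl : ∀ {e m : M}, e * e = e → m ∈ rightIdeal e → e * m = m := by
    rintro e m he ⟨n, rfl⟩
    simp only [LinearMap.mulLeft_apply]
    rw [← mul_assoc, he]
  have hr : ∀ {e m : M}, e * m = m → m ∈ rightIdeal e := fun {e m} he => ⟨m, he⟩
  have hp1 : (1 - p) * (1 - p) = 1 - p := hp.one_sub.isIdempotentElem.eq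
  have hqs : q * sigma p q = sigma p q := hl hqq h1
  have hps : p * sigma p q = p := by
    have h3 := hl hp1 h2
    rw [sub_mul, one_mul, sub_eq_self, mul_sub, hpp, sub_eq_zero] at h3
    exact h3
  have hdis : ∀ m, q * m = m → p * m = 0 → m = 0 := by
    intro m h3 h4
    have h5 : m ∈ rightIdeal q ⊓ rightIdeal (1 - p) :=
      ⟨hr h3, hr (by rw [sub_mul, one_mul, h4, sub_zero])⟩
    rw [h.inf_eq_bot] at h5
    exact h5
  have hsp : sigma p q * p = sigma p q := by
    rw [← sub_eq_zero]
    apply hdis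
    · rw [mul_sub, ← mul_assoc, hqs]
    · rw [mul_sub, ← mul_assoc, hps, hpp, sub_self]
  have hsq : sigma p q * q = q := by
    rw [← sub_eq_zero]
    apply hdis
    · rw [mul_sub, ← mul_assoc, hqs, hqq]
    · rw [mul_sub, ← mul_assoc, hps, sub_self]
  refine ⟨⟨hp, hq, by rw [mul_assoc, hqs, hps], by rw [← mul_assoc, hsp, hsq], hsp,
    by rw [← mul_assoc, hpp]⟩, hps⟩

open Classical in
/-- The chart `φ_p : Π_p → (1 - p) M p`, where `p = σ_p(q) - φ_p(q)`. -/
noncomputable def phi (p q : M) (hp : IsStarProjection p) (hq : IsStarProjection q) :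
    corner (1 - p) p :=
  if h : Splits p q then ⟨sigma p q - p, by
    obtain ⟨h1, h2⟩ := sigma_spec hp hq h
    have hpp : p * p = p := hp.isIdempotentElem.eq
    exact ⟨by rw [sub_mul, one_mul, mul_sub, h2, hpp, sub_self, sub_zero],
      by rw [sub_mul, h1.xp, hpp]⟩⟩
  else 0

/-- The atlas of the orbit of `p₀`, with charts `φ_p : Π_p → (1 - p) M p`. -/
noncomputable def orbitAtlas (p₀ : M) : BanachAtlas (orbit p₀) where
  ι := orbit p₀
  E p := corner (1 - p.1) p.1
  source p := {q | Splits p.1 q.1}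
  chart p q := phi p.1 q.1 (isStarProjection_of_mem_orbit p.2) (isStarProjection_of_mem_orbit q.2)
  chartAt q := q

open Classical in
/-- The middle coordinate `σ_p'(l(x))⁻¹ x σ_p(r(x))`, with values in `p' M p`, of the chart of the
groupoid indexed by `(p', p)`. -/
noncomputable def middle {p₀ : M} (p' p : orbit p₀) (x : arrows p₀) : corner p'.1 p.1 :=
  if h : Splits p'.1 (leftSupport x.1) ∧ Splits p.1 (rightSupport x.1) then
    ⟨pinv (sigma p'.1 (leftSupport x.1)) * x.1 * sigma p.1 (rightSupport x.1), by
      have h1 := (sigma_spec (isStarProjection_of_mem_orbit p'.2)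
        (isStarProjection_of_mem_orbit x.2.2.1) h.1).1
      have h2 := (sigma_spec (isStarProjection_of_mem_orbit p.2)
        (isStarProjection_of_mem_orbit x.2.2.2) h.2).1
      have h3 := isInverse_pinv h1.partiallyInvertible
      rw [h1.rightSupport_eq] at h3
      refine ⟨?_, ?_⟩
      · rw [← mul_assoc, ← mul_assoc, h3.py]
      · rw [mul_assoc, h2.xp]⟩
  else 0

/-- The atlas of the groupoid, with charts
`x ↦ (φ_p'(l(x)), σ_p'(l(x))⁻¹ x σ_p(r(x)), φ_p(r(x)))` on `l⁻¹(Π_p') ∩ r⁻¹(Π_p)`. -/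
noncomputable def arrowAtlas (p₀ : M) : BanachAtlas (arrows p₀) where
  ι := orbit p₀ × orbit p₀
  E i := corner (1 - i.1.1) i.1.1 × corner i.1.1 i.2.1 × corner (1 - i.2.1) i.2.1
  source i := {x | Splits i.1.1 (leftSupport x.1) ∧ Splits i.2.1 (rightSupport x.1)}
  chart i x :=
    ((orbitAtlas p₀).chart i.1 ((groupoid p₀).tgt x), middle i.1 i.2 x,
      (orbitAtlas p₀).chart i.2 ((groupoid p₀).src x))
  chartAt x := ((groupoid p₀).tgt x, (groupoid p₀).src x)

theorem mem_corner_of_mem_bundle {p₀ η : M} (h : η ∈ bundle p₀) : η ∈ corner 1 p₀ := by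
  refine ⟨one_mul η, ?_⟩
  have h1 := (isInverse_pinv h.1.1).xp
  rwa [h.2] at h1

/-- The manifold structure of `P₀ = r⁻¹(p₀)` as a subset of the Banach space `M p₀`. -/
noncomputable def bundleAtlas (p₀ : M) : BanachAtlas (bundle p₀) where
  ι := PUnit
  E _ := corner 1 p₀
  source _ := Set.univ
  chart _ η := ⟨η.1, mem_corner_of_mem_bundle η.2⟩
  chartAt _ := PUnit.unit

/-! ### The gauge groupoid -/

theorem unitGroup_one {p₀ : M} (h : p₀ * p₀ = p₀) : p₀ ∈ unitGroup p₀ :=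
  ⟨⟨h, h⟩, p₀, ⟨h, h⟩, h, h⟩

theorem unitGroup_inv {p₀ g : M} (h : g ∈ unitGroup p₀) :
    ∃ g' ∈ unitGroup p₀, g * g' = p₀ ∧ g' * g = p₀ := by
  obtain ⟨h1, g', h2, h3, h4⟩ := h
  exact ⟨g', ⟨h2, g, h1, h4, h3⟩, h3, h4⟩

theorem unitGroup_mul {p₀ g h : M} (hg : g ∈ unitGroup p₀) (hh : h ∈ unitGroup p₀) :
    g * h ∈ unitGroup p₀ := by
  obtain ⟨h1, g', h2, h3, h4⟩ := hg
  obtain ⟨k1, h', k2, k3, k4⟩ := hh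
  refine ⟨⟨by rw [← mul_assoc, h1.1], by rw [mul_assoc, k1.2]⟩, h' * g',
    ⟨by rw [← mul_assoc, k2.1], by rw [mul_assoc, h2.2]⟩, ?_, ?_⟩
  · rw [mul_assoc, ← mul_assoc h, k3, h2.1, h3]
  · rw [mul_assoc, ← mul_assoc g', h4, k1.1, k4]

theorem bundle_idem {p₀ : M} (η : bundle p₀) : p₀ * p₀ = p₀ := by
  have h1 := (isInverse_pinv η.2.1.1).hp.isIdempotentElem.eq
  rwa [η.2.2] at h1

theorem bundle_mul {p₀ : M} (η : bundle p₀) : η.1 * p₀ = η.1 :=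
  (mem_corner_of_mem_bundle η.2).2

/-- The orbits in `P₀` of the action `(η, g) ↦ η g` of the group of invertible elements. -/
def bundleSetoid (p₀ : M) : Setoid (bundle p₀) where
  r η η' := ∃ g ∈ unitGroup p₀, η'.1 = η.1 * g
  iseqv := by
    refine ⟨fun η => ⟨p₀, unitGroup_one (bundle_idem η), (bundle_mul η).symm⟩, ?_, ?_⟩
    · rintro η η' ⟨g, hg, h⟩
      obtain ⟨g', hg', h1, -⟩ := unitGroup_inv hg
      exact ⟨g', hg', by rw [h, mul_assoc, h1, bundle_mul]⟩
    · rintro η η' η'' ⟨g, hg, h⟩ ⟨k, hk, h'⟩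
      exact ⟨g * k, unitGroup_mul hg hk, by rw [h', h, mul_assoc]⟩

/-- The orbits in `P₀ × P₀` of the action `((η, ξ), g) ↦ (η g, ξ g)`. -/
def pairSetoid (p₀ : M) : Setoid (bundle p₀ × bundle p₀) where
  r a b := ∃ g ∈ unitGroup p₀, b.1.1 = a.1.1 * g ∧ b.2.1 = a.2.1 * g
  iseqv := by
    refine ⟨fun a => ⟨p₀, unitGroup_one (bundle_idem a.1), (bundle_mul a.1).symm,
      (bundle_mul a.2).symm⟩, ?_, ?_⟩
    · rintro a b ⟨g, hg, h, k⟩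
      obtain ⟨g', hg', h1, -⟩ := unitGroup_inv hg
      exact ⟨g', hg', by rw [h, mul_assoc, h1, bundle_mul], by rw [k, mul_assoc, h1, bundle_mul]⟩
    · rintro a b c ⟨g, hg, h, k⟩ ⟨g', hg', h', k'⟩
      exact ⟨g * g', unitGroup_mul hg hg', by rw [h', h, mul_assoc], by rw [k', k, mul_assoc]⟩

/-- The orbits in `T P₀` (whose fibres are the Banach space `M p₀`) of the action
`((ϑ, η), g) ↦ (ϑ g, η g)`, the tangent of the action on `P₀`. -/
def tangentSetoid (p₀ : M) : Setoid (bundleAtlas p₀).TangentTotal where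
  r a b := ∃ g ∈ unitGroup p₀, b.1.1 = a.1.1 * g ∧
    (show corner 1 p₀ from b.2).1 = (show corner 1 p₀ from a.2).1 * g
  iseqv := by
    have hm : ∀ v : corner 1 p₀, v.1 * p₀ = v.1 := fun v => v.2.2
    refine ⟨fun a => ⟨p₀, unitGroup_one (bundle_idem a.1), (bundle_mul a.1).symm,
      (hm _).symm⟩, ?_, ?_⟩
    · rintro a b ⟨g, hg, h, k⟩
      obtain ⟨g', hg', h1, -⟩ := unitGroup_inv hg
      exact ⟨g', hg', by rw [h, mul_assoc, h1, bundle_mul], by rw [k, mul_assoc, h1, hm]⟩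
    · rintro a b c ⟨g, hg, h, k⟩ ⟨g', hg', h', k'⟩
      exact ⟨g * g', unitGroup_mul hg hg', by rw [h', h, mul_assoc], by rw [k', k, mul_assoc]⟩

/-- The class `[η]` in `P₀ / G₀`. -/
abbrev cls {p₀ : M} (η : bundle p₀) : Quotient (bundleSetoid p₀) := Quotient.mk _ η

/-- The class `⟨η, ξ⟩` in `(P₀ × P₀) / G₀`. -/
abbrev pairCls {p₀ : M} (η ξ : bundle p₀) : Quotient (pairSetoid p₀) := Quotient.mk _ (η, ξ)

/-- The class `[(ϑ, η)]` in `T P₀ / G₀`. -/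
abbrev tangentCls {p₀ : M} (η : bundle p₀) (ϑ : (bundleAtlas p₀).TangentAt η) :
    Quotient (tangentSetoid p₀) := Quotient.mk _ ⟨η, ϑ⟩

open Classical in
/-- The gauge groupoid `(P₀ × P₀) / G₀ ⇉ P₀ / G₀` of the principal bundle `P₀`; the product is
`⟨η, ξ⟩ ⟨ξ, κ⟩ = ⟨η, κ⟩`. -/
noncomputable def gaugeGroupoid (p₀ : M) :
    GroupoidMaps (Quotient (bundleSetoid p₀)) (Quotient (pairSetoid p₀)) where
  src := Quotient.lift (fun a => cls a.2) (by
    rintro a b ⟨g, hg, -, h⟩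
    exact Quotient.sound ⟨g, hg, h⟩)
  tgt := Quotient.lift (fun a => cls a.1) (by
    rintro a b ⟨g, hg, h, -⟩
    exact Quotient.sound ⟨g, hg, h⟩)
  unit := Quotient.lift (fun η => pairCls η η) (by
    rintro a b ⟨g, hg, h⟩
    exact Quotient.sound ⟨g, hg, h, h⟩)
  inv := Quotient.lift (fun a => pairCls a.2 a.1) (by
    rintro a b ⟨g, hg, h, k⟩
    exact Quotient.sound ⟨g, hg, k, h⟩)
  mul a b := if h : ∃ t : bundle p₀ × bundle p₀ × bundle p₀,
      a = pairCls t.1 t.2.1 ∧ b = pairCls t.2.1 t.2.2 then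
    pairCls h.choose.1 h.choose.2.2 else a

/-- The product `⟨η, ξ⟩ ⟨lam, κ⟩ = ⟨η, κ g⟩`, where `ξ = lam g`, is well defined. -/
theorem gaugeGroupoid_mul {p₀ : M} (η ξ lam κ κ' : bundle p₀) {g : M} (hg : g ∈ unitGroup p₀)
    (h : ξ.1 = lam.1 * g) (h' : κ'.1 = κ.1 * g) :
    (gaugeGroupoid p₀).mul (pairCls η ξ) (pairCls lam κ) = pairCls η κ' := by
  have h0 : pairCls lam κ = pairCls ξ κ' := Quotient.sound ⟨g, hg, h, h'⟩
  rw [h0]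
  have hex : ∃ t : bundle p₀ × bundle p₀ × bundle p₀,
      pairCls η ξ = pairCls t.1 t.2.1 ∧ pairCls ξ κ' = pairCls t.2.1 t.2.2 :=
    ⟨(η, ξ, κ'), rfl, rfl⟩
  have hm : (gaugeGroupoid p₀).mul (pairCls η ξ) (pairCls ξ κ')
      = pairCls hex.choose.1 hex.choose.2.2 := dif_pos hex
  rw [hm]
  obtain ⟨h1, h2⟩ := hex.choose_spec
  obtain ⟨a, ha, a1, a2⟩ := Quotient.exact h1
  obtain ⟨b, hb, b1, b2⟩ := Quotient.exact h2
  have hab : a = b := by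
    have h3 : ξ.1 * a = ξ.1 * b := a2.symm.trans b1
    have h4 := (isInverse_pinv ξ.2.1.1).yx
    rw [ξ.2.2] at h4
    have h5 := congrArg (pinv ξ.1 * ·) h3
    simp only [← mul_assoc, h4] at h5
    rwa [ha.1.1, hb.1.1] at h5
  subst hab
  have h6 : pairCls η κ' = pairCls hex.choose.1 hex.choose.2.2 := Quotient.sound ⟨a, ha, a1, b2⟩
  exact h6.symm

/-- The bundle projection `P₀ → L_{p₀}(M)`, the left support. -/
noncomputable def bundleProj {p₀ : M} (η : bundle p₀) : orbit p₀ := ⟨leftSupport η.1, η.2.1.2.1⟩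

/-! ### The Atiyah algebroid and the algebroid of the groupoid -/

/-- A real smooth `G₀`-invariant vector field `ϑ` on the preimage of `U` in `P₀`, that is, a smooth
section over `U` of the Atiyah algebroid `T P₀ / G₀`; the values of `ϑ` elsewhere are irrelevant.
The bracket of such sections is the bracket of vector fields on `P₀`. -/
def IsAtiyahSection {p₀ : M} (U : Set (orbit p₀)) (ϑ : ∀ η, (bundleAtlas p₀).TangentAt η) : Prop :=
  RealSmoothOn (bundleAtlas p₀) (bundleAtlas p₀).tangentAtlas (fun η => ⟨η, ϑ η⟩)
      {η | bundleProj η ∈ U} ∧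
    ∀ η η' : bundle p₀, bundleProj η ∈ U → ∀ g ∈ unitGroup p₀, η'.1 = η.1 * g →
      (show corner 1 p₀ from ϑ η').1 = (show corner 1 p₀ from ϑ η).1 * g

/-- A real smooth section `X` over `U` of the algebroid of the groupoid; the values of `X`
elsewhere are irrelevant. -/
def IsAlgebroidSection {p₀ : M} (U : Set (orbit p₀))
    (X : ∀ q, (arrowAtlas p₀).TangentAt ((groupoid p₀).unit q)) : Prop :=
  RealSmoothOn (orbitAtlas p₀) (arrowAtlas p₀).tangentAtlas
      (fun q => ⟨(groupoid p₀).unit q, X q⟩) U ∧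
    ∀ q ∈ U, (⟨(groupoid p₀).unit q, X q⟩ : (arrowAtlas p₀).TangentTotal) ∈
      (groupoid p₀).algebroid (orbitAtlas p₀) (arrowAtlas p₀)

/-- Over `U` the map `Φ` carries the section `ϑ` of `T P₀ / G₀` to the section `X`. -/
def CarriesSection {p₀ : M} (Φ : Quotient (tangentSetoid p₀) → (arrowAtlas p₀).TangentTotal)
    (U : Set (orbit p₀)) (ϑ : ∀ η, (bundleAtlas p₀).TangentAt η)
    (X : ∀ q, (arrowAtlas p₀).TangentAt ((groupoid p₀).unit q)) : Prop :=
  ∀ η, bundleProj η ∈ U →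
    Φ (tangentCls η (ϑ η)) = ⟨(groupoid p₀).unit (bundleProj η), X (bundleProj η)⟩

/-- `Φ : T P₀ / G₀ → T G_{p₀}(M)` is an isomorphism of Banach-Lie algebroids, covering
`φ₀ : P₀ / G₀ → L_{p₀}(M)`, of the Atiyah algebroid `T P₀ / G₀` onto the algebroid of the groupoid
of partially invertible elements. -/
structure IsAlgebroidIso (p₀ : M) (𝒬₀ : BanachAtlas (Quotient (bundleSetoid p₀)))
    (𝒬₂ : BanachAtlas (Quotient (tangentSetoid p₀)))
    (φ₀ : Quotient (bundleSetoid p₀) → orbit p₀)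
    (Φ : Quotient (tangentSetoid p₀) → (arrowAtlas p₀).TangentTotal) : Prop where
  /-- `Φ` is a biholomorphic map onto the algebroid. -/
  injective : Function.Injective Φ
  range_eq : Set.range Φ = (groupoid p₀).algebroid (orbitAtlas p₀) (arrowAtlas p₀)
  holomorphic : Holomorphic 𝒬₂ (arrowAtlas p₀).tangentAtlas Φ
  inverse_holomorphic : ∃ Ψ : (arrowAtlas p₀).TangentTotal → Quotient (tangentSetoid p₀),
    Function.LeftInverse Ψ Φ ∧ HolomorphicOn (arrowAtlas p₀).tangentAtlas 𝒬₂ Ψ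
      ((groupoid p₀).algebroid (orbitAtlas p₀) (arrowAtlas p₀))
  /-- `Φ` maps the fibre over `[η]` linearly to the fibre over `φ₀ [η]`. -/
  fibre_linear : ∀ η : bundle p₀, ∃ q : arrows p₀, q = (groupoid p₀).unit (φ₀ (cls η)) ∧
    ∃ L : (bundleAtlas p₀).TangentAt η →L[ℂ] (arrowAtlas p₀).TangentAt q,
      ∀ ϑ, Φ (tangentCls η ϑ) = ⟨q, L ϑ⟩
  /-- `Φ` intertwines the anchors, which are induced by the quotient map `P₀ → P₀ / G₀` and by the
  target map. -/
  anchor : ∀ (η : bundle p₀) (ϑ : (bundleAtlas p₀).TangentAt η),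
    tangentTotalMap (arrowAtlas p₀) (orbitAtlas p₀) (groupoid p₀).tgt (Φ (tangentCls η ϑ)) =
      tangentTotalMap 𝒬₀ (orbitAtlas p₀) φ₀ (tangentTotalMap (bundleAtlas p₀) 𝒬₀ cls ⟨η, ϑ⟩)
  /-- Over each open set `U`, `Φ` identifies the smooth sections. -/
  exists_section : ∀ U, (orbitAtlas p₀).IsOpenSet U → ∀ ϑ, IsAtiyahSection U ϑ →
    ∃ X, IsAlgebroidSection U X ∧ CarriesSection Φ U ϑ X
  exists_field : ∀ U, (orbitAtlas p₀).IsOpenSet U → ∀ X, IsAlgebroidSection U X →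
    ∃ ϑ, IsAtiyahSection U ϑ ∧ CarriesSection Φ U ϑ X
  /-- `Φ` intertwines the brackets of smooth sections. -/
  bracket : ∀ U, (orbitAtlas p₀).IsOpenSet U → ∀ ϑ₁ ϑ₂ X₁ X₂,
    IsAtiyahSection U ϑ₁ → IsAtiyahSection U ϑ₂ → IsAlgebroidSection U X₁ →
    IsAlgebroidSection U X₂ → CarriesSection Φ U ϑ₁ X₁ → CarriesSection Φ U ϑ₂ X₂ →
      IsAtiyahSection U ((bundleAtlas p₀).fieldBracket ϑ₁ ϑ₂) ∧
      IsAlgebroidSection U ((groupoid p₀).algebroidBracket (arrowAtlas p₀) X₁ X₂) ∧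
      CarriesSection Φ U ((bundleAtlas p₀).fieldBracket ϑ₁ ϑ₂)
        ((groupoid p₀).algebroidBracket (arrowAtlas p₀) X₁ X₂)

end PartialInv

open BanachAtlas PartialInv

/-! Everything rests on the relation `IsInverse x y p q`, which treats `x` as an invertible arrow
from the projection `p` to the projection `q`. Two facts govern it. An element `x = x p` with a left
inverse, `y x = p`, is partially invertible (`exists_isInverse_of_mul_eq`), because `p ≤ ‖y‖² x* x`
makes `‖y‖² x* x + (1 - p)` invertible. And inside a fixed corner `p' M p`, near an element with
inverse `z`, the inverse of `x` is `(z x + 1 - p)⁻¹ z` (`IsInverse.of_isUnit`), which is analytic in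
`x`. The first fact is behind the openness of `P₀` in `M p₀`, the second behind the analyticity of
all the formulas in charts.

If `x` has left support `q`, then `q` lies in `Π_p` exactly when `p x` is an invertible arrow ending
at `p`, and then `σ_p(q) = x (p x)⁻¹` for every such `x` (`Splits.sigma_eq`). So chart domains
overlap in open sets, and the transition maps are built from products and inverses. Each `a` in `(1
- p) M p` is a coordinate, since `p` is a left inverse of `p + a`. The Hausdorff property comes from
the fact that `q = x (x* x + 1 - p)⁻¹ x*` depends continuously, though not holomorphically, on `x`.
In the charts of the arrows, source and target are coordinate projections, units have constant
middle coordinate, inversion inverts the middle coordinate, and composition multiplies middle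
coordinates.

The gauge side is compared with this through three surjective submersions whose fibres are exactly
the `G₀`-orbits: `η ↦ l(η)`, `(η, ξ) ↦ η ξ⁻¹`, and `(ϑ, η) ↦ ϑ η⁻¹`, the last one onto the bundle of
pairs `(q, A)` with `A` in `M q`. They have explicit local sections such as `a ↦ (p + a) η`. Pulling
back the atlas of the target gives the quotient structure (`exists_isQuotientManifold`). Any other
quotient structure agrees with it, since holomorphy of a map can be tested after composing with a
surjective submersion (`IsSubmersion.holomorphic_of_comp`). The groupoid axioms and the analyticity
of the gauge groupoid are then transported along the isomorphism.

For the algebroids, both `T P₀ / G₀` and the vectors at units tangent to the source fibres are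
identified with the same bundle of left ideals: the vector `(ϑ, η)` and its image both correspond to
`A = ϑ η⁻¹`. Right translation by `g` carries the vector given by `A` at the unit to the vector
given by `A` at `g` (`rightTranslate_arrowVec`). Therefore an invariant field on `P₀` and the
corresponding right invariant field are related by `ζ ↦ ζ ξ⁻¹` for every `ξ`, and brackets of
related fields are related (`lieBracket_of_related`). -/

namespace BanachAtlas

variable {X Y Z W : Type u} {𝒜 : BanachAtlas X} {ℬ : BanachAtlas Y} {𝒞 : BanachAtlas Z}
  {𝒟 : BanachAtlas W}

/-! ## Maps in charts -/

theorem localExpr_chart_of_injOn {i : 𝒜.ι} (h : Set.InjOn (𝒜.chart i) (𝒜.source i)) (f : X → Y)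
    (j : ℬ.ι) {x : X} (hx : x ∈ 𝒜.source i) :
    localExpr 𝒜 ℬ f i j (𝒜.chart i x) = ℬ.chart j (f x) := by
  have hinj : Function.Injective (fun x : 𝒜.source i => 𝒜.chart i x) :=
    fun a b hab => Subtype.ext (h a.2 b.2 hab)
  exact hinj.extend_apply _ _ ⟨x, hx⟩

namespace IsBanachManifold

theorem isOpen_image_source (h𝒜 : 𝒜.IsBanachManifold) (i : 𝒜.ι) :
    IsOpen (𝒜.chart i '' 𝒜.source i) := by
  simpa using h𝒜.isOpen_image i i

theorem image_mem_nhds (h𝒜 : 𝒜.IsBanachManifold) {i : 𝒜.ι} {x : X} (hx : x ∈ 𝒜.source i) :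
    𝒜.chart i '' 𝒜.source i ∈ 𝓝 (𝒜.chart i x) :=
  (h𝒜.isOpen_image_source i).mem_nhds ⟨x, hx, rfl⟩

theorem image_inter_mem_nhds (h𝒜 : 𝒜.IsBanachManifold) {i j : 𝒜.ι} {x : X}
    (hx : x ∈ 𝒜.source i) (hx' : x ∈ 𝒜.source j) :
    𝒜.chart i '' (𝒜.source i ∩ 𝒜.source j) ∈ 𝓝 (𝒜.chart i x) :=
  (h𝒜.isOpen_image i j).mem_nhds ⟨x, ⟨hx, hx'⟩, rfl⟩

theorem localExpr_chart (h𝒜 : 𝒜.IsBanachManifold) (f : X → Y) {i : 𝒜.ι} (j : ℬ.ι) {x : X}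
    (hx : x ∈ 𝒜.source i) : localExpr 𝒜 ℬ f i j (𝒜.chart i x) = ℬ.chart j (f x) :=
  localExpr_chart_of_injOn (h𝒜.injOn i) f j hx

/-- Openness is phrased through images under charts, so injectivity is what turns a statement about
coordinates back into one about points. -/
theorem mem_of_chart_mem_image (h𝒜 : 𝒜.IsBanachManifold) {i : 𝒜.ι} {S : Set X} {x : X}
    (hx : x ∈ 𝒜.source i) (h : 𝒜.chart i x ∈ 𝒜.chart i '' (𝒜.source i ∩ S)) : x ∈ S := by
  obtain ⟨y, hy, hxy⟩ := h
  rw [← h𝒜.injOn i hy.1 hx hxy]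
  exact hy.2

theorem represents_id (h𝒜 : 𝒜.IsBanachManifold) {i j : 𝒜.ι} {x : X} (hi : x ∈ 𝒜.source i)
    (hj : x ∈ 𝒜.source j) :
    Represents 𝒜 𝒜 id Set.univ x i j (localExpr 𝒜 𝒜 id i j) :=
  ⟨hi, hj, _, h𝒜.image_inter_mem_nhds hi hj, fun _ hx' hN =>
    ⟨h𝒜.mem_of_chart_mem_image hx'.1 hN, h𝒜.localExpr_chart id j hx'.1⟩⟩

theorem analyticAt_localExpr_id (h𝒜 : 𝒜.IsBanachManifold) {i j : 𝒜.ι} {x : X}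
    (hi : x ∈ 𝒜.source i) (hj : x ∈ 𝒜.source j) :
    AnalyticAt ℂ (localExpr 𝒜 𝒜 id i j) (𝒜.chart i x) := by
  obtain ⟨g, hg, hgx⟩ := h𝒜.transition i j
  refine (hg _ ⟨x, ⟨hi, hj⟩, rfl⟩).congr ?_
  filter_upwards [h𝒜.image_inter_mem_nhds hi hj]
  rintro _ ⟨y, hy, rfl⟩
  rw [hgx y hy, h𝒜.localExpr_chart id j hy.1, id]

end IsBanachManifold

namespace Represents

variable {f : X → Y} {S : Set X} {x : X} {i : 𝒜.ι} {j : ℬ.ι} {g : 𝒜.E i → ℬ.E j}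

theorem mono {S' : Set X} (h : Represents 𝒜 ℬ f S x i j g) (hS : S' ⊆ S) :
    Represents 𝒜 ℬ f S' x i j g := by
  obtain ⟨h1, h2, N, hN, h⟩ := h
  exact ⟨h1, h2, N, hN, fun x' hx' => h x' ⟨hx'.1, hS hx'.2⟩⟩

theorem congr {f' : X → Y} (h : Represents 𝒜 ℬ f S x i j g) (hx : x ∈ S)
    (hf : Set.EqOn f f' S) : Represents 𝒜 ℬ f' S x i j g := by
  obtain ⟨h1, h2, N, hN, h⟩ := h
  refine ⟨h1, hf hx ▸ h2, N, hN, fun x' hx' => ?_⟩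
  rw [← hf hx'.2]
  exact h x' hx'

theorem apply_chart (h : Represents 𝒜 ℬ f S x i j g) (hx : x ∈ S) :
    g (𝒜.chart i x) = ℬ.chart j (f x) := by
  obtain ⟨h1, h2, N, hN, h⟩ := h
  exact (h x ⟨h1, hx⟩ (mem_of_mem_nhds hN)).2

theorem comp {f' : Y → Z} {S' : Set Y} {k : 𝒞.ι} {g' : ℬ.E j → 𝒞.E k}
    (h' : Represents ℬ 𝒞 f' S' (f x) j k g') (h : Represents 𝒜 ℬ f S x i j g)
    (hg : ContinuousAt g (𝒜.chart i x)) (hx : x ∈ S) (hm : Set.MapsTo f S S') :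
    Represents 𝒜 𝒞 (f' ∘ f) S x i k (g' ∘ g) := by
  have hgx := h.apply_chart hx
  obtain ⟨h1, h2, N, hN, h⟩ := h
  obtain ⟨k1, k2, N', hN', h'⟩ := h'
  rw [← hgx] at hN'
  refine ⟨h1, k2, N ∩ g ⁻¹' N', Filter.inter_mem hN (hg hN'), fun x' hx' hxN => ?_⟩
  obtain ⟨a1, a2⟩ := h x' hx' hxN.1
  have hb : ℬ.chart j (f x') ∈ N' := a2 ▸ hxN.2
  obtain ⟨b1, b2⟩ := h' (f x') ⟨a1, hm hx'.2⟩ hb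
  exact ⟨b1, by rw [Function.comp_apply, a2, b2, Function.comp_apply]⟩

theorem eventuallyEq_localExpr (h𝒜 : 𝒜.IsBanachManifold)
    (h : Represents 𝒜 ℬ f Set.univ x i j g) : localExpr 𝒜 ℬ f i j =ᶠ[𝓝 (𝒜.chart i x)] g := by
  obtain ⟨h1, h2, N, hN, h⟩ := h
  filter_upwards [hN, h𝒜.image_mem_nhds h1]
  rintro _ hy ⟨x', hx', rfl⟩
  rw [h𝒜.localExpr_chart f j hx', (h x' ⟨hx', trivial⟩ hy).2]

/-- Passage to other charts. -/
theorem change (h𝒜 : 𝒜.IsBanachManifold) (hℬ : ℬ.IsBanachManifold)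
    (h : Represents 𝒜 ℬ f S x i j g) (hg : ContinuousAt g (𝒜.chart i x)) (hx : x ∈ S)
    {i' : 𝒜.ι} {j' : ℬ.ι} (hi : x ∈ 𝒜.source i') (hj : f x ∈ ℬ.source j') :
    Represents 𝒜 ℬ f S x i' j'
      (localExpr ℬ ℬ id j j' ∘ g ∘ localExpr 𝒜 𝒜 id i' i) := by
  have e := h𝒜.localExpr_chart id (ℬ := 𝒜) i hi
  have h1 : Represents 𝒜 ℬ (f ∘ id) S x i' j (g ∘ localExpr 𝒜 𝒜 id i' i) :=
    h.comp ((h𝒜.represents_id hi h.1).mono (Set.subset_univ S))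
      (h𝒜.analyticAt_localExpr_id hi h.1).continuousAt hx (Set.mapsTo_id S)
  refine (hℬ.represents_id h.2.1 hj).comp h1 ?_ hx (Set.mapsTo_univ _ _)
  refine ContinuousAt.comp ?_ (h𝒜.analyticAt_localExpr_id hi h.1).continuousAt
  rw [e]
  exact hg

end Represents

namespace HolomorphicOn

variable {f : X → Y} {S : Set X}

theorem congr {f' : X → Y} (h : HolomorphicOn 𝒜 ℬ f S) (hf : Set.EqOn f f' S) :
    HolomorphicOn 𝒜 ℬ f' S := by
  intro x hx
  obtain ⟨i, j, g, hr, hg⟩ := h x hx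
  exact ⟨i, j, g, hr.congr hx hf, hg⟩

/-- The definition of holomorphy supplies only some pair of charts; composing with transition maps
on both sides makes every admissible pair available. -/
theorem exists_represents (h𝒜 : 𝒜.IsBanachManifold) (hℬ : ℬ.IsBanachManifold)
    (h : HolomorphicOn 𝒜 ℬ f S) {x : X} (hx : x ∈ S) {i : 𝒜.ι} {j : ℬ.ι}
    (hi : x ∈ 𝒜.source i) (hj : f x ∈ ℬ.source j) :
    ∃ g : 𝒜.E i → ℬ.E j, Represents 𝒜 ℬ f S x i j g ∧ AnalyticAt ℂ g (𝒜.chart i x) := by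
  obtain ⟨i', j', g, hr, hg⟩ := h x hx
  refine ⟨_, hr.change h𝒜 hℬ hg.continuousAt hx hi hj, ?_⟩
  have e := h𝒜.localExpr_chart id (ℬ := 𝒜) i' hi
  refine AnalyticAt.comp ?_ (AnalyticAt.comp ?_ (h𝒜.analyticAt_localExpr_id hi hr.1))
  · rw [Function.comp_apply, e, id, hr.apply_chart hx]
    exact hℬ.analyticAt_localExpr_id hr.2.1 hj
  · rw [e]
    exact hg

theorem comp (hℬ : ℬ.IsBanachManifold) {f' : Y → Z} {S' : Set Y}
    (h' : HolomorphicOn ℬ 𝒞 f' S') (h : HolomorphicOn 𝒜 ℬ f S) (hm : Set.MapsTo f S S') :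
    HolomorphicOn 𝒜 𝒞 (f' ∘ f) S := by
  intro x hx
  obtain ⟨i, j, g, hr, hg⟩ := h x hx
  obtain ⟨j', k, g', hr', hg'⟩ := h' (f x) (hm hx)
  have e := hℬ.localExpr_chart id (ℬ := ℬ) j' hr.2.1
  have ht := hℬ.analyticAt_localExpr_id hr.2.1 hr'.1
  have h1 : Represents 𝒜 ℬ (id ∘ f) S x i j' (localExpr ℬ ℬ id j j' ∘ g) :=
    (hℬ.represents_id hr.2.1 hr'.1).comp hr hg.continuousAt hx (Set.mapsTo_univ _ _)
  have h2 : AnalyticAt ℂ (localExpr ℬ ℬ id j j' ∘ g) (𝒜.chart i x) := by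
    refine AnalyticAt.comp ?_ hg
    rw [hr.apply_chart hx]
    exact ht
  refine ⟨i, k, _, hr'.comp h1 h2.continuousAt hx hm, AnalyticAt.comp ?_ h2⟩
  rw [Function.comp_apply, hr.apply_chart hx, e]
  exact hg'

end HolomorphicOn

theorem RealSmoothOn.exists_represents {f : X → Y} {S : Set X} (h𝒜 : 𝒜.IsBanachManifold)
    (hℬ : ℬ.IsBanachManifold) (h : RealSmoothOn 𝒜 ℬ f S) {x : X} (hx : x ∈ S) {i : 𝒜.ι} {j : ℬ.ι}
    (hi : x ∈ 𝒜.source i) (hj : f x ∈ ℬ.source j) :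
    ∃ g : 𝒜.E i → ℬ.E j, Represents 𝒜 ℬ f S x i j g ∧ ContDiffAt ℝ ∞ g (𝒜.chart i x) := by
  obtain ⟨i', j', g, hr, hg⟩ := h x hx
  refine ⟨_, hr.change h𝒜 hℬ hg.continuousAt hx hi hj, ?_⟩
  have e := h𝒜.localExpr_chart id (ℬ := 𝒜) i' hi
  refine ContDiffAt.comp _ ?_ (ContDiffAt.comp _ ?_
    ((h𝒜.analyticAt_localExpr_id hi hr.1).restrictScalars (𝕜 := ℝ)).contDiffAt)
  · rw [Function.comp_apply, e, id, hr.apply_chart hx]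
    exact ((hℬ.analyticAt_localExpr_id hr.2.1 hj).restrictScalars (𝕜 := ℝ)).contDiffAt
  · rw [e]
    exact hg

namespace Holomorphic

variable {f : X → Y} {f' : Y → Z}

theorem comp (hℬ : ℬ.IsBanachManifold) (h' : Holomorphic ℬ 𝒞 f') (h : Holomorphic 𝒜 ℬ f) :
    Holomorphic 𝒜 𝒞 (f' ∘ f) :=
  HolomorphicOn.comp hℬ h' h (Set.mapsTo_univ _ _)

/-- When the domain is the whole manifold, the values of a representative near the point are forced,
so the canonical `localExpr` can replace an arbitrary one. On a submanifold extensions are not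
unique and this step is not available. -/
theorem represents (h𝒜 : 𝒜.IsBanachManifold) (hℬ : ℬ.IsBanachManifold)
    (h : Holomorphic 𝒜 ℬ f) {x : X} {i : 𝒜.ι} {j : ℬ.ι}
    (hi : x ∈ 𝒜.source i) (hj : f x ∈ ℬ.source j) :
    Represents 𝒜 ℬ f Set.univ x i j (localExpr 𝒜 ℬ f i j) := by
  obtain ⟨g, hr, hg⟩ := HolomorphicOn.exists_represents h𝒜 hℬ h (Set.mem_univ x) hi hj
  obtain ⟨h1, h2, N, hN, h⟩ := hr
  exact ⟨h1, h2, N, hN, fun x' hx' hN => ⟨(h x' hx' hN).1, h𝒜.localExpr_chart f j hx'.1⟩⟩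

theorem analyticAt_localExpr (h𝒜 : 𝒜.IsBanachManifold) (hℬ : ℬ.IsBanachManifold)
    (h : Holomorphic 𝒜 ℬ f) {x : X} {i : 𝒜.ι} {j : ℬ.ι}
    (hi : x ∈ 𝒜.source i) (hj : f x ∈ ℬ.source j) :
    AnalyticAt ℂ (localExpr 𝒜 ℬ f i j) (𝒜.chart i x) := by
  obtain ⟨g, hr, hg⟩ := HolomorphicOn.exists_represents h𝒜 hℬ h (Set.mem_univ x) hi hj
  exact hg.congr (hr.eventuallyEq_localExpr h𝒜).symm

/-- The chain rule in charts. -/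
theorem fderiv_localExpr_comp (h𝒜 : 𝒜.IsBanachManifold) (hℬ : ℬ.IsBanachManifold)
    (h𝒞 : 𝒞.IsBanachManifold) (h' : Holomorphic ℬ 𝒞 f') (h : Holomorphic 𝒜 ℬ f)
    {x : X} {i : 𝒜.ι} {j : ℬ.ι} {k : 𝒞.ι} (hi : x ∈ 𝒜.source i) (hj : f x ∈ ℬ.source j)
    (hk : f' (f x) ∈ 𝒞.source k) :
    fderiv ℂ (localExpr 𝒜 𝒞 (f' ∘ f) i k) (𝒜.chart i x) =
      (fderiv ℂ (localExpr ℬ 𝒞 f' j k) (ℬ.chart j (f x))).comp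
        (fderiv ℂ (localExpr 𝒜 ℬ f i j) (𝒜.chart i x)) := by
  have ha := h.analyticAt_localExpr h𝒜 hℬ hi hj
  have hr := (h'.represents hℬ h𝒞 hj hk).comp (h.represents h𝒜 hℬ hi hj) ha.continuousAt
    (Set.mem_univ x) (Set.mapsTo_univ _ _)
  have ha' := h'.analyticAt_localExpr hℬ h𝒞 hj hk
  rw [(hr.eventuallyEq_localExpr h𝒜).fderiv_eq]
  rw [← h𝒜.localExpr_chart f j hi] at ha' ⊢
  exact fderiv_comp _ ha'.differentiableAt ha.differentiableAt

end Holomorphic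

theorem IsBanachManifold.holomorphic_id (h𝒜 : 𝒜.IsBanachManifold) : Holomorphic 𝒜 𝒜 id :=
  fun x _ => ⟨_, _, _,
    h𝒜.represents_id (h𝒜.mem_source_chartAt x) (h𝒜.mem_source_chartAt x),
    h𝒜.analyticAt_localExpr_id (h𝒜.mem_source_chartAt x) (h𝒜.mem_source_chartAt x)⟩

theorem IsBanachManifold.fderiv_localExpr_id_self (h𝒜 : 𝒜.IsBanachManifold) {x : X} {i : 𝒜.ι}
    (hi : x ∈ 𝒜.source i) :
    fderiv ℂ (localExpr 𝒜 𝒜 id i i) (𝒜.chart i x) = ContinuousLinearMap.id ℂ (𝒜.E i) := by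
  have h : localExpr 𝒜 𝒜 id i i =ᶠ[𝓝 (𝒜.chart i x)] id := by
    filter_upwards [h𝒜.image_mem_nhds hi]
    rintro _ ⟨y, hy, rfl⟩
    rw [h𝒜.localExpr_chart id i hy, id, id]
  rw [h.fderiv_eq, fderiv_id]

/-! ## The tangent bundle -/

theorem IsBanachManifold.tangentCoord_chartAt (h𝒜 : 𝒜.IsBanachManifold) (x : X)
    (v : 𝒜.TangentAt x) : 𝒜.tangentCoord (𝒜.chartAt x) x v = v := by
  unfold tangentCoord
  rw [h𝒜.fderiv_localExpr_id_self (h𝒜.mem_source_chartAt x)]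
  rfl

/-- Tangent maps are computed below by differentiating an explicit formula `g` in place of the
extension by zero. -/
theorem Represents.tangentMap_eq (h𝒜 : 𝒜.IsBanachManifold) {f : X → Y} {x : X}
    {g : 𝒜.TangentAt x → ℬ.TangentAt (f x)}
    (h : Represents 𝒜 ℬ f Set.univ x (𝒜.chartAt x) (ℬ.chartAt (f x)) g) :
    tangentMap 𝒜 ℬ f x = fderiv ℂ g (𝒜.chart (𝒜.chartAt x) x) :=
  (h.eventuallyEq_localExpr h𝒜).fderiv_eq

theorem Holomorphic.tangentMap_comp (h𝒜 : 𝒜.IsBanachManifold) (hℬ : ℬ.IsBanachManifold)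
    (h𝒞 : 𝒞.IsBanachManifold) {f : X → Y} {f' : Y → Z} (h' : Holomorphic ℬ 𝒞 f')
    (h : Holomorphic 𝒜 ℬ f) (x : X) :
    tangentMap 𝒜 𝒞 (f' ∘ f) x = (tangentMap ℬ 𝒞 f' (f x)).comp (tangentMap 𝒜 ℬ f x) :=
  Holomorphic.fderiv_localExpr_comp h𝒜 hℬ h𝒞 h' h (h𝒜.mem_source_chartAt _)
    (hℬ.mem_source_chartAt _) (h𝒞.mem_source_chartAt _)

theorem Holomorphic.tangentTotalMap_comp (h𝒜 : 𝒜.IsBanachManifold) (hℬ : ℬ.IsBanachManifold)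
    (h𝒞 : 𝒞.IsBanachManifold) {f : X → Y} {f' : Y → Z} (h' : Holomorphic ℬ 𝒞 f')
    (h : Holomorphic 𝒜 ℬ f) (t : 𝒜.TangentTotal) :
    tangentTotalMap 𝒜 𝒞 (f' ∘ f) t = tangentTotalMap ℬ 𝒞 f' (tangentTotalMap 𝒜 ℬ f t) := by
  unfold tangentTotalMap
  rw [Holomorphic.tangentMap_comp h𝒜 hℬ h𝒞 h' h]
  rfl

/-- The tangent map in charts. -/
theorem Holomorphic.tangentCoord_tangentMap (h𝒜 : 𝒜.IsBanachManifold) (hℬ : ℬ.IsBanachManifold)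
    {f : X → Y} (h : Holomorphic 𝒜 ℬ f) {x : X} {i : 𝒜.ι} {j : ℬ.ι} (hi : x ∈ 𝒜.source i)
    (hj : f x ∈ ℬ.source j) (v : 𝒜.TangentAt x) :
    ℬ.tangentCoord j (f x) (tangentMap 𝒜 ℬ f x v) =
      fderiv ℂ (localExpr 𝒜 ℬ f i j) (𝒜.chart i x) (𝒜.tangentCoord i x v) := by
  have h1 := Holomorphic.fderiv_localExpr_comp h𝒜 hℬ hℬ hℬ.holomorphic_id h
    (h𝒜.mem_source_chartAt x) (hℬ.mem_source_chartAt (f x)) hj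
  have h2 := Holomorphic.fderiv_localExpr_comp h𝒜 h𝒜 hℬ h h𝒜.holomorphic_id
    (h𝒜.mem_source_chartAt x) hi hj
  exact congrArg (fun L => L v) (h1.symm.trans h2)

/-- The cocycle identity of the tangent bundle: the chain rule for `id ∘ id` read in three charts.
-/
theorem IsBanachManifold.fderiv_localExpr_id_comp (h𝒜 : 𝒜.IsBanachManifold) {x : X}
    {i j k : 𝒜.ι} (hi : x ∈ 𝒜.source i) (hj : x ∈ 𝒜.source j) (hk : x ∈ 𝒜.source k)
    (v : 𝒜.E i) :
    fderiv ℂ (localExpr 𝒜 𝒜 id j k) (𝒜.chart j x)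
      (fderiv ℂ (localExpr 𝒜 𝒜 id i j) (𝒜.chart i x) v) =
      fderiv ℂ (localExpr 𝒜 𝒜 id i k) (𝒜.chart i x) v :=
  congrArg (fun L => L v) (Holomorphic.fderiv_localExpr_comp h𝒜 h𝒜 h𝒜 h𝒜.holomorphic_id
    h𝒜.holomorphic_id hi hj hk).symm

/-- Continuity of `F` for the topology of the atlas, tested in charts. The target is a mere
topological space and no holomorphy is asked, since the maps used for separation involve the
adjoint. -/
theorem isOpenSet_preimage (hopen : ∀ i, IsOpen (𝒜.chart i '' 𝒜.source i)) {T : Type*}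
    [TopologicalSpace T] {F : X → T}
    (hF : ∀ i, ∀ x ∈ 𝒜.source i, ∃ h : 𝒜.E i → T, ContinuousAt h (𝒜.chart i x) ∧
      ∀ᶠ y in 𝓝 (𝒜.chart i x), ∀ x' ∈ 𝒜.source i, 𝒜.chart i x' = y → F x' = h y)
    {O : Set T} (hO : IsOpen O) : 𝒜.IsOpenSet (F ⁻¹' O) := by
  intro i
  rw [isOpen_iff_mem_nhds]
  rintro _ ⟨x, ⟨hxO, hx⟩, rfl⟩
  obtain ⟨h, hc, he⟩ := hF i x hx
  have hO' : O ∈ 𝓝 (h (𝒜.chart i x)) := by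
    rw [← he.self_of_nhds x hx rfl]
    exact hO.mem_nhds hxO
  filter_upwards [hc hO', he, (hopen i).mem_nhds ⟨x, hx, rfl⟩]
  rintro _ h1 h2 ⟨x', hx', rfl⟩
  refine ⟨x', ⟨?_, hx'⟩, rfl⟩
  change F x' ∈ O
  rw [h2 x' hx' rfl]
  exact h1

/-- A manifold with a continuous injective map to a Hausdorff space is Hausdorff. -/
theorem t2_of_injective (hopen : ∀ i, IsOpen (𝒜.chart i '' 𝒜.source i)) {T : Type*}
    [TopologicalSpace T] [T2Space T] {F : X → T} (hinj : Function.Injective F)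
    (hF : ∀ i, ∀ x ∈ 𝒜.source i, ∃ h : 𝒜.E i → T, ContinuousAt h (𝒜.chart i x) ∧
      ∀ᶠ y in 𝓝 (𝒜.chart i x), ∀ x' ∈ 𝒜.source i, 𝒜.chart i x' = y → F x' = h y)
    (x y : X) (hxy : x ≠ y) :
    ∃ U V, 𝒜.IsOpenSet U ∧ 𝒜.IsOpenSet V ∧ x ∈ U ∧ y ∈ V ∧ Disjoint U V := by
  obtain ⟨U, V, hU, hV, hx, hy, hd⟩ := t2_separation (hinj.ne hxy)
  exact ⟨F ⁻¹' U, F ⁻¹' V, isOpenSet_preimage hopen hF hU, isOpenSet_preimage hopen hF hV, hx, hy,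
    hd.preimage F⟩

end BanachAtlas

namespace BanachAtlas

variable {X Y Z W : Type u} {𝒜 : BanachAtlas X} {ℬ : BanachAtlas Y} {𝒞 : BanachAtlas Z}
  {𝒟 : BanachAtlas W}

/-- The chart of the tangent bundle induced by the chart `i`. -/
noncomputable def tangentChart (𝒜 : BanachAtlas X) (i : 𝒜.ι) (t : 𝒜.TangentTotal) :
    𝒜.E i × 𝒜.E i :=
  (𝒜.chart i t.1, 𝒜.tangentCoord i t.1 t.2)

/-- The change of coordinates of the tangent bundle. -/
noncomputable def tangentTrans (𝒜 : BanachAtlas X) (i j : 𝒜.ι) (z : 𝒜.E i × 𝒜.E i) :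
    𝒜.E j × 𝒜.E j :=
  (localExpr 𝒜 𝒜 id i j z.1, fderiv ℂ (localExpr 𝒜 𝒜 id i j) z.1 z.2)

namespace IsBanachManifold

theorem tangentChart_image (h𝒜 : 𝒜.IsBanachManifold) (i : 𝒜.ι) (S : Set X) :
    𝒜.tangentChart i '' {t | t.1 ∈ 𝒜.source i ∩ S} =
      (𝒜.chart i '' (𝒜.source i ∩ S)) ×ˢ (Set.univ : Set (𝒜.E i)) := by
  apply Set.Subset.antisymm
  · rintro _ ⟨t, ht, rfl⟩
    exact ⟨⟨t.1, ht, rfl⟩, trivial⟩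
  · rintro ⟨_, v⟩ ⟨⟨x, hx, rfl⟩, -⟩
    -- Tangent vectors live in the preferred chart at their base point, so `v` is first carried
    -- there; the cocycle identity brings it back to chart `i`.
    refine ⟨⟨x, fderiv ℂ (localExpr 𝒜 𝒜 id i (𝒜.chartAt x)) (𝒜.chart i x) v⟩, hx, ?_⟩
    refine Prod.ext rfl ?_
    refine (h𝒜.fderiv_localExpr_id_comp hx.1 (h𝒜.mem_source_chartAt x) hx.1 v).trans ?_
    rw [h𝒜.fderiv_localExpr_id_self hx.1]
    rfl

theorem tangentChart_injOn (h𝒜 : 𝒜.IsBanachManifold) (i : 𝒜.ι) :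
    Set.InjOn (𝒜.tangentChart i) {t | t.1 ∈ 𝒜.source i} := by
  rintro ⟨x, v⟩ hx ⟨y, w⟩ hy hxy
  obtain rfl : x = y := h𝒜.injOn i hx hy (congrArg Prod.fst hxy)
  have h1 : 𝒜.tangentCoord i x v = 𝒜.tangentCoord i x w := congrArg Prod.snd hxy
  have h2 := congrArg (fderiv ℂ (localExpr 𝒜 𝒜 id i (𝒜.chartAt x)) (𝒜.chart i x)) h1
  unfold tangentCoord at h2
  have hc := h𝒜.mem_source_chartAt x
  rw [h𝒜.fderiv_localExpr_id_comp hc hx hc, h𝒜.fderiv_localExpr_id_comp hc hx hc,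
    h𝒜.fderiv_localExpr_id_self hc] at h2
  exact congrArg (Sigma.mk x) h2

theorem tangentTrans_tangentChart (h𝒜 : 𝒜.IsBanachManifold) {i j : 𝒜.ι} {t : 𝒜.TangentTotal}
    (hi : t.1 ∈ 𝒜.source i) (hj : t.1 ∈ 𝒜.source j) :
    𝒜.tangentTrans i j (𝒜.tangentChart i t) = 𝒜.tangentChart j t :=
  Prod.ext (h𝒜.localExpr_chart id j hi)
    (h𝒜.fderiv_localExpr_id_comp (h𝒜.mem_source_chartAt t.1) hi hj t.2)

/-- The fibre component is the evaluation pairing, a bounded bilinear map, applied to the derivative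
of the transition map and the vector. -/
theorem analyticAt_tangentTrans (h𝒜 : 𝒜.IsBanachManifold) {i j : 𝒜.ι} {t : 𝒜.TangentTotal}
    (hi : t.1 ∈ 𝒜.source i) (hj : t.1 ∈ 𝒜.source j) :
    AnalyticAt ℂ (𝒜.tangentTrans i j) (𝒜.tangentChart i t) := by
  have ha := h𝒜.analyticAt_localExpr_id hi hj
  have h1 : ∀ z : 𝒜.E i × 𝒜.E i, z.1 = 𝒜.chart i t.1 →
      AnalyticAt ℂ (𝒜.tangentTrans i j) z := by
    intro z hz
    rw [← hz] at ha
    exact (ha.comp analyticAt_fst).prod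
      (((ContinuousLinearMap.id ℂ (𝒜.E i →L[ℂ] 𝒜.E j)).analyticAt_bilinear _).comp
        ((ha.fderiv.comp analyticAt_fst).prod analyticAt_snd))
  exact h1 _ rfl

theorem tangentAtlas (h𝒜 : 𝒜.IsBanachManifold) : 𝒜.tangentAtlas.IsBanachManifold := by
  have hopen : ∀ i j : 𝒜.ι, IsOpen (𝒜.tangentChart i '' {t | t.1 ∈ 𝒜.source i ∩ 𝒜.source j}) := by
    intro i j
    rw [h𝒜.tangentChart_image]
    exact (h𝒜.isOpen_image i j).prod isOpen_univ
  refine ⟨fun t => h𝒜.mem_source_chartAt t.1, h𝒜.tangentChart_injOn, hopen, ?_, ?_⟩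
  · intro (i : 𝒜.ι) (j : 𝒜.ι)
    refine ⟨𝒜.tangentTrans i j, ?_, fun t ht => h𝒜.tangentTrans_tangentChart ht.1 ht.2⟩
    rintro _ ⟨t, ht, rfl⟩
    exact h𝒜.analyticAt_tangentTrans ht.1 ht.2
  · rintro ⟨x, v⟩ ⟨y, w⟩ hxy
    -- Vectors at the same point are separated by their coordinates in a common chart, vectors at
    -- different points by open sets of the base.
    by_cases h : x = y
    · subst h
      have hc := h𝒜.mem_source_chartAt x
      have h1 : 𝒜.tangentChart (𝒜.chartAt x) ⟨x, v⟩ ≠ 𝒜.tangentChart (𝒜.chartAt x) ⟨x, w⟩ :=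
        fun h => hxy (h𝒜.tangentChart_injOn (𝒜.chartAt x) hc hc h)
      obtain ⟨U, V, hU, hV, hxU, hyV, hd⟩ := t2_separation h1
      have key : ∀ O : Set (𝒜.E (𝒜.chartAt x) × 𝒜.E (𝒜.chartAt x)), IsOpen O → ∀ i : 𝒜.ι,
          IsOpen (𝒜.tangentChart i '' ({t | t.1 ∈ 𝒜.source (𝒜.chartAt x) ∧
            𝒜.tangentChart (𝒜.chartAt x) t ∈ O} ∩ {t | t.1 ∈ 𝒜.source i})) := by
        intro O hO i
        rw [isOpen_iff_mem_nhds]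
        rintro _ ⟨t, ⟨ht, ht'⟩, rfl⟩
        have hO' := (h𝒜.analyticAt_tangentTrans ht' ht.1).continuousAt.preimage_mem_nhds
          (hO.mem_nhds (by
            rw [h𝒜.tangentTrans_tangentChart ht' ht.1]
            exact ht.2))
        filter_upwards [hO', (hopen i (𝒜.chartAt x)).mem_nhds ⟨t, ⟨ht', ht.1⟩, rfl⟩]
        rintro _ k1 ⟨s, hs, rfl⟩
        refine ⟨s, ⟨⟨hs.2, ?_⟩, hs.1⟩, rfl⟩
        rw [← h𝒜.tangentTrans_tangentChart hs.1 hs.2]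
        exact k1
      refine ⟨_, _, key U hU, key V hV, ⟨hc, hxU⟩, ⟨hc, hyV⟩, ?_⟩
      rw [Set.disjoint_left]
      exact fun t h1 h2 => Set.disjoint_left.1 hd h1.2 h2.2
    · obtain ⟨U, V, hU, hV, hxU, hyV, hd⟩ := h𝒜.t2 x y h
      have key : ∀ O, 𝒜.IsOpenSet O → ∀ i : 𝒜.ι,
          IsOpen (𝒜.tangentChart i '' ({t | t.1 ∈ O} ∩ {t | t.1 ∈ 𝒜.source i})) := by
        intro O hO i
        have h1 := h𝒜.tangentChart_image i O
        rw [Set.inter_comm] at h1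
        have h2 := (hO i).prod (isOpen_univ (X := 𝒜.E i))
        rwa [← h1] at h2
      refine ⟨_, _, key U hU, key V hV, hxU, hyV, ?_⟩
      rw [Set.disjoint_left]
      exact fun t h1 h2 => Set.disjoint_left.1 hd h1 h2

end IsBanachManifold

/-! ## Products -/

theorem analyticAt_prodMap {E F E' F' : Type*} [NormedAddCommGroup E] [NormedSpace ℂ E]
    [NormedAddCommGroup F] [NormedSpace ℂ F] [NormedAddCommGroup E'] [NormedSpace ℂ E']
    [NormedAddCommGroup F'] [NormedSpace ℂ F'] {g : E → E'} {g' : F → F'} {z : E × F}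
    (h : AnalyticAt ℂ g z.1) (h' : AnalyticAt ℂ g' z.2) : AnalyticAt ℂ (Prod.map g g') z :=
  (h.comp analyticAt_fst).prod (h'.comp analyticAt_snd)

theorem IsBanachManifold.prodAtlas (h𝒜 : 𝒜.IsBanachManifold) (hℬ : ℬ.IsBanachManifold) :
    (BanachAtlas.prodAtlas 𝒜 ℬ).IsBanachManifold := by
  refine ⟨fun x => ⟨h𝒜.mem_source_chartAt x.1, hℬ.mem_source_chartAt x.2⟩, ?_, ?_, ?_, ?_⟩
  · rintro i x hx y hy hxy
    exact Prod.ext (h𝒜.injOn i.1 hx.1 hy.1 (congrArg Prod.fst hxy))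
      (hℬ.injOn i.2 hx.2 hy.2 (congrArg Prod.snd hxy))
  · intro (i : 𝒜.ι × ℬ.ι) (j : 𝒜.ι × ℬ.ι)
    have h1 : IsOpen (Prod.map (𝒜.chart i.1) (ℬ.chart i.2) ''
        (𝒜.source i.1 ×ˢ ℬ.source i.2 ∩ 𝒜.source j.1 ×ˢ ℬ.source j.2)) := by
      rw [Set.prod_inter_prod, Set.prodMap_image_prod]
      exact (h𝒜.isOpen_image _ _).prod (hℬ.isOpen_image _ _)
    exact h1
  · intro (i : 𝒜.ι × ℬ.ι) (j : 𝒜.ι × ℬ.ι)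
    refine ⟨Prod.map (localExpr 𝒜 𝒜 id i.1 j.1) (localExpr ℬ ℬ id i.2 j.2), ?_, fun x hx =>
      Prod.ext (h𝒜.localExpr_chart id _ hx.1.1) (hℬ.localExpr_chart id _ hx.1.2)⟩
    rintro _ ⟨x, hx, rfl⟩
    have h3 := analyticAt_prodMap (z := (𝒜.chart i.1 x.1, ℬ.chart i.2 x.2))
      (h𝒜.analyticAt_localExpr_id hx.1.1 hx.2.1) (hℬ.analyticAt_localExpr_id hx.1.2 hx.2.2)
    exact h3
  · have key : ∀ U V, 𝒜.IsOpenSet U → ℬ.IsOpenSet V →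
        (BanachAtlas.prodAtlas 𝒜 ℬ).IsOpenSet (U ×ˢ V) := by
      intro U V hU hV (i : 𝒜.ι × ℬ.ι)
      have h1 : IsOpen (Prod.map (𝒜.chart i.1) (ℬ.chart i.2) ''
          (U ×ˢ V ∩ 𝒜.source i.1 ×ˢ ℬ.source i.2)) := by
        rw [Set.prod_inter_prod, Set.prodMap_image_prod]
        exact (hU i.1).prod (hV i.2)
      exact h1
    have h1 : 𝒜.IsOpenSet Set.univ := fun i => by
      simpa using h𝒜.isOpen_image_source i
    have h2 : ℬ.IsOpenSet Set.univ := fun i => by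
      simpa using hℬ.isOpen_image_source i
    intro x y hxy
    by_cases h : x.1 = y.1
    · obtain ⟨U, V, hU, hV, hx, hy, hd⟩ := hℬ.t2 x.2 y.2 (fun h' => hxy (Prod.ext h h'))
      exact ⟨_, _, key _ _ h1 hU, key _ _ h1 hV, ⟨trivial, hx⟩, ⟨trivial, hy⟩,
        Set.disjoint_prod.2 (Or.inr hd)⟩
    · obtain ⟨U, V, hU, hV, hx, hy, hd⟩ := h𝒜.t2 x.1 y.1 h
      exact ⟨_, _, key _ _ hU h2, key _ _ hV h2, ⟨hx, trivial⟩, ⟨hy, trivial⟩,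
        Set.disjoint_prod.2 (Or.inl hd)⟩

theorem HolomorphicOn.prodMap {f : X → Z} {f' : Y → W} {S : Set (X × Y)}
    (hf : Holomorphic 𝒜 𝒞 f) (hf' : Holomorphic ℬ 𝒟 f') :
    HolomorphicOn (prodAtlas 𝒜 ℬ) (prodAtlas 𝒞 𝒟) (Prod.map f f') S := by
  intro x _
  obtain ⟨i, j, g, ⟨h1, h2, N, hN, h⟩, hg⟩ := hf x.1 trivial
  obtain ⟨i', j', g', ⟨h1', h2', N', hN', h'⟩, hg'⟩ := hf' x.2 trivial
  have h3 := analyticAt_prodMap (z := (𝒜.chart i x.1, ℬ.chart i' x.2)) hg hg'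
  refine ⟨(i, i'), (j, j'), Prod.map g g', ⟨⟨h1, h1'⟩, ⟨h2, h2'⟩, N ×ˢ N',
    prod_mem_nhds hN hN', ?_⟩, h3⟩
  rintro x' ⟨⟨ha, ha'⟩, -⟩ ⟨hb, hb'⟩
  obtain ⟨c1, c2⟩ := h x'.1 ⟨ha, trivial⟩ hb
  obtain ⟨c1', c2'⟩ := h' x'.2 ⟨ha', trivial⟩ hb'
  exact ⟨⟨c1, c1'⟩, Prod.ext c2 c2'⟩

/-! ## Submersions -/

/-- A map with holomorphic local sections is a submersion. -/
theorem isSubmersion_of_sections (h𝒜 : 𝒜.IsBanachManifold) {f : X → Y}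
    (h : ∀ x, ∃ (g : 𝒜.TangentAt x → ℬ.TangentAt (f x)) (s : ℬ.TangentAt (f x) → 𝒜.TangentAt x),
      Represents 𝒜 ℬ f Set.univ x (𝒜.chartAt x) (ℬ.chartAt (f x)) g ∧
      AnalyticAt ℂ g (𝒜.chart (𝒜.chartAt x) x) ∧
      DifferentiableAt ℂ s (ℬ.chart (ℬ.chartAt (f x)) (f x)) ∧
      s (ℬ.chart (ℬ.chartAt (f x)) (f x)) = 𝒜.chart (𝒜.chartAt x) x ∧
      ∀ᶠ y in 𝓝 (ℬ.chart (ℬ.chartAt (f x)) (f x)), g (s y) = y) :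
    IsSubmersion 𝒜 ℬ f := by
  refine ⟨fun x _ => ?_, fun x => ?_⟩
  · obtain ⟨g, s, hr, hg, -⟩ := h x
    exact ⟨_, _, g, hr, hg⟩
  · obtain ⟨g, s, hr, hg, hs, hsx, hgs⟩ := h x
    refine ⟨fderiv ℂ s (ℬ.chart (ℬ.chartAt (f x)) (f x)), fun w => ?_⟩
    -- Differentiating `g ∘ s = id` shows that the derivative of the section is a bounded right
    -- inverse of the tangent map.
    have h1 : g ∘ s =ᶠ[𝓝 (ℬ.chart (ℬ.chartAt (f x)) (f x))] id := hgs
    have h2 := h1.fderiv_eq (𝕜 := ℂ)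
    rw [← hsx] at hg
    rw [fderiv_comp _ hg.differentiableAt hs, fderiv_id, hsx] at h2
    rw [hr.tangentMap_eq h𝒜]
    exact congrArg (fun L => L w) h2

/-- A holomorphic submersion has holomorphic local sections. -/
theorem IsSubmersion.exists_section (h𝒜 : 𝒜.IsBanachManifold) (hℬ : ℬ.IsBanachManifold)
    {f : X → Y} (hf : IsSubmersion 𝒜 ℬ f) (x : X) :
    ∃ s : ℬ.TangentAt (f x) → 𝒜.TangentAt x,
      AnalyticAt ℂ s (ℬ.chart (ℬ.chartAt (f x)) (f x)) ∧
      s (ℬ.chart (ℬ.chartAt (f x)) (f x)) = 𝒜.chart (𝒜.chartAt x) x ∧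
      ∀ᶠ y in 𝓝 (ℬ.chart (ℬ.chartAt (f x)) (f x)),
        localExpr 𝒜 ℬ f (𝒜.chartAt x) (ℬ.chartAt (f x)) (s y) = y := by
  obtain ⟨L, hL⟩ := hf.2 x
  have hx := h𝒜.mem_source_chartAt x
  have hg := hf.1.analyticAt_localExpr h𝒜 hℬ hx (hℬ.mem_source_chartAt (f x))
  have hgx := h𝒜.localExpr_chart f (ℬ.chartAt (f x)) hx
  have htm : ∀ w, fderiv ℂ (localExpr 𝒜 ℬ f (𝒜.chartAt x) (ℬ.chartAt (f x)))
    (𝒜.chart (𝒜.chartAt x) x) (L w) = w := hL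
  revert hg hgx htm
  generalize localExpr 𝒜 ℬ f (𝒜.chartAt x) (ℬ.chartAt (f x)) = g
  generalize ℬ.chart (ℬ.chartAt (f x)) (f x) = c
  generalize 𝒜.chart (𝒜.chartAt x) x = e
  intro hg hgx htm
  -- The affine map through `e` with direction the right inverse `L` makes the derivative of `g ∘ h`
  -- at `c` the identity. The inverse function theorem provides a local inverse `k` of `g ∘ h`, and
  -- `h ∘ k` is the section.
  let h : ℬ.TangentAt (f x) → 𝒜.TangentAt x := fun y => e + L (y - c)
  have hc : h c = e := by simp [h]
  have hh : AnalyticAt ℂ h c :=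
    analyticAt_const.add ((L.analyticAt _).comp (analyticAt_id.sub analyticAt_const))
  have hhd : HasFDerivAt h L c := by
    have := (L.hasFDerivAt.comp c ((hasFDerivAt_id c).sub_const c)).const_add e
    rwa [ContinuousLinearMap.comp_id] at this
  have hgh : AnalyticAt ℂ (g ∘ h) c := by
    refine AnalyticAt.comp ?_ hh
    rwa [hc]
  have hd : fderiv ℂ (g ∘ h) c = ContinuousLinearMap.id ℂ (ℬ.TangentAt (f x)) := by
    rw [← hc] at hg htm
    rw [fderiv_comp _ hg.differentiableAt hh.differentiableAt, hhd.fderiv]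
    ext w
    exact htm w
  have hst : HasStrictFDerivAt (g ∘ h)
      ((ContinuousLinearEquiv.refl ℂ (ℬ.TangentAt (f x)) : _ →L[ℂ] ℬ.TangentAt (f x))) c := by
    have := hgh.hasStrictFDerivAt
    rwa [hd] at this
  have hk : AnalyticAt ℂ (hst.localInverse (g ∘ h) _ c) ((g ∘ h) c) :=
    ((hgh.contDiffAt (n := ω)).to_localInverse hst.hasFDerivAt (by simp)).analyticAt
  have hgc : (g ∘ h) c = c := by rw [Function.comp_apply, hc, hgx]
  have hki := hst.localInverse_apply_image
  have hkr := hst.eventually_right_inverse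
  rw [hgc] at hk hki hkr
  refine ⟨h ∘ hst.localInverse (g ∘ h) _ c, AnalyticAt.comp ?_ hk, ?_, hkr⟩
  · rwa [hki]
  · rw [Function.comp_apply, hki, hc]

/-- Maps that become holomorphic after composition with a surjective submersion are
holomorphic. -/
theorem IsSubmersion.holomorphic_of_comp (h𝒜 : 𝒜.IsBanachManifold) (hℬ : ℬ.IsBanachManifold)
    (h𝒞 : 𝒞.IsBanachManifold) {f : X → Y} (hf : IsSubmersion 𝒜 ℬ f)
    (hsurj : Function.Surjective f) {f' : Y → Z} (hf' : Holomorphic 𝒜 𝒞 (f' ∘ f)) :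
    Holomorphic ℬ 𝒞 f' := by
  rintro y -
  obtain ⟨x, rfl⟩ := hsurj y
  obtain ⟨s, hs, hsx, hr⟩ := hf.exists_section h𝒜 hℬ x
  have hx := h𝒜.mem_source_chartAt x
  have hz := h𝒞.mem_source_chartAt (f' (f x))
  have hg := hf'.analyticAt_localExpr h𝒜 h𝒞 hx hz
  have hrep := hf'.represents h𝒜 h𝒞 hx hz
  have hrepf := hf.1.represents h𝒜 hℬ hx (hℬ.mem_source_chartAt (f x))
  refine ⟨_, 𝒞.chartAt (f' (f x)), localExpr 𝒜 𝒞 (f' ∘ f) (𝒜.chartAt x) (𝒞.chartAt (f' (f x))) ∘ s,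
    ⟨hℬ.mem_source_chartAt (f x), hz, ?_⟩, AnalyticAt.comp (by rwa [hsx]) hs⟩
  obtain ⟨-, -, N, hN, hN'⟩ := hrep
  obtain ⟨-, -, N₁, hN₁, hN₁'⟩ := hrepf
  have hsc := hs.continuousAt
  have hNs := hsc.preimage_mem_nhds (by rw [hsx]; exact hN)
  have hN₁s := hsc.preimage_mem_nhds (by rw [hsx]; exact hN₁)
  have himg := hsc.preimage_mem_nhds (by rw [hsx]; exact h𝒜.image_mem_nhds hx)
  refine ⟨_, Filter.inter_mem (Filter.inter_mem hNs hN₁s) (Filter.inter_mem himg hr), ?_⟩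
  rintro y' ⟨hy', -⟩ ⟨⟨h1, h2⟩, ⟨⟨x', hx', hxs⟩, h4⟩⟩
  have h1' : s (ℬ.chart (ℬ.chartAt (f x)) y') ∈ N := h1
  have h2' : s (ℬ.chart (ℬ.chartAt (f x)) y') ∈ N₁ := h2
  have h4' : localExpr 𝒜 ℬ f (𝒜.chartAt x) (ℬ.chartAt (f x))
    (s (ℬ.chart (ℬ.chartAt (f x)) y')) = ℬ.chart (ℬ.chartAt (f x)) y' := h4
  rw [Function.comp_apply]
  rw [← hxs] at h1' h2' h4' ⊢
  obtain ⟨a1, a2⟩ := hN' x' ⟨hx', trivial⟩ h1'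
  obtain ⟨b1, b2⟩ := hN₁' x' ⟨hx', trivial⟩ h2'
  rw [h4'] at b2
  -- The point `x'` with coordinates `s (chart y')` lies over `y'`, so near `f x` the map `f'` is
  -- read off from `f' ∘ f` along the section.
  have hy : f x' = y' := hℬ.injOn _ b1 hy' b2.symm
  rw [a2, ← hy]
  rw [Function.comp_apply] at a1
  exact ⟨a1, rfl⟩

/-- The derivative of the inverse map is the required right inverse. -/
theorem Biholomorphic.isSubmersion (h𝒜 : 𝒜.IsBanachManifold) (hℬ : ℬ.IsBanachManifold)
    {f : X → Y} (hf : Biholomorphic 𝒜 ℬ f) : IsSubmersion 𝒜 ℬ f := by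
  obtain ⟨h1, g, hl, hr, h2⟩ := hf
  refine ⟨h1, fun x => ?_⟩
  have hx : g (f x) = x := hl x
  have h3 := Holomorphic.fderiv_localExpr_comp hℬ h𝒜 hℬ h1 h2 (x := f x)
    (hℬ.mem_source_chartAt (f x)) (j := 𝒜.chartAt x) (k := ℬ.chartAt (f x))
    (by rw [hx]; exact h𝒜.mem_source_chartAt x) (by rw [hx]; exact hℬ.mem_source_chartAt (f x))
  have h4 : f ∘ g = id := hr.comp_eq_id
  rw [h4, hℬ.fderiv_localExpr_id_self (hℬ.mem_source_chartAt (f x)), hx] at h3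
  exact ⟨_, fun w => (congrArg (fun L => L w) h3).symm⟩

theorem IsSubmersion.comp (h𝒜 : 𝒜.IsBanachManifold) (hℬ : ℬ.IsBanachManifold)
    (h𝒞 : 𝒞.IsBanachManifold) {f : X → Y} {f' : Y → Z} (hf' : IsSubmersion ℬ 𝒞 f')
    (hf : IsSubmersion 𝒜 ℬ f) : IsSubmersion 𝒜 𝒞 (f' ∘ f) := by
  refine ⟨hf'.1.comp hℬ hf.1, fun x => ?_⟩
  obtain ⟨s, hs⟩ := hf.2 x
  obtain ⟨s', hs'⟩ := hf'.2 (f x)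
  refine ⟨s.comp s', fun w => ?_⟩
  rw [Holomorphic.tangentMap_comp h𝒜 hℬ h𝒞 hf'.1 hf.1]
  exact (congrArg (tangentMap ℬ 𝒞 f' (f x)) (hs (s' w))).trans (hs' w)

/-! ## Quotients -/

/-- The atlas on `X` obtained from an atlas on `Y` by a bijection. -/
def comapAtlas (ℬ : BanachAtlas Y) (e : X → Y) : BanachAtlas X where
  ι := ℬ.ι
  E := ℬ.E
  source i := e ⁻¹' ℬ.source i
  chart i x := ℬ.chart i (e x)
  chartAt x := ℬ.chartAt (e x)

theorem IsBanachManifold.comapAtlas (hℬ : ℬ.IsBanachManifold) {e : X → Y}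
    (he : Function.Bijective e) : (ℬ.comapAtlas e).IsBanachManifold := by
  have himg : ∀ i S, (ℬ.comapAtlas e).chart i '' (e ⁻¹' S) = ℬ.chart i '' S := fun i S => by
    conv_rhs => rw [← Set.image_preimage_eq S he.2, Set.image_image]
    rfl
  refine ⟨fun x => hℬ.mem_source_chartAt (e x), fun i x hx y hy h =>
    he.1 (hℬ.injOn i hx hy h), fun i j => ?_, fun i j => ?_, fun x y hxy => ?_⟩
  · have := himg i (ℬ.source i ∩ ℬ.source j)
    rw [Set.preimage_inter] at this
    exact this ▸ hℬ.isOpen_image i j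
  · refine ⟨localExpr ℬ ℬ id i j, ?_, fun x hx => hℬ.localExpr_chart id j hx.1⟩
    rintro _ ⟨x, hx, rfl⟩
    exact hℬ.analyticAt_localExpr_id hx.1 hx.2
  · obtain ⟨U, V, hU, hV, h1, h2, hd⟩ := hℬ.t2 (e x) (e y) (he.1.ne hxy)
    have key : ∀ O, ℬ.IsOpenSet O → (ℬ.comapAtlas e).IsOpenSet (e ⁻¹' O) := by
      intro O hO i
      have := himg i (O ∩ ℬ.source i)
      rw [Set.preimage_inter] at this
      exact this ▸ hO i
    exact ⟨_, _, key U hU, key V hV, h1, h2, hd.preimage e⟩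

/-- With the atlas pulled back along `e`, the quotient map has literally the chart expressions of
`f`, so the hypothesis on `f` is the conclusion. Constructing a quotient thus amounts to finding a
submersion onto a known manifold whose fibres are the classes. -/
theorem exists_isQuotientManifold (hℬ : ℬ.IsBanachManifold) {s : Setoid X} {f : X → Y}
    (hf : IsSubmersion 𝒜 ℬ f) {e : Quotient s → Y} (he : Function.Bijective e)
    (hfe : ∀ x, e (Quotient.mk s x) = f x) : ∃ 𝒬, IsQuotientManifold 𝒜 s 𝒬 := by
  obtain rfl : f = fun x => e (Quotient.mk s x) := funext fun x => (hfe x).symm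
  exact ⟨ℬ.comapAtlas e, hℬ.comapAtlas he, hf⟩

/-- The bijection of a quotient manifold with the image of a submersion is biholomorphic. -/
theorem IsQuotientManifold.biholomorphic (h𝒜 : 𝒜.IsBanachManifold) (hℬ : ℬ.IsBanachManifold)
    {s : Setoid X} {𝒬 : BanachAtlas (Quotient s)} (h𝒬 : IsQuotientManifold 𝒜 s 𝒬) {f : X → Y}
    (hf : IsSubmersion 𝒜 ℬ f) {e : Quotient s → Y} (he : Function.Bijective e)
    (hfe : ∀ x, e (Quotient.mk s x) = f x) : Biholomorphic 𝒬 ℬ e := by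
  have hcomp : e ∘ Quotient.mk s = f := funext hfe
  obtain ⟨g, hl, hr⟩ := Function.bijective_iff_has_inverse.1 he
  have hsurj : Function.Surjective f := by
    rw [← hcomp]
    exact he.2.comp Quotient.mk_surjective
  -- Both the quotient map and `f` are surjective submersions, so `e` is tested after the former and
  -- its inverse after the latter.
  refine ⟨h𝒬.2.holomorphic_of_comp h𝒜 h𝒬.1 hℬ Quotient.mk_surjective (by rw [hcomp]; exact hf.1),
    g, hl, hr, hf.holomorphic_of_comp h𝒜 hℬ h𝒬.1 hsurj ?_⟩
  have : g ∘ f = Quotient.mk s := funext fun x => by rw [Function.comp_apply, ← hfe, hl]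
  rw [this]
  exact h𝒬.2.1

end BanachAtlas

/-! ### Transport of Banach-Lie groupoid structures along isomorphisms -/

namespace GroupoidMaps

variable {B G B' G' : Type u} {S : GroupoidMaps B G} {ℬ : BanachAtlas B} {𝒢 : BanachAtlas G}
  {S' : GroupoidMaps B' G'} {ℬ' : BanachAtlas B'} {𝒢' : BanachAtlas G'} {φ : G → G'} {φ₀ : B → B'}

/-- Banach-Lie groupoid structures are transported by isomorphisms. -/
theorem IsIso.isBanachLieGroupoid (h : IsIso S ℬ 𝒢 S' ℬ' 𝒢' φ φ₀) (hℬ : ℬ.IsBanachManifold)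
    (h𝒢 : 𝒢.IsBanachManifold) (h' : S'.IsBanachLieGroupoid ℬ' 𝒢')
    (hsrc : ∀ g k, S.src g = S.tgt k → S.src (S.mul g k) = S.src k)
    (htgt : ∀ g k, S.src g = S.tgt k → S.tgt (S.mul g k) = S.tgt g) :
    S.IsBanachLieGroupoid ℬ 𝒢 := by
  have hℬ' := h'.base_manifold
  have h𝒢' := h'.arrow_manifold
  have hs := h.base_biholomorphic.isSubmersion hℬ hℬ'
  have hsφ := h.arrow_biholomorphic.isSubmersion h𝒢 h𝒢'
  obtain ⟨hφ, ψ, hψφ, hφψ, hψ⟩ := h.arrow_biholomorphic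
  obtain ⟨hφ₀, ψ₀, hψφ₀, hφψ₀, hψ₀⟩ := h.base_biholomorphic
  have hψ₀s : IsSubmersion ℬ' ℬ ψ₀ :=
    Biholomorphic.isSubmersion hℬ' hℬ ⟨hψ₀, φ₀, hφψ₀, hψφ₀, hφ₀⟩
  have i₀ : Function.Injective φ₀ := hψφ₀.injective
  have i : Function.Injective φ := hψφ.injective
  have gr := h'.isGroupoid
  have hc : ∀ g k, S.src g = S.tgt k → S'.src (φ g) = S'.tgt (φ k) := fun g k e => by
    rw [h.map_src, h.map_tgt, e]
  have us : ∀ b, S.src (S.unit b) = b := fun b => i₀ (by rw [← h.map_src, h.map_unit, gr.src_unit])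
  have ut : ∀ b, S.tgt (S.unit b) = b := fun b => i₀ (by rw [← h.map_tgt, h.map_unit, gr.tgt_unit])
  have is : ∀ g, S.src (S.inv g) = S.tgt g := fun g =>
    i₀ (by rw [← h.map_src, h.map_inv, gr.src_inv, h.map_tgt])
  have it : ∀ g, S.tgt (S.inv g) = S.src g := fun g =>
    i₀ (by rw [← h.map_tgt, h.map_inv, gr.tgt_inv, h.map_src])
  refine ⟨⟨us, ut, hsrc, htgt, ?_, ?_, ?_, is, it, ?_, ?_⟩, hℬ, h𝒢, ?_, ?_, ?_, ?_, ?_⟩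
  -- The remaining algebraic identities are verified after applying the injective map `φ`.
  · intro g k l e1 e2
    apply i
    rw [h.map_mul _ _ ((hsrc g k e1).trans e2), h.map_mul g k e1,
      h.map_mul _ _ (e1.trans (htgt k l e2).symm), h.map_mul k l e2,
      gr.mul_assoc _ _ _ (hc g k e1) (hc k l e2)]
  · intro g
    apply i
    rw [h.map_mul _ _ (us _), h.map_unit, ← h.map_tgt, gr.unit_mul]
  · intro g
    apply i
    rw [h.map_mul _ _ (ut _).symm, h.map_unit, ← h.map_src, gr.mul_unit]
  · intro g
    apply i
    rw [h.map_mul _ _ (it g).symm, h.map_inv, gr.mul_inv, h.map_unit, h.map_tgt]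
  · intro g
    apply i
    rw [h.map_mul _ _ (is g), h.map_inv, gr.inv_mul, h.map_unit, h.map_src]
  -- Each structure map is that of `S'` conjugated by the isomorphism; biholomorphic maps are
  -- submersions, so source and target stay submersions.
  · have e : S.src = ψ₀ ∘ (S'.src ∘ φ) := funext fun g => by
      rw [Function.comp_apply, Function.comp_apply, h.map_src, hψφ₀]
    rw [e]
    exact hψ₀s.comp h𝒢 hℬ' hℬ (h'.src_submersion.comp h𝒢 h𝒢' hℬ' hsφ)
  · have e : S.tgt = ψ₀ ∘ (S'.tgt ∘ φ) := funext fun g => by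
      rw [Function.comp_apply, Function.comp_apply, h.map_tgt, hψφ₀]
    rw [e]
    exact hψ₀s.comp h𝒢 hℬ' hℬ (h'.tgt_submersion.comp h𝒢 h𝒢' hℬ' hsφ)
  · have e : S.unit = ψ ∘ (S'.unit ∘ φ₀) := funext fun g => by
      rw [Function.comp_apply, Function.comp_apply, ← h.map_unit, hψφ]
    rw [e]
    exact hψ.comp h𝒢' (h'.unit_holomorphic.comp hℬ' hφ₀)
  · have e : S.inv = ψ ∘ (S'.inv ∘ φ) := funext fun g => by
      rw [Function.comp_apply, Function.comp_apply, ← h.map_inv, hψφ]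
    rw [e]
    exact hψ.comp h𝒢' (h'.inv_holomorphic.comp h𝒢' hφ)
  · have h1 : HolomorphicOn (prodAtlas 𝒢 𝒢) (prodAtlas 𝒢' 𝒢') (Prod.map φ φ)
        {x | S.src x.1 = S.tgt x.2} := HolomorphicOn.prodMap hφ hφ
    have h2 := h'.mul_holomorphic.comp (h𝒢'.prodAtlas h𝒢') h1 (fun x hx => hc x.1 x.2 hx)
    have h3 : HolomorphicOn 𝒢' 𝒢 ψ Set.univ := hψ
    refine (h3.comp h𝒢' h2 (Set.mapsTo_univ _ _)).congr fun x hx => ?_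
    rw [Function.comp_apply, Function.comp_apply, Prod.map, ← h.map_mul _ _ hx, hψφ]

end GroupoidMaps

namespace PartialInv

variable {M : Type u} [CStarAlgebra M] {x y z p p' q p₀ : M}

/-! ## Inverses of partially invertible elements -/

namespace IsInverse

theorem pp (h : IsInverse x y p q) : p * p = p := h.hp.isIdempotentElem.eq

theorem qq (h : IsInverse x y p q) : q * q = q := h.hq.isIdempotentElem.eq

theorem pinv (h : IsInverse x y p q) : IsInverse x (pinv x) p q := by
  have h1 := isInverse_pinv h.partiallyInvertible
  rwa [h.rightSupport_eq, h.leftSupport_eq] at h1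

theorem pinv_eq (h : IsInverse x y p q) : PartialInv.pinv x = y := h.pinv.unique h

/-- On `p` the element `x* x` is inverted by `y y*`, and `1 - p` takes care of the complement. The
resulting formula for `q` is continuous in `x`, which is how supports, and hence points of the
manifolds, are mapped continuously to `M` in the Hausdorff arguments. -/
theorem star_mul_self_isUnit (h : IsInverse x y p q) :
    IsUnit (star x * x + (1 - p)) ∧ x * Ring.inverse (star x * x + (1 - p)) * star x = q := by
  have hp : star p = p := h.hp.isSelfAdjoint.star_eq
  have hq : star q = q := h.hq.isSelfAdjoint.star_eq
  have hsy : star x * star y = p := by rw [← star_mul, h.yx, hp]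
  have hsx : star y * star x = q := by rw [← star_mul, h.xy, hq]
  have hpx : p * star x = star x := by rw [← hp, ← star_mul, h.xp]
  have hyp : star y * p = star y := by rw [← hp, ← star_mul, h.py]
  have h1 : (star x * x + (1 - p)) * (y * star y + (1 - p)) = 1 := by
    have a1 : star x * x * (y * star y) = p := by
      rw [mul_assoc, ← mul_assoc x, h.xy, ← hsx]
      calc star x * (star y * star x * star y) = (star x * star y) * (star x * star y) := by
            simp only [mul_assoc]
        _ = p := by rw [hsy, h.pp]
    have a2 : star x * x * (1 - p) = 0 := by rw [mul_sub, mul_one, mul_assoc, h.xp, sub_self]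
    have a3 : (1 - p) * (y * star y) = 0 := by
      rw [sub_mul, one_mul, ← mul_assoc, h.py, sub_self]
    have a4 : (1 - p) * (1 - p) = 1 - p := by
      rw [sub_mul, one_mul, mul_sub, mul_one, h.pp, sub_self, sub_zero]
    rw [add_mul, mul_add, mul_add, a1, a2, a3, a4]
    abel
  have h2 : (y * star y + (1 - p)) * (star x * x + (1 - p)) = 1 := by
    have := congrArg star h1
    simpa [star_mul, hp] using this
  let w : Mˣ := ⟨_, _, h1, h2⟩
  refine ⟨w.isUnit, ?_⟩
  change x * Ring.inverse (w : M) * star x = q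
  rw [Ring.inverse_unit]
  change x * (y * star y + (1 - p)) * star x = q
  have h3 : x * (1 - p) = 0 := by rw [mul_sub, mul_one, h.xp, sub_self]
  rw [mul_add, h3, add_zero, ← mul_assoc, h.xy, mul_assoc, hsx, h.qq]

end IsInverse

theorem bundle_isInverse (η : bundle p₀) :
    IsInverse η.1 (pinv η.1) p₀ (leftSupport η.1) := by
  have h := isInverse_pinv η.2.1.1
  rwa [η.2.2] at h

theorem arrow_isInverse (x : arrows p₀) :
    IsInverse x.1 (pinv x.1) (rightSupport x.1) (leftSupport x.1) := isInverse_pinv x.2.1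

theorem mem_orbit_iff : q ∈ orbit p₀ ↔ ∃ x y, IsInverse x y p₀ q := by
  constructor
  · rintro ⟨x, hx, rfl, rfl⟩
    exact ⟨x, _, isInverse_pinv hx⟩
  · rintro ⟨x, y, h⟩
    exact ⟨x, h.partiallyInvertible, h.rightSupport_eq, h.leftSupport_eq⟩

namespace IsInverse

theorem mem_orbit (h : IsInverse x y p q) (hp : p ∈ orbit p₀) : q ∈ orbit p₀ := by
  obtain ⟨s, t, hs⟩ := mem_orbit_iff.1 hp
  exact mem_orbit_iff.2 ⟨_, _, h.mul hs⟩

theorem self_mem_orbit (h : IsInverse x y p₀ q) : p₀ ∈ orbit p₀ :=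
  mem_orbit_iff.2 ⟨_, _, of_isStarProjection h.hp⟩

theorem mem_bundle (h : IsInverse x y p₀ q) : x ∈ bundle p₀ :=
  ⟨h.mem_arrows h.self_mem_orbit (h.mem_orbit h.self_mem_orbit), h.rightSupport_eq⟩

end IsInverse

/-- Elements with a left inverse are partially invertible. -/
theorem exists_isInverse_of_mul_eq (hp : IsStarProjection p) (hx : x * p = x) (h : y * x = p) :
    ∃ z q, IsInverse x z p q := by
  let := CStarAlgebra.spectralOrder M
  have := CStarAlgebra.spectralOrderedRing M
  have hps : star p = p := hp.isSelfAdjoint.star_eq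
  have hpp : p * p = p := hp.isIdempotentElem.eq
  have hpx : p * star x = star x := by
    have := congrArg star hx
    rwa [star_mul, hps] at this
  -- Conjugating `y* y ≤ ‖y‖²` by `x` and using `y x = p` bounds `x* x` from below on `p`.
  have h1 : p ≤ (‖y‖ ^ 2 : ℝ) • (star x * x) := by
    have a1 : star y * y ≤ algebraMap ℝ M (‖y‖ ^ 2) := CStarAlgebra.star_mul_le_algebraMap_norm_sq
    have a2 := star_left_conjugate_le_conjugate a1 x
    have a3 : star x * (star y * y) * x = p := by
      calc star x * (star y * y) * x = star (y * x) * (y * x) := by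
            rw [star_mul]; simp only [mul_assoc]
        _ = p := by rw [h, hps, hpp]
    rwa [a3, Algebra.algebraMap_eq_smul_one, mul_smul_comm, smul_mul_assoc, mul_one] at a2
  have hu : IsUnit ((‖y‖ ^ 2 : ℝ) • (star x * x) + (1 - p)) := by
    refine CStarAlgebra.isUnit_of_le (1 : M) ?_
    calc (1 : M) = p + (1 - p) := by abel
      _ ≤ _ := by gcongr
  obtain ⟨w, hw⟩ := hu
  set c : ℝ := ‖y‖ ^ 2
  have hwp : (w : M) * p = c • (star x * x) := by
    rw [hw, add_mul, sub_mul, one_mul, hpp, sub_self, add_zero, smul_mul_assoc, mul_assoc, hx]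
  have hpw : p * (w : M) = c • (star x * x) := by
    rw [hw, mul_add, mul_sub, mul_one, hpp, sub_self, add_zero, mul_smul_comm, ← mul_assoc, hpx]
  have hws : star (w : M) = w := by
    rw [hw]
    simp [star_smul, hps]
  have hws' : star ((w⁻¹ : Mˣ) : M) = (w⁻¹ : Mˣ) := by
    rw [← Units.coe_star, star_inv]
    congr 2
    exact Units.ext hws
  have hwi : ((w⁻¹ : Mˣ) : M) * p = p * ((w⁻¹ : Mˣ) : M) := by
    rw [Units.inv_mul_eq_iff_eq_mul, ← mul_assoc, hwp, ← hpw, mul_assoc, Units.mul_inv, mul_one]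
  have hyx : c • ((w⁻¹ : Mˣ) : M) * star x * x = p := by
    rw [smul_mul_assoc, smul_mul_assoc, mul_assoc, ← mul_smul_comm, ← hwp, Units.inv_mul_cancel_left]
  -- For a general left inverse `y` the idempotent `x y` need not be self-adjoint. The left inverse
  -- `c w⁻¹ x*` is chosen so that `x` times it is the self-adjoint element `c x w⁻¹ x*`.
  refine ⟨c • ((w⁻¹ : Mˣ) : M) * star x, x * (c • ((w⁻¹ : Mˣ) : M) * star x), hp, ⟨?_, ?_⟩, hyx, rfl,
    hx, ?_⟩
  · change x * (c • ((w⁻¹ : Mˣ) : M) * star x) * (x * (c • ((w⁻¹ : Mˣ) : M) * star x)) = _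
    rw [mul_assoc x, ← mul_assoc _ x, hyx, smul_mul_assoc, mul_smul_comm, ← mul_assoc p, ← hwi,
      mul_assoc _ p, hpx]
  · rw [isSelfAdjoint_iff]
    simp [star_smul, hws', mul_assoc]
  · rw [smul_mul_assoc, mul_smul_comm, ← mul_assoc p, ← hwi, mul_assoc _ p, hpx]

/-- The element `z x` acts on `p` alone; adding `1 - p` turns invertibility in `p M p` into
invertibility in `M`, where the units are open and inversion is analytic. -/
theorem IsInverse.of_isUnit (h : IsInverse z y p' p) (hx : p' * x = x) (hxp : x * p = x)
    (hu : IsUnit (z * x + (1 - p))) :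
    IsInverse x (Ring.inverse (z * x + (1 - p)) * z) p p' := by
  obtain ⟨w, hw⟩ := hu
  rw [← hw, Ring.inverse_unit]
  have hwp : (w : M) * p = z * x := by
    rw [hw, add_mul, sub_mul, one_mul, h.qq, sub_self, add_zero, mul_assoc, hxp]
  have hpw : p * (w : M) = z * x := by
    rw [hw, mul_add, mul_sub, mul_one, h.qq, sub_self, add_zero, ← mul_assoc, h.qx]
  have hwi : ((w⁻¹ : Mˣ) : M) * p = p * ((w⁻¹ : Mˣ) : M) := by
    rw [Units.inv_mul_eq_iff_eq_mul, ← mul_assoc, hwp, ← hpw, mul_assoc, Units.mul_inv, mul_one]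
  refine ⟨h.hq, h.hp, ?_, ?_, hxp, ?_⟩
  · rw [mul_assoc, ← hwp, Units.inv_mul_cancel_left]
  · have h1 : x = y * z * x := by rw [h.yx, hx]
    calc x * (((w⁻¹ : Mˣ) : M) * z) = y * z * x * (((w⁻¹ : Mˣ) : M) * z) := by rw [← h1]
      _ = y * (z * x) * ((w⁻¹ : Mˣ) : M) * z := by simp only [mul_assoc]
      _ = y * (p * ((w : M) * ((w⁻¹ : Mˣ) : M))) * z := by rw [← hpw]; simp only [mul_assoc]
      _ = p' := by rw [Units.mul_inv, mul_one, mul_assoc, h.qx, h.yx]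
  · rw [← mul_assoc, ← hwi, mul_assoc, h.qx]

/-! ### Stability and analytic dependence of inverses -/

section Analytic

variable {E : Type*} [NormedAddCommGroup E] {F : E → M} {e : E}

theorem eventually_isUnit_mul_add (hF : ContinuousAt F e) (hz : z * F e = p) :
    ∀ᶠ e' in 𝓝 e, IsUnit (z * F e' + (1 - p)) := by
  have h1 : ContinuousAt (fun e' => z * F e' + (1 - p)) e := by fun_prop
  have h2 : IsUnit (z * F e + (1 - p)) := by simp [hz]
  exact h1.preimage_mem_nhds (Units.isOpen.mem_nhds h2)

theorem eventually_isInverse (hF : ContinuousAt F e) (hz : IsInverse (F e) z p p')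
    (hmem : ∀ᶠ e' in 𝓝 e, p' * F e' = F e' ∧ F e' * p = F e') :
    ∀ᶠ e' in 𝓝 e, IsInverse (F e') (pinv (F e')) p p' := by
  filter_upwards [eventually_isUnit_mul_add hF hz.yx, hmem] with e' h1 h2
  exact (hz.symm.of_isUnit h2.1 h2.2 h1).pinv

/-- Only the right support is prescribed here; the left support may move. This is the openness of
`P₀`. -/
theorem eventually_exists_isInverse (hF : ContinuousAt F e) (hz : IsInverse (F e) z p p')
    (hmem : ∀ᶠ e' in 𝓝 e, F e' * p = F e') :
    ∀ᶠ e' in 𝓝 e, ∃ q, IsInverse (F e') (pinv (F e')) p q := by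
  filter_upwards [eventually_isUnit_mul_add hF hz.yx, hmem] with e' h1 h2
  -- With `u = z F e' + (1 - p)` a unit one has `z F e' = u p`, so `u⁻¹ z` is a left inverse of `F
  -- e'`.
  have h3 : z * F e' = (z * F e' + (1 - p)) * p := by
    rw [add_mul, sub_mul, one_mul, hz.pp, sub_self, add_zero, mul_assoc, h2]
  obtain ⟨w, q, h⟩ := exists_isInverse_of_mul_eq
    (y := Ring.inverse (z * F e' + (1 - p)) * z) hz.hp h2
    (by rw [mul_assoc, h3, ← mul_assoc, ← h3, Ring.inverse_mul_cancel _ h1, one_mul])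
  exact ⟨q, h.pinv⟩

variable [NormedSpace ℂ E]

/-- The usual rule `d(F⁻¹) = -F⁻¹ dF F⁻¹`, obtained from inversion at the unit `1`, the value of `z
F + (1 - p)` at `e`. -/
theorem hasFDerivAt_pinv {F' : E →L[ℂ] M} (hF : HasFDerivAt F F' e)
    (hz : IsInverse (F e) z p p')
    (hmem : ∀ᶠ e' in 𝓝 e, p' * F e' = F e' ∧ F e' * p = F e') :
    ∃ L : E →L[ℂ] M, HasFDerivAt (fun e' => pinv (F e')) L e ∧ ∀ v, L v = -(z * F' v * z) := by
  have hc := hF.continuousAt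
  have heq : (fun e' => pinv (F e')) =ᶠ[𝓝 e]
      fun e' => Ring.inverse (z * F e' + (1 - p)) * z := by
    filter_upwards [eventually_isUnit_mul_add hc hz.yx, hmem] with e' h1 h2
    exact (hz.symm.of_isUnit h2.1 h2.2 h1).pinv_eq
  have h1 : z * F e + (1 - p) = ((1 : Mˣ) : M) := by simp [hz.yx]
  have h2 := hasFDerivAt_ringInverse (𝕜 := ℂ) (1 : Mˣ)
  rw [← h1] at h2
  have h3 : HasFDerivAt (fun e' => z * F e' + (1 - p)) (z • F') e :=
    (hF.const_mul z).add_const _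
  have h4 := ((h2.comp e h3).mul_const' z).congr_of_eventuallyEq heq
  refine ⟨_, h4, fun v => ?_⟩
  simp

theorem analyticAt_pinv (hF : AnalyticAt ℂ F e) (hz : IsInverse (F e) z p p')
    (hmem : ∀ᶠ e' in 𝓝 e, p' * F e' = F e' ∧ F e' * p = F e') :
    AnalyticAt ℂ (fun e' => pinv (F e')) e := by
  have hc := hF.continuousAt
  have heq : (fun e' => Ring.inverse (z * F e' + (1 - p)) * z) =ᶠ[𝓝 e]
      fun e' => pinv (F e') := by
    filter_upwards [eventually_isUnit_mul_add hc hz.yx, hmem] with e' h1 h2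
    exact (hz.symm.of_isUnit h2.1 h2.2 h1).pinv_eq.symm
  have h1 : z * F e + (1 - p) = ((1 : Mˣ) : M) := by simp [hz.yx]
  have h2 := analyticAt_inverse (𝕜 := ℂ) (1 : Mˣ)
  have h3 : AnalyticAt ℂ (fun e' => z * F e' + (1 - p)) e := by fun_prop
  exact ((AnalyticAt.comp_of_eq h2 h3 h1).mul analyticAt_const).congr heq

end Analytic

/-! ## The corners -/

/-- The projection `x ↦ a x b` of `M` to the corner `a M b`. -/
noncomputable def toCorner {a b : M} (ha : IsIdempotentElem a) (hb : IsIdempotentElem b) :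
    M →L[ℂ] corner a b :=
  (((ContinuousLinearMap.mul ℂ M a).comp ((ContinuousLinearMap.mul ℂ M).flip b))).codRestrict
    (corner a b) (fun x => (mem_corner_iff_exists ha hb).2 ⟨x, by simp [mul_assoc]⟩)

@[simp]
theorem toCorner_coe {a b : M} (ha : IsIdempotentElem a) (hb : IsIdempotentElem b) (x : M) :
    (toCorner ha hb x : M) = a * x * b := by
  simp [toCorner, mul_assoc]

theorem toCorner_of_mem {a b : M} (ha : IsIdempotentElem a) (hb : IsIdempotentElem b)
    (x : corner a b) : toCorner ha hb x.1 = x :=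
  Subtype.ext (by rw [toCorner_coe, x.2.1, x.2.2])

theorem analyticAt_corner_coe {a b : M} (x : corner a b) :
    AnalyticAt ℂ (fun x : corner a b => (x : M)) x :=
  (corner a b).subtypeL.analyticAt x

/-! ## The splittings -/

theorem mem_rightIdeal_iff (hq : q * q = q) : x ∈ rightIdeal q ↔ q * x = x := by
  constructor
  · rintro ⟨y, rfl⟩
    rw [LinearMap.mulLeft_apply, ← mul_assoc, hq]
  · exact fun h => ⟨x, h⟩

/-- The normalisation `p x = p` forces `y = p q`, so left multiplication by `p` is injective on `q
M`. -/
theorem eq_zero_of_splits (h : IsInverse x y p q) (hpx : p * x = p) (h1 : q * z = z)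
    (h2 : p * z = 0) : z = 0 := by
  have hw : p * q = y := by rw [← h.xy, ← mul_assoc, hpx, h.py]
  rw [← h1, ← h.xy, ← hw, mul_assoc, mul_assoc, h1, h2, mul_zero]

/-- The element `x` plays the part of `σ_p(q)`: it is the graph over `p` of the range of `q`. -/
theorem splits_of_isInverse (h : IsInverse x y p q) (hpx : p * x = p) : Splits p q := by
  have hp1 : (1 - p) * (1 - p) = 1 - p := h.hp.one_sub.isIdempotentElem.eq
  refine ⟨?_, ?_⟩
  · rw [disjoint_iff, eq_bot_iff]
    rintro m ⟨h1, h2⟩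
    have h1' := (mem_rightIdeal_iff h.qq).1 h1
    have h2' := (mem_rightIdeal_iff hp1).1 h2
    rw [sub_mul, one_mul, sub_eq_self] at h2'
    exact eq_zero_of_splits h hpx h1' h2'
  · rw [codisjoint_iff, eq_top_iff]
    rintro m -
    -- The splitting is `m = x m + (m - x m)`; the second summand is killed by `p` because `p x =
    -- p`.
    refine Submodule.mem_sup.2 ⟨x * m, (mem_rightIdeal_iff h.qq).2 ?_, m - x * m,
      (mem_rightIdeal_iff hp1).2 ?_, add_sub_cancel _ _⟩
    · rw [← mul_assoc, h.qx]
    · rw [sub_mul, one_mul, mul_sub p, ← mul_assoc, hpx, sub_self, sub_zero]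

theorem sigma_eq_of_isInverse (h : IsInverse x y p q) (hpx : p * x = p) : sigma p q = x := by
  obtain ⟨h1, h2⟩ := sigma_spec h.hp h.hq (splits_of_isInverse h hpx)
  rw [← sub_eq_zero]
  refine eq_zero_of_splits h hpx ?_ ?_
  · rw [mul_sub, h1.qx, h.qx]
  · rw [mul_sub, h2, hpx, sub_self]

theorem Splits.isInverse_mul (h : Splits p' q) (hp' : IsStarProjection p')
    (hx : IsInverse x y p q) : IsInverse (p' * x) (pinv (p' * x)) p p' := by
  obtain ⟨h1, -⟩ := sigma_spec hp' hx.hq h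
  have h2 := h1.symm.mul hx
  rw [mul_assoc, hx.qx] at h2
  exact h2.pinv

theorem IsInverse.mul_pinv_mul (hx : IsInverse x y p q) (hz : IsInverse (p' * x) z p p') :
    IsInverse (x * PartialInv.pinv (p' * x)) (p' * x * y) p' q ∧
      p' * (x * PartialInv.pinv (p' * x)) = p' :=
  ⟨hx.mul hz.pinv.symm, by rw [← mul_assoc, hz.pinv.xy]⟩

theorem IsInverse.splits (hx : IsInverse x y p q) (hz : IsInverse (p' * x) z p p') :
    Splits p' q :=
  splits_of_isInverse (hx.mul_pinv_mul hz).1 (hx.mul_pinv_mul hz).2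

/-- The formula holds for any `x` with left support `q`, so a chart can be computed from whichever
representative is at hand; all transition maps are derived from it. -/
theorem Splits.sigma_eq (h : Splits p' q) (hp' : IsStarProjection p') (hx : IsInverse x y p q) :
    sigma p' q = x * pinv (p' * x) := by
  have h1 := hx.mul_pinv_mul (h.isInverse_mul hp' hx)
  exact sigma_eq_of_isInverse h1.1 h1.2

theorem Splits.pinv_sigma (h : Splits p' q) (hp' : IsStarProjection p') (hq : IsStarProjection q) :
    pinv (sigma p' q) = p' * q :=
  (sigma_spec hp' hq h).1.pinv_eq

theorem splits_self (hp : IsStarProjection p) : Splits p p :=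
  splits_of_isInverse (IsInverse.of_isStarProjection hp) hp.isIdempotentElem.eq

theorem sigma_self (hp : IsStarProjection p) : sigma p p = p :=
  sigma_eq_of_isInverse (IsInverse.of_isStarProjection hp) hp.isIdempotentElem.eq

theorem phi_coe (hp : IsStarProjection p) (hq : IsStarProjection q) (h : Splits p q) :
    (phi p q hp hq : M) = sigma p q - p := by
  unfold phi
  rw [dif_pos h]

end PartialInv

namespace PartialInv

variable {M : Type u} [CStarAlgebra M] {p₀ : M}

theorem orbit_proj (p : orbit p₀) : IsStarProjection p.1 := isStarProjection_of_mem_orbit p.2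

theorem orbit_idem (p : orbit p₀) : IsIdempotentElem p.1 := (orbit_proj p).isIdempotentElem

theorem orbit_idem' (p : orbit p₀) : IsIdempotentElem (1 - p.1) :=
  (orbit_proj p).one_sub.isIdempotentElem

/-! ## The manifold of projections -/

/-- The chart `φ_p` of the orbit. -/
noncomputable def baseChart (p q : orbit p₀) : corner (1 - p.1) p.1 :=
  phi p.1 q.1 (isStarProjection_of_mem_orbit p.2) (isStarProjection_of_mem_orbit q.2)

/-- The element of `(1 - p) M p` whose graph over `p` has the range of `x`, in coordinates: the
chart `φ_p` at the left support of `x`. -/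
noncomputable def slope (p : orbit p₀) (x : M) : corner (1 - p.1) p.1 :=
  toCorner (orbit_idem' p) (orbit_idem p) (x * pinv (p.1 * x))

theorem add_baseChart {p q : orbit p₀} (h : Splits p.1 q.1) :
    p.1 + (baseChart p q).1 = sigma p.1 q.1 := by
  unfold baseChart
  rw [phi_coe _ _ h, add_sub_cancel]

theorem isInverse_sigma {p q : orbit p₀} (h : Splits p.1 q.1) :
    IsInverse (sigma p.1 q.1) (p.1 * q.1) p.1 q.1 :=
  (sigma_spec (orbit_proj p) (orbit_proj q) h).1

theorem mul_sigma {p q : orbit p₀} (h : Splits p.1 q.1) : p.1 * sigma p.1 q.1 = p.1 :=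
  (sigma_spec (orbit_proj p) (orbit_proj q) h).2

theorem baseChart_eq_slope {p q : orbit p₀} (h : Splits p.1 q.1) {x y r : M}
    (hx : IsInverse x y r q.1) : baseChart p q = slope p x := by
  rw [← toCorner_of_mem (orbit_idem' p) (orbit_idem p) (baseChart p q), slope,
    ← h.sigma_eq (orbit_proj p) hx, ← add_baseChart h]
  refine Subtype.ext ?_
  rw [toCorner_coe, toCorner_coe, mul_add (1 - p.1), sub_mul 1 p.1 p.1, one_mul, (orbit_idem p).eq,
    sub_self, zero_add]

theorem mul_add_corner {p : M} (hp : IsIdempotentElem p) (a : corner (1 - p) p) :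
    p * (p + a.1) = p := by
  have h := a.2.1
  rw [sub_mul, one_mul, sub_eq_self] at h
  rw [mul_add, hp.eq, h, add_zero]

theorem add_corner_mul {p : M} (hp : IsIdempotentElem p) (a : corner (1 - p) p) :
    (p + a.1) * p = p + a.1 := by
  rw [add_mul, hp.eq, a.2.2]

/-- Since `p (p + a) = p`, the projection `p` is a left inverse of `p + a`, whose left support is
the required `q`. Thus each chart maps onto its whole model space. -/
theorem exists_baseChart_eq (p : orbit p₀) (a : corner (1 - p.1) p.1) :
    ∃ q : orbit p₀, IsInverse (p.1 + a.1) (pinv (p.1 + a.1)) p.1 q.1 ∧ Splits p.1 q.1 ∧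
      baseChart p q = a := by
  have h1 := mul_add_corner (orbit_idem p) a
  obtain ⟨y, q, h⟩ := exists_isInverse_of_mul_eq (orbit_proj p) (add_corner_mul (orbit_idem p) a) h1
  have hs := splits_of_isInverse h h1
  let q' : orbit p₀ := ⟨q, h.mem_orbit p.2⟩
  have hs' : Splits p.1 q'.1 := hs
  refine ⟨q', h.pinv, hs, Subtype.ext ?_⟩
  have h2 := add_baseChart hs'
  rw [sigma_eq_of_isInverse h h1] at h2
  exact add_left_cancel h2

/-! ### Supports and slopes of elements depending on a parameter -/

section Analytic

variable {E : Type*} [NormedAddCommGroup E] {F : E → M} {e : E}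

theorem eventually_isInverse_mul {r z : M} (p : orbit p₀) (hF : ContinuousAt F e)
    (hz : IsInverse (p.1 * F e) z r p.1) (hmem : ∀ᶠ e' in 𝓝 e, F e' * r = F e') :
    ∀ᶠ e' in 𝓝 e, IsInverse (p.1 * F e') (pinv (p.1 * F e')) r p.1 := by
  refine eventually_isInverse (F := fun e' => p.1 * F e') (by fun_prop) hz ?_
  filter_upwards [hmem] with e' he
  exact ⟨by rw [← mul_assoc, (orbit_idem p).eq], by rw [mul_assoc, he]⟩

theorem continuousAt_leftSupport {y p q : M} (hF : ContinuousAt F e) (h : IsInverse (F e) y p q) :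
    ContinuousAt (fun e => F e * Ring.inverse (star (F e) * F e + (1 - p)) * star (F e)) e := by
  obtain ⟨w, hw⟩ := h.star_mul_self_isUnit.1
  have h1 := NormedRing.inverse_continuousAt w
  rw [hw] at h1
  have h2 : ContinuousAt (fun e => star (F e) * F e + (1 - p)) e := by fun_prop
  have h3 : ContinuousAt (fun e => Ring.inverse (star (F e) * F e + (1 - p))) e :=
    ContinuousAt.comp (g := Ring.inverse) h1 h2
  fun_prop

variable [NormedSpace ℂ E]

theorem analyticAt_pinv_mul {r z : M} (p : orbit p₀) (hF : AnalyticAt ℂ F e)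
    (hz : IsInverse (p.1 * F e) z r p.1) (hmem : ∀ᶠ e' in 𝓝 e, F e' * r = F e') :
    AnalyticAt ℂ (fun e' => pinv (p.1 * F e')) e := by
  refine analyticAt_pinv (F := fun e' => p.1 * F e') (by fun_prop) hz ?_
  filter_upwards [hmem] with e' he
  exact ⟨by rw [← mul_assoc, (orbit_idem p).eq], by rw [mul_assoc, he]⟩

theorem analyticAt_toCorner {a b : M} (ha : IsIdempotentElem a) (hb : IsIdempotentElem b)
    (hF : AnalyticAt ℂ F e) : AnalyticAt ℂ (fun e' => toCorner ha hb (F e')) e :=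
  ((toCorner ha hb).analyticAt _).comp hF

theorem analyticAt_slope {r z : M} (p : orbit p₀) (hF : AnalyticAt ℂ F e)
    (hz : IsInverse (p.1 * F e) z r p.1) (hmem : ∀ᶠ e' in 𝓝 e, F e' * r = F e') :
    AnalyticAt ℂ (fun e' => slope p (F e')) e :=
  analyticAt_toCorner _ _ (hF.mul (analyticAt_pinv_mul p hF hz hmem))

end Analytic

theorem analyticAt_add_corner {p : M} (a : corner (1 - p) p) :
    AnalyticAt ℂ (fun a : corner (1 - p) p => p + a.1) a :=
  analyticAt_const.add (analyticAt_corner_coe a)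

theorem eventually_add_corner_mul {p : M} (hp : IsIdempotentElem p) (a : corner (1 - p) p) :
    ∀ᶠ a : corner (1 - p) p in 𝓝 a, (p + a.1) * p = p + a.1 :=
  Filter.Eventually.of_forall fun a => add_corner_mul hp a

theorem Splits.isInverse_add {p p' q : orbit p₀} (h : Splits p.1 q.1) (h' : Splits p'.1 q.1) :
    IsInverse (p'.1 * (p.1 + (baseChart p q).1)) (pinv (p'.1 * (p.1 + (baseChart p q).1)))
      p.1 p'.1 := by
  rw [add_baseChart h]
  exact h'.isInverse_mul (orbit_proj p') (isInverse_sigma h)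

/-- In the chart at `p` the overlap with `Π_{p'}` is the set of `a` for which `p' (p + a)` is
invertible. -/
theorem isOpen_baseChart_image (p p' : orbit p₀) :
    IsOpen (baseChart p '' {q | Splits p.1 q.1 ∧ Splits p'.1 q.1}) := by
  rw [isOpen_iff_mem_nhds]
  rintro _ ⟨q, ⟨h, h'⟩, rfl⟩
  filter_upwards [eventually_isInverse_mul p' (analyticAt_add_corner (baseChart p q)).continuousAt
    (h.isInverse_add h') (eventually_add_corner_mul (orbit_idem p) _)] with a ha
  obtain ⟨q', h1, h2, rfl⟩ := exists_baseChart_eq p a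
  exact ⟨q', ⟨h2, h1.splits ha⟩, rfl⟩

/-- The projection is recovered from its coordinate as the left support of `p + φ_p(q)`. -/
theorem baseChart_injOn (p : orbit p₀) : Set.InjOn (baseChart p) {q | Splits p.1 q.1} := by
  intro q hq q' hq' h
  have h1 := add_baseChart hq
  rw [h, add_baseChart hq'] at h1
  have h2 := isInverse_sigma hq
  rw [← h1] at h2
  exact Subtype.ext (h2.leftSupport_eq.symm.trans (isInverse_sigma hq').leftSupport_eq)

theorem isBanachManifold_orbitAtlas : (orbitAtlas p₀).IsBanachManifold := by
  refine ⟨fun q => splits_self (orbit_proj q), baseChart_injOn, isOpen_baseChart_image, ?_, ?_⟩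
  · intro (p : orbit p₀) (p' : orbit p₀)
    refine ⟨fun a : corner (1 - p.1) p.1 => slope p' (p.1 + a.1), ?_, ?_⟩
    · rintro _ ⟨q, hq, rfl⟩
      have h1 := analyticAt_slope p' (analyticAt_add_corner (baseChart p q))
        (Splits.isInverse_add hq.1 hq.2) (eventually_add_corner_mul (orbit_idem p) _)
      exact h1
    · rintro q hq
      have h1 : baseChart p' q = slope p' (p.1 + (baseChart p q).1) := by
        rw [add_baseChart hq.1]
        exact baseChart_eq_slope hq.2 (isInverse_sigma hq.1)
      exact h1.symm
  · have hopen : ∀ p : orbit p₀, IsOpen (baseChart p '' {q | Splits p.1 q.1}) := fun p => by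
      simpa using isOpen_baseChart_image p p
    refine t2_of_injective hopen (F := Subtype.val) Subtype.val_injective ?_
    intro (p : orbit p₀) q hq
    -- The inclusion of the orbit in `M`, read in the chart: the formula for the left support of `p
    -- + a`.
    refine ⟨fun a : corner (1 - p.1) p.1 => (p.1 + a.1) *
      Ring.inverse (star (p.1 + a.1) * (p.1 + a.1) + (1 - p.1)) * star (p.1 + a.1), ?_, ?_⟩
    · have h1 := continuousAt_leftSupport (analyticAt_add_corner (baseChart p q)).continuousAt
        (y := p.1 * q.1) (p := p.1) (q := q.1) (by
          rw [add_baseChart hq]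
          exact isInverse_sigma hq)
      exact h1
    · refine Filter.Eventually.of_forall ?_
      rintro _ q' hq' rfl
      have h1 : (q' : M) = (p.1 + (baseChart p q').1) * Ring.inverse
          (star (p.1 + (baseChart p q').1) * (p.1 + (baseChart p q').1) + (1 - p.1)) *
            star (p.1 + (baseChart p q').1) := by
        rw [add_baseChart hq', (isInverse_sigma hq').star_mul_self_isUnit.2]
      exact h1

/-! ## The manifold of arrows -/

/-- The left support as a point of the orbit. -/
noncomputable def tgt (x : arrows p₀) : orbit p₀ := (groupoid p₀).tgt x

/-- The right support as a point of the orbit. -/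
noncomputable def src (x : arrows p₀) : orbit p₀ := (groupoid p₀).src x

theorem isInverse_arrow (x : arrows p₀) : IsInverse x.1 (pinv x.1) (src x).1 (tgt x).1 :=
  arrow_isInverse x

/-- The domain of the chart indexed by `(p', p)`. -/
def arrowSource (i : orbit p₀ × orbit p₀) : Set (arrows p₀) :=
  {x | Splits i.1.1 (tgt x).1 ∧ Splits i.2.1 (src x).1}

/-- The model space of the chart indexed by `(p', p)`. -/
abbrev arrowModel (i : orbit p₀ × orbit p₀) : Type u :=
  corner (1 - i.1.1) i.1.1 × corner i.1.1 i.2.1 × corner (1 - i.2.1) i.2.1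

/-- The chart indexed by `(p', p)`. -/
noncomputable def arrowChart (i : orbit p₀ × orbit p₀) (x : arrows p₀) : arrowModel i :=
  (baseChart i.1 (tgt x), middle i.1 i.2 x, baseChart i.2 (src x))

variable {i j : orbit p₀ × orbit p₀} {x : arrows p₀}

/-- Because `σ_{p'}(q)⁻¹ = p' q`, the left factor of the middle coordinate reduces to `p'`. -/
theorem middle_coe (hx : x ∈ arrowSource i) :
    (middle i.1 i.2 x : M) = i.1.1 * x.1 * sigma i.2.1 (src x).1 := by
  have h : middle i.1 i.2 x = ⟨pinv (sigma i.1.1 (leftSupport x.1)) * x.1 *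
      sigma i.2.1 (rightSupport x.1), _⟩ := dif_pos hx
  rw [h]
  change pinv (sigma i.1.1 (tgt x).1) * x.1 * sigma i.2.1 (src x).1 = _
  rw [hx.1.pinv_sigma (orbit_proj i.1) (orbit_proj (tgt x)), mul_assoc i.1.1,
    (isInverse_arrow x).qx]

theorem isInverse_middle (hx : x ∈ arrowSource i) :
    IsInverse (middle i.1 i.2 x).1 (i.2.1 * pinv x.1 * sigma i.1.1 (tgt x).1) i.2.1 i.1.1 := by
  have h := ((isInverse_sigma hx.1).symm.mul (isInverse_arrow x)).mul (isInverse_sigma hx.2)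
  rw [middle_coe hx]
  rwa [mul_assoc i.1.1, (isInverse_arrow x).qx, ← mul_assoc, mul_assoc i.2.1 _ (pinv x.1),
    (isInverse_arrow x).py] at h

theorem arrow_eq (hx : x ∈ arrowSource i) :
    x.1 = (i.1.1 + (arrowChart i x).1.1) * (arrowChart i x).2.1.1 *
      (i.2.1 * (src x).1) := by
  change x.1 = (i.1.1 + (baseChart i.1 (tgt x)).1) * (middle i.1 i.2 x).1 * (i.2.1 * (src x).1)
  rw [add_baseChart hx.1, middle_coe hx]
  have h1 := isInverse_sigma hx.1
  have h2 := isInverse_sigma hx.2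
  have h3 := isInverse_arrow x
  calc x.1 = (tgt x).1 * x.1 * (src x).1 := by rw [h3.qx, h3.xp]
    _ = sigma i.1.1 (tgt x).1 * (i.1.1 * (tgt x).1) * x.1 *
        (sigma i.2.1 (src x).1 * (i.2.1 * (src x).1)) := by rw [h1.xy, h2.xy]
    _ = sigma i.1.1 (tgt x).1 * (i.1.1 * ((tgt x).1 * x.1)) *
        (sigma i.2.1 (src x).1 * (i.2.1 * (src x).1)) := by simp only [mul_assoc]
    _ = _ := by rw [h3.qx]; simp only [mul_assoc]

/-- The chart image consists of the triples `(a, m, b)` with `m` invertible and `a`, `b` arbitrary;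
the arrow is `(p' + a) m (p + b)⁻¹`. -/
theorem exists_arrowChart_eq (i : orbit p₀ × orbit p₀) (z : arrowModel i) {n : M}
    (hm : IsInverse z.2.1.1 n i.2.1 i.1.1) :
    ∃ x ∈ arrowSource i, arrowChart i x = z ∧
      IsInverse (i.1.1 + z.1.1) (pinv (i.1.1 + z.1.1)) i.1.1 (tgt x).1 ∧
      IsInverse (i.2.1 + z.2.2.1) (pinv (i.2.1 + z.2.2.1)) i.2.1 (src x).1 ∧
      x.1 * (i.2.1 + z.2.2.1) = (i.1.1 + z.1.1) * z.2.1.1 := by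
  obtain ⟨q', h1, h2, h3⟩ := exists_baseChart_eq i.1 z.1
  obtain ⟨q, k1, k2, k3⟩ := exists_baseChart_eq i.2 z.2.2
  have h := (h1.mul hm).mul k1.symm
  have ht : tgt (⟨_, h.mem_arrows q.2 q'.2⟩ : arrows p₀) = q' := Subtype.ext h.leftSupport_eq
  have hs : src (⟨_, h.mem_arrows q.2 q'.2⟩ : arrows p₀) = q := Subtype.ext h.rightSupport_eq
  have hsrc : (⟨_, h.mem_arrows q.2 q'.2⟩ : arrows p₀) ∈ arrowSource i := by
    refine ⟨?_, ?_⟩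
    · rw [ht]; exact h2
    · rw [hs]; exact k2
  have hmul : (i.1.1 + z.1.1) * z.2.1.1 * pinv (i.2.1 + z.2.2.1) * (i.2.1 + z.2.2.1) =
      (i.1.1 + z.1.1) * z.2.1.1 := by
    rw [mul_assoc _ (pinv _), k1.yx, mul_assoc, z.2.1.2.2]
  refine ⟨_, hsrc, ?_, by rw [ht]; exact h1, by rw [hs]; exact k1, hmul⟩
  refine Prod.ext ?_ (Prod.ext (Subtype.ext ?_) ?_)
  · change baseChart i.1 (tgt _) = _
    rw [ht, h3]
  · change (middle i.1 i.2 _).1 = _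
    rw [middle_coe hsrc, hs, ← add_baseChart k2, k3]
    change i.1.1 * ((i.1.1 + z.1.1) * z.2.1.1 * pinv (i.2.1 + z.2.2.1)) * (i.2.1 + z.2.2.1) = _
    rw [mul_assoc, hmul, ← mul_assoc, mul_add_corner (orbit_idem i.1), z.2.1.2.1]
  · change baseChart i.2 (src _) = _
    rw [hs, k3]

theorem arrowChart_injOn (i : orbit p₀ × orbit p₀) :
    Set.InjOn (arrowChart i) (arrowSource i) := by
  intro x hx y hy h
  have h2 : src x = src y := baseChart_injOn i.2 hx.2 hy.2
    (congrArg (fun z => z.2.2) h : (arrowChart i x).2.2 = (arrowChart i y).2.2)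
  refine Subtype.ext ?_
  rw [arrow_eq hx, arrow_eq hy, h, h2]

/-- The change of charts of the manifold of arrows. -/
noncomputable def arrowTrans (i j : orbit p₀ × orbit p₀) (z : arrowModel i) : arrowModel j :=
  (slope j.1 (i.1.1 + z.1.1),
    toCorner (orbit_idem j.1) (orbit_idem j.2)
      (j.1.1 * (i.1.1 + z.1.1) * z.2.1.1 * pinv (j.2.1 * (i.2.1 + z.2.2.1))),
    slope j.2 (i.2.1 + z.2.2.1))

theorem arrowTrans_arrowChart (hi : x ∈ arrowSource i) (hj : x ∈ arrowSource j) :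
    arrowTrans i j (arrowChart i x) = arrowChart j x := by
  have e1 : i.1.1 + (arrowChart i x).1.1 = sigma i.1.1 (tgt x).1 := add_baseChart hi.1
  have e2 : i.2.1 + (arrowChart i x).2.2.1 = sigma i.2.1 (src x).1 := add_baseChart hi.2
  have h1 := isInverse_sigma hi.1
  have h2 := isInverse_sigma hi.2
  refine Prod.ext ?_ (Prod.ext (Subtype.ext ?_) ?_)
  · change slope j.1 (i.1.1 + (arrowChart i x).1.1) = baseChart j.1 (tgt x)
    rw [e1, baseChart_eq_slope hj.1 h1]
  · change (toCorner (orbit_idem j.1) (orbit_idem j.2)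
      (j.1.1 * (i.1.1 + (arrowChart i x).1.1) * (arrowChart i x).2.1.1 *
        pinv (j.2.1 * (i.2.1 + (arrowChart i x).2.2.1))) : M) = (middle j.1 j.2 x).1
    -- The relation `x σ_p = σ_{p'} m` between an arrow and its middle coordinate. The new middle
    -- coordinate follows from it and from `σ` at the new source index being the old `σ` times an
    -- inverse.
    have h3 : x.1 * (i.2.1 + (arrowChart i x).2.2.1) =
        (i.1.1 + (arrowChart i x).1.1) * (arrowChart i x).2.1.1 := by
      conv_lhs => rw [arrow_eq hi]
      rw [e2, mul_assoc, h2.yx, mul_assoc, (arrowChart i x).2.1.2.2]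
    rw [mul_assoc j.1.1, ← h3, e2, middle_coe hj, hj.2.sigma_eq (orbit_proj j.2) h2, toCorner_coe]
    have h4 := hj.2.isInverse_mul (orbit_proj j.2) h2
    have h5 : pinv (j.2.1 * sigma i.2.1 (src x).1) * j.2.1 =
      pinv (j.2.1 * sigma i.2.1 (src x).1) := h4.yq
    simp only [mul_assoc, h5]
    rw [← mul_assoc j.1.1, (orbit_idem j.1).eq]
  · change slope j.2 (i.2.1 + (arrowChart i x).2.2.1) = baseChart j.2 (src x)
    rw [e2, baseChart_eq_slope hj.2 h2]

section ModelAnalytic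

variable (z : arrowModel i)

theorem analyticAt_model_fst : AnalyticAt ℂ (fun z : arrowModel i => i.1.1 + z.1.1) z :=
  (analyticAt_add_corner z.1).comp analyticAt_fst

theorem analyticAt_model_mid : AnalyticAt ℂ (fun z : arrowModel i => z.2.1.1) z :=
  (analyticAt_corner_coe z.2.1).comp (f := fun z : arrowModel i => z.2.1)
    (((ContinuousLinearMap.fst ℂ _ _).comp (ContinuousLinearMap.snd ℂ _ _)).analyticAt z)

theorem analyticAt_model_snd : AnalyticAt ℂ (fun z : arrowModel i => i.2.1 + z.2.2.1) z :=
  (analyticAt_add_corner z.2.2).comp (f := fun z : arrowModel i => z.2.2)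
    (((ContinuousLinearMap.snd ℂ _ _).comp (ContinuousLinearMap.snd ℂ _ _)).analyticAt z)

theorem eventually_model_fst :
    ∀ᶠ z : arrowModel i in 𝓝 z, (i.1.1 + z.1.1) * i.1.1 = i.1.1 + z.1.1 :=
  Filter.Eventually.of_forall fun z => add_corner_mul (orbit_idem i.1) z.1

theorem eventually_model_snd :
    ∀ᶠ z : arrowModel i in 𝓝 z, (i.2.1 + z.2.2.1) * i.2.1 = i.2.1 + z.2.2.1 :=
  Filter.Eventually.of_forall fun z => add_corner_mul (orbit_idem i.2) z.2.2

theorem eventually_model_mid :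
    ∀ᶠ z : arrowModel i in 𝓝 z, i.1.1 * z.2.1.1 = z.2.1.1 ∧ z.2.1.1 * i.2.1 = z.2.1.1 :=
  Filter.Eventually.of_forall fun z => z.2.1.2

end ModelAnalytic

/-- Three open conditions describe the overlap: one on each outer coordinate as for the orbit, and
invertibility of the middle one. -/
theorem isOpen_arrowChart_image (i j : orbit p₀ × orbit p₀) :
    IsOpen (arrowChart i '' (arrowSource i ∩ arrowSource j)) := by
  rw [isOpen_iff_mem_nhds]
  rintro _ ⟨x, ⟨hi, hj⟩, rfl⟩
  filter_upwards [eventually_isInverse_mul j.1 (analyticAt_model_fst (arrowChart i x)).continuousAt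
      (Splits.isInverse_add hi.1 hj.1) (eventually_model_fst _),
    eventually_isInverse_mul j.2 (analyticAt_model_snd (arrowChart i x)).continuousAt
      (Splits.isInverse_add hi.2 hj.2) (eventually_model_snd _),
    eventually_isInverse (analyticAt_model_mid (arrowChart i x)).continuousAt
      (isInverse_middle hi) (eventually_model_mid _)] with z h1 h2 h3
  obtain ⟨y, hy, rfl, k1, k2, -⟩ := exists_arrowChart_eq i z h3
  exact ⟨y, ⟨hy, k1.splits h1, k2.splits h2⟩, rfl⟩

theorem analyticAt_arrowTrans (hi : x ∈ arrowSource i) (hj : x ∈ arrowSource j) :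
    AnalyticAt ℂ (arrowTrans i j) (arrowChart i x) := by
  have h1 := analyticAt_model_fst (arrowChart i x)
  have h2 := analyticAt_model_snd (arrowChart i x)
  have h3 := analyticAt_model_mid (arrowChart i x)
  refine (analyticAt_slope j.1 h1 (Splits.isInverse_add hi.1 hj.1) (eventually_model_fst _)).prod
    ((analyticAt_toCorner _ _ ?_).prod
      (analyticAt_slope j.2 h2 (Splits.isInverse_add hi.2 hj.2) (eventually_model_snd _)))
  exact ((analyticAt_const.mul h1).mul h3).mul
    (analyticAt_pinv_mul j.2 h2 (Splits.isInverse_add hi.2 hj.2) (eventually_model_snd _))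

theorem isBanachManifold_arrowAtlas : (arrowAtlas p₀).IsBanachManifold := by
  refine ⟨fun x => ⟨splits_self (orbit_proj (tgt x)), splits_self (orbit_proj (src x))⟩,
    arrowChart_injOn, isOpen_arrowChart_image, ?_, ?_⟩
  · intro (i : orbit p₀ × orbit p₀) (j : orbit p₀ × orbit p₀)
    refine ⟨arrowTrans i j, ?_, fun x hx => arrowTrans_arrowChart hx.1 hx.2⟩
    rintro _ ⟨x, hx, rfl⟩
    exact analyticAt_arrowTrans hx.1 hx.2
  · have hopen : ∀ i : orbit p₀ × orbit p₀, IsOpen (arrowChart i '' arrowSource i) := fun i => by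
      simpa using isOpen_arrowChart_image i i
    refine t2_of_injective hopen (F := Subtype.val) Subtype.val_injective ?_
    intro (i : orbit p₀ × orbit p₀) x hx
    -- The arrow is rebuilt in `M` from its coordinates, its right support being computed from the
    -- last coordinate by the continuous formula for supports.
    refine ⟨fun z : arrowModel i => (i.1.1 + z.1.1) * z.2.1.1 * (i.2.1 * ((i.2.1 + z.2.2.1) *
      Ring.inverse (star (i.2.1 + z.2.2.1) * (i.2.1 + z.2.2.1) + (1 - i.2.1)) *
        star (i.2.1 + z.2.2.1))), ?_, ?_⟩
    · have h1 := (analyticAt_model_fst (arrowChart i x)).continuousAt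
      have h2 := (analyticAt_model_mid (arrowChart i x)).continuousAt
      have h3 := continuousAt_leftSupport (analyticAt_model_snd (arrowChart i x)).continuousAt
        (y := i.2.1 * (src x).1) (p := i.2.1) (q := (src x).1) (by
          change IsInverse (i.2.1 + (baseChart i.2 (src x)).1) _ _ _
          rw [add_baseChart hx.2]
          exact isInverse_sigma hx.2)
      exact (h1.mul h2).mul (continuousAt_const.mul h3)
    · refine Filter.Eventually.of_forall ?_
      rintro _ y hy rfl
      have h1 : i.2.1 + (arrowChart i y).2.2.1 = sigma i.2.1 (src y).1 := add_baseChart hy.2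
      have h2 := arrow_eq hy
      have h3 := (isInverse_sigma (q := src y) hy.2).star_mul_self_isUnit.2
      rw [← h1] at h3
      rw [← h3] at h2
      exact h2

/-! ## The bundle -/

theorem isBanachManifold_bundleAtlas : (bundleAtlas p₀).IsBanachManifold := by
  let c : bundle p₀ → corner 1 p₀ := fun η => ⟨η.1, mem_corner_of_mem_bundle η.2⟩
  have hopen : IsOpen (c '' Set.univ) := by
    rw [isOpen_iff_mem_nhds]
    rintro _ ⟨η, -, rfl⟩
    -- Elements of `M p₀` near `η` retain the right support `p₀` and stay partially invertible, so
    -- they belong to `P₀`.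
    filter_upwards [eventually_exists_isInverse (analyticAt_corner_coe (c η)).continuousAt
      (bundle_isInverse η) (Filter.Eventually.of_forall fun x => x.2.2)]
    rintro x ⟨q, hq⟩
    exact ⟨⟨x.1, hq.mem_bundle⟩, trivial, rfl⟩
  refine ⟨fun _ => trivial, fun _ x _ y _ h =>
    Subtype.ext (congrArg (fun z : corner 1 p₀ => z.1) h), fun _ _ => ?_,
    fun _ _ => ⟨id, fun _ _ => analyticAt_id, fun _ _ => rfl⟩, ?_⟩
  · have h1 : IsOpen (c '' (Set.univ ∩ Set.univ)) := by rwa [Set.inter_univ]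
    exact h1
  · refine t2_of_injective (fun _ => hopen) (F := Subtype.val) Subtype.val_injective ?_
    intro _ η _
    refine ⟨fun x : corner 1 p₀ => x.1, (analyticAt_corner_coe (c η)).continuousAt,
      Filter.Eventually.of_forall ?_⟩
    rintro _ η' - rfl
    rfl

/-! ## The groupoid -/

theorem groupoid_mul_coe {x y : arrows p₀} (h : src x = tgt y) :
    ((groupoid p₀).mul x y).1 = x.1 * y.1 := by
  have h' : rightSupport x.1 = leftSupport y.1 := congrArg Subtype.val h
  have h1 : (groupoid p₀).mul x y = ⟨x.1 * y.1, _⟩ := dif_pos h'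
  rw [h1]

theorem tgt_eq_of_isInverse {x : arrows p₀} {y p : M} {q : orbit p₀}
    (h : IsInverse x.1 y p q.1) : tgt x = q := Subtype.ext h.leftSupport_eq

theorem src_eq_of_isInverse {x : arrows p₀} {y q : M} {p : orbit p₀}
    (h : IsInverse x.1 y p.1 q) : src x = p := Subtype.ext h.rightSupport_eq

theorem isInverse_groupoid_mul {x y : arrows p₀} (h : src x = tgt y) :
    IsInverse ((groupoid p₀).mul x y).1 (pinv y.1 * pinv x.1) (src y).1 (tgt x).1 := by
  rw [groupoid_mul_coe h]
  have h1 := isInverse_arrow x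
  rw [h] at h1
  exact h1.mul (isInverse_arrow y)

theorem isInverse_groupoid_inv (x : arrows p₀) :
    IsInverse ((groupoid p₀).inv x).1 x.1 (tgt x).1 (src x).1 :=
  (isInverse_arrow x).symm

theorem isInverse_groupoid_unit (q : orbit p₀) :
    IsInverse ((groupoid p₀).unit q).1 q.1 q.1 q.1 := IsInverse.of_isStarProjection (orbit_proj q)

theorem tgt_unit (q : orbit p₀) : tgt ((groupoid p₀).unit q) = q :=
  tgt_eq_of_isInverse (isInverse_groupoid_unit q)

theorem src_unit (q : orbit p₀) : src ((groupoid p₀).unit q) = q :=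
  src_eq_of_isInverse (isInverse_groupoid_unit q)

theorem isGroupoid_groupoid : (groupoid p₀).IsGroupoid := by
  have hs : ∀ x y : arrows p₀, src x = tgt y → src ((groupoid p₀).mul x y) = src y :=
    fun x y h => src_eq_of_isInverse (isInverse_groupoid_mul h)
  have ht : ∀ x y : arrows p₀, src x = tgt y → tgt ((groupoid p₀).mul x y) = tgt x :=
    fun x y h => tgt_eq_of_isInverse (isInverse_groupoid_mul h)
  have is : ∀ x : arrows p₀, src ((groupoid p₀).inv x) = tgt x :=
    fun x => src_eq_of_isInverse (isInverse_groupoid_inv x)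
  have it : ∀ x : arrows p₀, tgt ((groupoid p₀).inv x) = src x :=
    fun x => tgt_eq_of_isInverse (isInverse_groupoid_inv x)
  refine ⟨src_unit, tgt_unit, hs, ht, ?_, ?_, ?_, is, it, ?_, ?_⟩
  · intro x y z h1 h2
    refine Subtype.ext ?_
    rw [groupoid_mul_coe ((hs x y h1).trans h2), groupoid_mul_coe h1,
      groupoid_mul_coe (h1.trans (ht y z h2).symm), groupoid_mul_coe h2, mul_assoc]
  · intro x
    refine Subtype.ext ?_
    exact (groupoid_mul_coe (src_unit _)).trans (isInverse_arrow x).qx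
  · intro x
    refine Subtype.ext ?_
    exact (groupoid_mul_coe (tgt_unit _).symm).trans (isInverse_arrow x).xp
  · intro x
    refine Subtype.ext ?_
    rw [groupoid_mul_coe (it x).symm]
    exact (isInverse_arrow x).xy
  · intro x
    refine Subtype.ext ?_
    rw [groupoid_mul_coe (is x)]
    exact (isInverse_arrow x).yx

theorem isTransitive_groupoid : (groupoid p₀).IsTransitive := by
  intro a b
  obtain ⟨x, y, h⟩ := mem_orbit_iff.1 a.2
  obtain ⟨x', y', h'⟩ := mem_orbit_iff.1 b.2
  have h1 := h'.mul h.symm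
  refine ⟨⟨_, h1.mem_arrows a.2 b.2⟩, src_eq_of_isInverse h1, tgt_eq_of_isInverse h1⟩

end PartialInv

namespace PartialInv

variable {M : Type u} [CStarAlgebra M] {p₀ : M} {i j : orbit p₀ × orbit p₀} {x : arrows p₀}

/-! ## The Banach-Lie groupoid -/

theorem baseChart_self (p : orbit p₀) : baseChart p p = 0 := by
  have h := add_baseChart (splits_self (orbit_proj p))
  rw [sigma_self (orbit_proj p), add_eq_left] at h
  exact Subtype.ext h

theorem mem_arrowSource_self (x : arrows p₀) : x ∈ arrowSource (tgt x, src x) :=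
  ⟨splits_self (orbit_proj (tgt x)), splits_self (orbit_proj (src x))⟩

theorem represents_src (hx : x ∈ arrowSource i) :
    Represents (arrowAtlas p₀) (orbitAtlas p₀) (groupoid p₀).src Set.univ x i i.2
      (fun z : arrowModel i => z.2.2) :=
  ⟨hx, hx.2, Set.univ, Filter.univ_mem, fun _ hx' _ => ⟨hx'.1.2, rfl⟩⟩

theorem represents_tgt (hx : x ∈ arrowSource i) :
    Represents (arrowAtlas p₀) (orbitAtlas p₀) (groupoid p₀).tgt Set.univ x i i.1
      (fun z : arrowModel i => z.1) :=
  ⟨hx, hx.1, Set.univ, Filter.univ_mem, fun _ hx' _ => ⟨hx'.1.1, rfl⟩⟩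

/-- The projection to the coordinates of the source. -/
noncomputable def modelSnd (i : orbit p₀ × orbit p₀) :
    arrowModel i →L[ℂ] corner (1 - i.2.1) i.2.1 :=
  (ContinuousLinearMap.snd ℂ _ _).comp (ContinuousLinearMap.snd ℂ _ _)

theorem isSubmersion_src : IsSubmersion (arrowAtlas p₀) (orbitAtlas p₀) (groupoid p₀).src := by
  refine isSubmersion_of_sections isBanachManifold_arrowAtlas fun x => ?_
  have hx := mem_arrowSource_self x
  let i : orbit p₀ × orbit p₀ := (tgt x, src x)
  -- In charts the source is a coordinate projection; freezing the two other coordinates gives the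
  -- section.
  let s : corner (1 - i.2.1) i.2.1 → arrowModel i := fun b =>
    ((arrowChart i x).1, (arrowChart i x).2.1, b)
  have hs : AnalyticAt ℂ s (baseChart i.2 (src x)) :=
    analyticAt_const.prod (analyticAt_const.prod analyticAt_id)
  exact ⟨_, s, represents_src hx, (modelSnd i).analyticAt (arrowChart i x), hs.differentiableAt,
    rfl, Filter.Eventually.of_forall fun _ => rfl⟩

theorem isSubmersion_tgt : IsSubmersion (arrowAtlas p₀) (orbitAtlas p₀) (groupoid p₀).tgt := by
  refine isSubmersion_of_sections isBanachManifold_arrowAtlas fun x => ?_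
  have hx := mem_arrowSource_self x
  let i : orbit p₀ × orbit p₀ := (tgt x, src x)
  let s : corner (1 - i.1.1) i.1.1 → arrowModel i := fun a =>
    (a, (arrowChart i x).2.1, (arrowChart i x).2.2)
  have hs : AnalyticAt ℂ s (baseChart i.1 (tgt x)) :=
    analyticAt_id.prod (analyticAt_const.prod analyticAt_const)
  have hg : AnalyticAt ℂ (fun z : arrowModel i => z.1) (arrowChart i x) := analyticAt_fst
  exact ⟨_, s, represents_tgt hx, hg, hs.differentiableAt, rfl,
    Filter.Eventually.of_forall fun _ => rfl⟩

theorem unit_mem_arrowSource {p q : orbit p₀} (h : Splits p.1 q.1) :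
    (groupoid p₀).unit q ∈ arrowSource (p, p) := by
  refine ⟨?_, ?_⟩
  · rwa [tgt_unit]
  · rwa [src_unit]

/-- With the same index on both sides the middle coordinate is `p q σ_p(q) = p`, independent of `q`.
-/
theorem arrowChart_unit {p q : orbit p₀} (h : Splits p.1 q.1) :
    arrowChart (p, p) ((groupoid p₀).unit q) =
      (baseChart p q, ⟨p.1, orbit_idem p, orbit_idem p⟩, baseChart p q) := by
  refine Prod.ext ?_ (Prod.ext (Subtype.ext ?_) ?_)
  · exact congrArg (baseChart p) (tgt_unit q)
  · refine (middle_coe (unit_mem_arrowSource h)).trans ?_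
    rw [src_unit]
    change p.1 * q.1 * sigma p.1 q.1 = p.1
    rw [mul_assoc, (isInverse_sigma h).qx, mul_sigma h]
  · exact congrArg (baseChart p) (src_unit q)

theorem holomorphic_unit : Holomorphic (orbitAtlas p₀) (arrowAtlas p₀) (groupoid p₀).unit := by
  intro p _
  have hp := splits_self (orbit_proj p)
  let g : corner (1 - p.1) p.1 → arrowModel (p, p) := fun a =>
    (a, ⟨p.1, orbit_idem p, orbit_idem p⟩, a)
  have hg : AnalyticAt ℂ g (baseChart p p) :=
    analyticAt_id.prod (analyticAt_const.prod analyticAt_id)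
  exact ⟨p, (p, p), g, ⟨hp, unit_mem_arrowSource hp, Set.univ, Filter.univ_mem, fun q hq _ =>
    ⟨unit_mem_arrowSource hq.1, (arrowChart_unit hq.1).symm⟩⟩, hg⟩

theorem tgt_inv (x : arrows p₀) : tgt ((groupoid p₀).inv x) = src x :=
  tgt_eq_of_isInverse (isInverse_groupoid_inv x)

theorem src_inv (x : arrows p₀) : src ((groupoid p₀).inv x) = tgt x :=
  src_eq_of_isInverse (isInverse_groupoid_inv x)

theorem inv_mem_arrowSource (hx : x ∈ arrowSource i) :
    (groupoid p₀).inv x ∈ arrowSource (i.2, i.1) := by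
  refine ⟨?_, ?_⟩
  · rw [tgt_inv]; exact hx.2
  · rw [src_inv]; exact hx.1

theorem arrowChart_inv (hx : x ∈ arrowSource i) :
    arrowChart (i.2, i.1) ((groupoid p₀).inv x) = ((arrowChart i x).2.2,
      toCorner (orbit_idem i.2) (orbit_idem i.1) (pinv (arrowChart i x).2.1.1),
      (arrowChart i x).1) := by
  refine Prod.ext ?_ (Prod.ext (Subtype.ext ?_) ?_)
  · exact congrArg (baseChart i.2) (tgt_inv x)
  · refine (middle_coe (inv_mem_arrowSource hx)).trans ?_
    have h := isInverse_middle hx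
    change i.2.1 * pinv x.1 * sigma i.1.1 (src ((groupoid p₀).inv x)).1 =
      (toCorner _ _ (pinv (middle i.1 i.2 x).1) : corner i.2.1 i.1.1).1
    rw [toCorner_coe, h.pinv_eq, h.py, h.yq, src_inv]
  · exact congrArg (baseChart i.1) (src_inv x)

theorem holomorphic_inv : Holomorphic (arrowAtlas p₀) (arrowAtlas p₀) (groupoid p₀).inv := by
  intro x _
  let i : orbit p₀ × orbit p₀ := (tgt x, src x)
  have hx : x ∈ arrowSource i := mem_arrowSource_self x
  let g : arrowModel i → arrowModel (i.2, i.1) := fun z =>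
    (z.2.2, toCorner (orbit_idem i.2) (orbit_idem i.1) (pinv z.2.1.1), z.1)
  have hg : AnalyticAt ℂ g (arrowChart i x) :=
    ((modelSnd i).analyticAt _).prod ((analyticAt_toCorner _ _
      (analyticAt_pinv (analyticAt_model_mid _) (isInverse_middle hx)
        (eventually_model_mid _))).prod analyticAt_fst)
  exact ⟨i, (i.2, i.1), g, ⟨hx, inv_mem_arrowSource hx, Set.univ, Filter.univ_mem, fun y hy _ =>
    ⟨inv_mem_arrowSource hy.1, (arrowChart_inv hy.1).symm⟩⟩, hg⟩

theorem tgt_mul {x y : arrows p₀} (h : src x = tgt y) : tgt ((groupoid p₀).mul x y) = tgt x :=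
  tgt_eq_of_isInverse (isInverse_groupoid_mul h)

theorem src_mul {x y : arrows p₀} (h : src x = tgt y) : src ((groupoid p₀).mul x y) = src y :=
  src_eq_of_isInverse (isInverse_groupoid_mul h)

theorem mul_mem_arrowSource {y : arrows p₀} {k : orbit p₀} (h : src x = tgt y)
    (hx : x ∈ arrowSource i) (hy : y ∈ arrowSource (i.2, k)) :
    (groupoid p₀).mul x y ∈ arrowSource (i.1, k) := by
  refine ⟨?_, ?_⟩
  · rw [tgt_mul h]; exact hx.1
  · rw [src_mul h]; exact hy.2

/-- The source chart of `x` and the target chart of `y` share an index, so `σ` and `σ⁻¹` cancel at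
the common object and the middle coordinates multiply. -/
theorem arrowChart_mul {y : arrows p₀} {k : orbit p₀} (h : src x = tgt y)
    (hx : x ∈ arrowSource i) (hy : y ∈ arrowSource (i.2, k)) :
    arrowChart (i.1, k) ((groupoid p₀).mul x y) = ((arrowChart i x).1,
      toCorner (orbit_idem i.1) (orbit_idem k)
        ((arrowChart i x).2.1.1 * (arrowChart (i.2, k) y).2.1.1),
      (arrowChart (i.2, k) y).2.2) := by
  refine Prod.ext ?_ (Prod.ext (Subtype.ext ?_) ?_)
  · exact congrArg (baseChart i.1) (tgt_mul h)
  · refine (middle_coe (mul_mem_arrowSource h hx hy)).trans ?_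
    change i.1.1 * ((groupoid p₀).mul x y).1 * sigma k.1 (src ((groupoid p₀).mul x y)).1 =
      (toCorner _ _ ((middle i.1 i.2 x).1 * (middle i.2 k y).1) : corner i.1.1 k.1).1
    rw [toCorner_coe, ← mul_assoc, (middle i.1 i.2 x).2.1, mul_assoc _ _ k.1,
      (middle i.2 k y).2.2, middle_coe hx, middle_coe (i := (i.2, k)) hy, src_mul h,
      groupoid_mul_coe h]
    have h1 := isInverse_sigma hx.2
    rw [h] at h1 ⊢
    have h2 : sigma i.2.1 (tgt y).1 * (i.2.1 * y.1) = y.1 := by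
      rw [← (isInverse_arrow y).qx, ← mul_assoc i.2.1, ← mul_assoc, h1.xy, (isInverse_arrow y).qx]
    conv_lhs => rw [← h2]
    simp only [mul_assoc]
  · exact congrArg (baseChart k) (src_mul h)

theorem holomorphicOn_mul : HolomorphicOn (prodAtlas (arrowAtlas p₀) (arrowAtlas p₀))
    (arrowAtlas p₀) (fun x => (groupoid p₀).mul x.1 x.2)
    {x | (groupoid p₀).src x.1 = (groupoid p₀).tgt x.2} := by
  rintro ⟨x, y⟩ (h : src x = tgt y)
  let i : orbit p₀ × orbit p₀ := (tgt x, src x)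
  have hx : x ∈ arrowSource i := mem_arrowSource_self x
  have hy : y ∈ arrowSource (i.2, src y) := by
    change y ∈ arrowSource (src x, src y)
    rw [h]
    exact mem_arrowSource_self y
  -- The formula ignores the source coordinate of `x` and the target coordinate of `y`, and so
  -- extends the product analytically beyond the composable pairs.
  let g : arrowModel i × arrowModel (i.2, src y) → arrowModel (i.1, src y) := fun z =>
    (z.1.1, toCorner (orbit_idem i.1) (orbit_idem (src y)) (z.1.2.1.1 * z.2.2.1.1), z.2.2.2)
  have hg : AnalyticAt ℂ g (arrowChart i x, arrowChart (i.2, src y) y) := by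
    have h1 : AnalyticAt ℂ (fun z : arrowModel i × arrowModel (i.2, src y) => z.1.2.1.1)
        (arrowChart i x, arrowChart (i.2, src y) y) :=
      AnalyticAt.comp (f := fun z : arrowModel i × arrowModel (i.2, src y) => z.1)
        (analyticAt_model_mid _) analyticAt_fst
    have h2 : AnalyticAt ℂ (fun z : arrowModel i × arrowModel (i.2, src y) => z.2.2.1.1)
        (arrowChart i x, arrowChart (i.2, src y) y) :=
      AnalyticAt.comp (f := fun z : arrowModel i × arrowModel (i.2, src y) => z.2)
        (analyticAt_model_mid _) analyticAt_snd
    exact (analyticAt_fst.comp analyticAt_fst).prod ((analyticAt_toCorner _ _ (h1.mul h2)).prod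
      (((modelSnd (i.2, src y)).analyticAt _).comp analyticAt_snd))
  exact ⟨(i, (i.2, src y)), (i.1, src y), g, ⟨⟨hx, hy⟩, mul_mem_arrowSource h hx hy, Set.univ,
    Filter.univ_mem, fun z hz _ => ⟨mul_mem_arrowSource hz.2 hz.1.1 hz.1.2,
      (arrowChart_mul hz.2 hz.1.1 hz.1.2).symm⟩⟩, hg⟩

theorem isBanachLieGroupoid_groupoid :
    (groupoid p₀).IsBanachLieGroupoid (orbitAtlas p₀) (arrowAtlas p₀) :=
  ⟨isGroupoid_groupoid, isBanachManifold_orbitAtlas, isBanachManifold_arrowAtlas,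
    isSubmersion_src, isSubmersion_tgt, holomorphic_unit, holomorphic_inv, holomorphicOn_mul⟩

/-! ## The projections of the bundle -/

/-- The inclusion of the bundle in `M p₀`. -/
def bundlePt (η : bundle p₀) : corner 1 p₀ := ⟨η.1, mem_corner_of_mem_bundle η.2⟩

theorem isInverse_bundle (η : bundle p₀) : IsInverse η.1 (pinv η.1) p₀ (bundleProj η).1 :=
  bundle_isInverse η

/-- The arrow `η ξ⁻¹`. -/
noncomputable def pairArrow (η ξ : bundle p₀) : arrows p₀ :=
  ⟨η.1 * pinv ξ.1, ((isInverse_bundle η).mul (isInverse_bundle ξ).symm).mem_arrows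
    (bundleProj ξ).2 (bundleProj η).2⟩

theorem isInverse_pairArrow (η ξ : bundle p₀) :
    IsInverse (pairArrow η ξ).1 (ξ.1 * pinv η.1) (bundleProj ξ).1 (bundleProj η).1 :=
  (isInverse_bundle η).mul (isInverse_bundle ξ).symm

theorem tgt_pairArrow (η ξ : bundle p₀) : tgt (pairArrow η ξ) = bundleProj η :=
  tgt_eq_of_isInverse (isInverse_pairArrow η ξ)

theorem src_pairArrow (η ξ : bundle p₀) : src (pairArrow η ξ) = bundleProj ξ :=
  src_eq_of_isInverse (isInverse_pairArrow η ξ)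

theorem pairArrow_self (η : bundle p₀) :
    pairArrow η η = (groupoid p₀).unit (bundleProj η) := Subtype.ext (isInverse_bundle η).xy

/-- The arrow `x y⁻¹` in the chart indexed by `i`. -/
noncomputable def pairChart (i : orbit p₀ × orbit p₀) (x y : M) : arrowModel i :=
  (slope i.1 x, toCorner (orbit_idem i.1) (orbit_idem i.2) (i.1.1 * x * pinv (i.2.1 * y)),
    slope i.2 y)

theorem isInverse_mul_bundle {p : orbit p₀} {η : bundle p₀} (h : Splits p.1 (bundleProj η).1) :
    IsInverse (p.1 * η.1) (pinv (p.1 * η.1)) p₀ p.1 :=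
  h.isInverse_mul (orbit_proj p) (isInverse_bundle η)

theorem pairArrow_mem_arrowSource {η ξ : bundle p₀} (h : Splits i.1.1 (bundleProj η).1)
    (h' : Splits i.2.1 (bundleProj ξ).1) : pairArrow η ξ ∈ arrowSource i := by
  refine ⟨?_, ?_⟩
  · rwa [tgt_pairArrow]
  · rwa [src_pairArrow]

theorem arrowChart_pairArrow {η ξ : bundle p₀} (h : Splits i.1.1 (bundleProj η).1)
    (h' : Splits i.2.1 (bundleProj ξ).1) :
    arrowChart i (pairArrow η ξ) = pairChart i η.1 ξ.1 := by
  refine Prod.ext ?_ (Prod.ext (Subtype.ext ?_) ?_)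
  · change baseChart i.1 (tgt _) = slope i.1 η.1
    rw [tgt_pairArrow, baseChart_eq_slope h (isInverse_bundle η)]
  · refine (middle_coe (pairArrow_mem_arrowSource h h')).trans ?_
    change i.1.1 * (η.1 * pinv ξ.1) * sigma i.2.1 (src (pairArrow η ξ)).1 =
      (toCorner _ _ (i.1.1 * η.1 * pinv (i.2.1 * ξ.1)) : corner i.1.1 i.2.1).1
    have h1 := isInverse_mul_bundle h'
    rw [src_pairArrow, h'.sigma_eq (orbit_proj i.2) (isInverse_bundle ξ), toCorner_coe]
    calc i.1.1 * (η.1 * pinv ξ.1) * (ξ.1 * pinv (i.2.1 * ξ.1))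
        = i.1.1 * η.1 * (pinv ξ.1 * ξ.1 * pinv (i.2.1 * ξ.1)) := by simp only [mul_assoc]
      _ = i.1.1 * i.1.1 * η.1 * (pinv (i.2.1 * ξ.1) * i.2.1) := by
        rw [(isInverse_bundle ξ).yx, h1.py, h1.yq, (orbit_idem i.1).eq]
      _ = _ := by simp only [mul_assoc]
  · change baseChart i.2 (src _) = slope i.2 ξ.1
    rw [src_pairArrow, baseChart_eq_slope h' (isInverse_bundle ξ)]

theorem eventually_bundle_mul (x : corner 1 p₀) : ∀ᶠ x : corner 1 p₀ in 𝓝 x, x.1 * p₀ = x.1 :=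
  Filter.Eventually.of_forall fun x => x.2.2

/-- The chart of `P₀` covers only an open part of `M p₀`; the quantifier over `η'` expresses a
property of the nearby points of `M p₀` that come from `P₀`. -/
theorem eventually_splits {p : orbit p₀} {η : bundle p₀} (h : Splits p.1 (bundleProj η).1) :
    ∀ᶠ x in 𝓝 (bundlePt η), ∀ η' : bundle p₀, bundlePt η' = x → Splits p.1 (bundleProj η').1 := by
  filter_upwards [eventually_isInverse_mul p (analyticAt_corner_coe (bundlePt η)).continuousAt
    (isInverse_mul_bundle h) (eventually_bundle_mul _)]
  rintro _ hx η' rfl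
  exact (isInverse_bundle η').splits hx

theorem analyticAt_slope_bundle {p : orbit p₀} {η : bundle p₀}
    (h : Splits p.1 (bundleProj η).1) :
    AnalyticAt ℂ (fun x : corner 1 p₀ => slope p x.1) (bundlePt η) :=
  analyticAt_slope p (analyticAt_corner_coe _) (isInverse_mul_bundle h) (eventually_bundle_mul _)

theorem represents_bundleProj {p : orbit p₀} {η : bundle p₀} (h : Splits p.1 (bundleProj η).1) :
    Represents (bundleAtlas p₀) (orbitAtlas p₀) bundleProj Set.univ η PUnit.unit p
      (fun x : corner 1 p₀ => slope p x.1) :=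
  ⟨trivial, h, _, eventually_splits h, fun η' _ hη' =>
    ⟨hη' η' rfl, (baseChart_eq_slope (hη' η' rfl) (isInverse_bundle η')).symm⟩⟩

/-- The projection to `M p₀`. -/
noncomputable def toBundle (η : bundle p₀) : M →L[ℂ] corner 1 p₀ :=
  toCorner IsIdempotentElem.one (isInverse_bundle η).hp.isIdempotentElem

theorem toBundle_coe {η : bundle p₀} {x : M} (h : x * p₀ = x) : (toBundle η x).1 = x := by
  rw [toBundle, toCorner_coe, one_mul, h]

theorem toBundle_mul_coe (η : bundle p₀) (x : M) : (toBundle η (x * η.1)).1 = x * η.1 :=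
  toBundle_coe (by rw [mul_assoc, bundle_mul])

/-- The map `a ↦ (p + a) x` is a section of the slope. The local sections of the bundle projections
below come from this formula. -/
theorem slope_add_mul {p : orbit p₀} (a : corner (1 - p.1) p.1) {x y r : M}
    (hx : IsInverse x y r p.1) : slope p ((p.1 + a.1) * x) = a := by
  rw [slope, ← mul_assoc, mul_add_corner (orbit_idem p), hx.qx, mul_assoc,
    hx.pinv.xy, add_corner_mul (orbit_idem p)]
  refine Subtype.ext ?_
  rw [toCorner_coe, mul_add (1 - p.1), sub_mul 1 p.1 p.1, one_mul, (orbit_idem p).eq, sub_self,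
    zero_add, a.2.1, a.2.2]

theorem isSubmersion_bundleProj :
    IsSubmersion (bundleAtlas p₀) (orbitAtlas p₀) bundleProj := by
  refine isSubmersion_of_sections isBanachManifold_bundleAtlas fun η => ?_
  have h := splits_self (orbit_proj (bundleProj η))
  set p : orbit p₀ := bundleProj η with hp
  -- The point `η` is moved along the projections near `p` by `σ_p(q) = p + a`.
  let s : corner (1 - p.1) p.1 → corner 1 p₀ := fun a => toBundle η ((p.1 + a.1) * η.1)
  have hη : p.1 * η.1 = η.1 := (isInverse_bundle η).qx
  have hs : AnalyticAt ℂ s (baseChart p p) :=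
    ((toBundle η).analyticAt _).comp ((analyticAt_add_corner _).mul analyticAt_const)
  have hs0 : s (baseChart p p) = bundlePt η := by
    refine Subtype.ext ?_
    rw [baseChart_self, toBundle_mul_coe]
    simp only [ZeroMemClass.coe_zero, add_zero]
    exact hη
  have hgs : ∀ a, slope p (s a).1 = a := by
    intro a
    rw [toBundle_mul_coe]
    exact slope_add_mul a (isInverse_bundle η)
  exact ⟨_, s, represents_bundleProj h, analyticAt_slope_bundle h, hs.differentiableAt, hs0,
    Filter.Eventually.of_forall hgs⟩

theorem analyticAt_pairChart {η ξ : bundle p₀} (h : Splits i.1.1 (bundleProj η).1)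
    (h' : Splits i.2.1 (bundleProj ξ).1) :
    AnalyticAt ℂ (fun z : corner 1 p₀ × corner 1 p₀ => pairChart i z.1.1 z.2.1)
      (bundlePt η, bundlePt ξ) := by
  have hx : AnalyticAt ℂ (fun z : corner 1 p₀ × corner 1 p₀ => z.1.1) (bundlePt η, bundlePt ξ) :=
    (analyticAt_corner_coe (bundlePt η)).comp (f := Prod.fst) analyticAt_fst
  have hy : AnalyticAt ℂ (fun z : corner 1 p₀ × corner 1 p₀ => z.2.1) (bundlePt η, bundlePt ξ) :=
    (analyticAt_corner_coe (bundlePt ξ)).comp (f := Prod.snd) analyticAt_snd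
  have hx' := Filter.Eventually.of_forall (f := 𝓝 (bundlePt η, bundlePt ξ))
    fun z : corner 1 p₀ × corner 1 p₀ => z.1.2.2
  have hy' := Filter.Eventually.of_forall (f := 𝓝 (bundlePt η, bundlePt ξ))
    fun z : corner 1 p₀ × corner 1 p₀ => z.2.2.2
  exact (analyticAt_slope i.1 hx (isInverse_mul_bundle h) hx').prod
    ((analyticAt_toCorner _ _ ((analyticAt_const.mul hx).mul
      (analyticAt_pinv_mul i.2 hy (isInverse_mul_bundle h') hy'))).prod
      (analyticAt_slope i.2 hy (isInverse_mul_bundle h') hy'))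

theorem represents_pairArrow {η ξ : bundle p₀} (h : Splits i.1.1 (bundleProj η).1)
    (h' : Splits i.2.1 (bundleProj ξ).1) :
    Represents (prodAtlas (bundleAtlas p₀) (bundleAtlas p₀)) (arrowAtlas p₀)
      (fun z => pairArrow z.1 z.2) Set.univ (η, ξ) (PUnit.unit, PUnit.unit) i
      (fun z : corner 1 p₀ × corner 1 p₀ => pairChart i z.1.1 z.2.1) := by
  refine ⟨⟨trivial, trivial⟩, pairArrow_mem_arrowSource h h', _,
    prod_mem_nhds (eventually_splits h) (eventually_splits h'), fun z _ hz => ?_⟩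
  have h1 := hz.1 z.1 rfl
  have h2 := hz.2 z.2 rfl
  exact ⟨pairArrow_mem_arrowSource h1 h2, (arrowChart_pairArrow h1 h2).symm⟩

/-- Local sections of the map `(x, y) ↦ x y⁻¹`. -/
theorem exists_section_pairChart (η ξ : bundle p₀) {i : orbit p₀ × orbit p₀}
    (e1 : i.1 = bundleProj η) (e2 : i.2 = bundleProj ξ) :
    ∃ s : arrowModel i → corner 1 p₀ × corner 1 p₀,
      AnalyticAt ℂ s (arrowChart i (pairArrow η ξ)) ∧
      s (arrowChart i (pairArrow η ξ)) = (bundlePt η, bundlePt ξ) ∧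
      ∀ᶠ z in 𝓝 (arrowChart i (pairArrow η ξ)), pairChart i (s z).1.1 (s z).2.1 = z := by
  have h : Splits i.1.1 (bundleProj η).1 := e1 ▸ splits_self (orbit_proj i.1)
  have h' : Splits i.2.1 (bundleProj ξ).1 := e2 ▸ splits_self (orbit_proj i.2)
  have hη := isInverse_bundle η
  have hξ := isInverse_bundle ξ
  rw [← e1] at hη
  rw [← e2] at hξ
  -- The second component `(p + b) ξ` lifts the source. The first is the arrow `(p' + a) m (p +
  -- b)⁻¹` applied to it, that is `(p' + a) m ξ`, so their quotient is the given arrow.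
  let s : arrowModel i → corner 1 p₀ × corner 1 p₀ := fun z =>
    (toBundle ξ ((i.1.1 + z.1.1) * z.2.1.1 * ξ.1), toBundle ξ ((i.2.1 + z.2.2.1) * ξ.1))
  have hs : AnalyticAt ℂ s (arrowChart i (pairArrow η ξ)) :=
    (((toBundle ξ).analyticAt _).comp
      (((analyticAt_model_fst _).mul (analyticAt_model_mid _)).mul analyticAt_const)).prod
      (((toBundle ξ).analyticAt _).comp ((analyticAt_model_snd _).mul analyticAt_const))
  have hc : arrowChart i (pairArrow η ξ) = pairChart i η.1 ξ.1 := arrowChart_pairArrow h h'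
  have hslope : ∀ (p : orbit p₀) (η : bundle p₀), p = bundleProj η → slope p η.1 = 0 := by
    rintro p η rfl
    rw [← baseChart_eq_slope (splits_self (orbit_proj _)) (isInverse_bundle η), baseChart_self]
  have hs0 : s (arrowChart i (pairArrow η ξ)) = (bundlePt η, bundlePt ξ) := by
    have z1 : (slope i.1 η.1 : M) = 0 := by rw [hslope i.1 η e1]; rfl
    have z2 : (slope i.2 ξ.1 : M) = 0 := by rw [hslope i.2 ξ e2]; rfl
    have z3 : i.1.1 * (i.1.1 * (i.1.1 * η.1 * pinv (i.2.1 * ξ.1)) * i.2.1) * ξ.1 = η.1 := by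
      rw [hη.qx, hξ.qx, ← mul_assoc i.1.1 η.1, hη.qx, ← mul_assoc i.1.1, ← mul_assoc i.1.1, hη.qx,
        mul_assoc, hξ.qx, mul_assoc, hξ.yx, hη.xp]
    rw [hc]
    refine Prod.ext (Subtype.ext ?_) (Subtype.ext ?_)
    · change (toBundle ξ ((i.1.1 + (slope i.1 η.1 : M)) * (toCorner _ _ _ : corner _ _).1 * ξ.1)).1
        = η.1
      rw [toBundle_mul_coe, z1, toCorner_coe, add_zero, z3]
    · change (toBundle ξ ((i.2.1 + (slope i.2 ξ.1 : M)) * ξ.1)).1 = ξ.1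
      rw [toBundle_mul_coe, z2, add_zero, hξ.qx]
  have hgs : ∀ᶠ z in 𝓝 (arrowChart i (pairArrow η ξ)),
      pairChart i (s z).1.1 (s z).2.1 = z := by
    filter_upwards [eventually_isInverse (analyticAt_model_mid
      (arrowChart i (pairArrow η ξ))).continuousAt
      (isInverse_middle (pairArrow_mem_arrowSource h h')) (eventually_model_mid _)] with z hz
    have e3 : (s z).1.1 = (i.1.1 + z.1.1) * (z.2.1.1 * ξ.1) := by
      rw [toBundle_mul_coe, mul_assoc]
    have e4 : (s z).2.1 = (i.2.1 + z.2.2.1) * ξ.1 := toBundle_mul_coe _ _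
    rw [e3, e4]
    refine Prod.ext (slope_add_mul z.1 (hz.mul hξ)) (Prod.ext (Subtype.ext ?_)
      (slope_add_mul z.2.2 hξ))
    change (toCorner _ _ (i.1.1 * ((i.1.1 + z.1.1) * (z.2.1.1 * ξ.1)) *
      pinv (i.2.1 * ((i.2.1 + z.2.2.1) * ξ.1))) : corner _ _).1 = _
    rw [toCorner_coe, ← mul_assoc i.1.1 (i.1.1 + _), mul_add_corner (orbit_idem i.1),
      ← mul_assoc i.2.1, mul_add_corner (orbit_idem i.2), hξ.qx, ← mul_assoc i.1.1 z.2.1.1,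
      z.2.1.2.1, mul_assoc z.2.1.1, hξ.xy, z.2.1.2.2, z.2.1.2.1, z.2.1.2.2]
  exact ⟨s, hs, hs0, hgs⟩

theorem splits_tgt_pairArrow (η ξ : bundle p₀) :
    Splits (tgt (pairArrow η ξ)).1 (bundleProj η).1 := by
  rw [tgt_pairArrow]
  exact splits_self (orbit_proj _)

theorem splits_src_pairArrow (η ξ : bundle p₀) :
    Splits (src (pairArrow η ξ)).1 (bundleProj ξ).1 := by
  rw [src_pairArrow]
  exact splits_self (orbit_proj _)

theorem isSubmersion_pairArrow :
    IsSubmersion (prodAtlas (bundleAtlas p₀) (bundleAtlas p₀)) (arrowAtlas p₀)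
      (fun z => pairArrow z.1 z.2) := by
  refine isSubmersion_of_sections (isBanachManifold_bundleAtlas.prodAtlas
    isBanachManifold_bundleAtlas) ?_
  rintro ⟨η, ξ⟩
  let i : orbit p₀ × orbit p₀ := (tgt (pairArrow η ξ), src (pairArrow η ξ))
  have h : Splits i.1.1 (bundleProj η).1 := splits_tgt_pairArrow η ξ
  have h' : Splits i.2.1 (bundleProj ξ).1 := splits_src_pairArrow η ξ
  obtain ⟨s, hs, hs0, hgs⟩ := exists_section_pairChart (i := i) η ξ (tgt_pairArrow η ξ)
    (src_pairArrow η ξ)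
  exact ⟨_, s, represents_pairArrow h h', analyticAt_pairChart h h', hs.differentiableAt, hs0, hgs⟩

/-! ## The gauge groupoid -/

theorem IsInverse.mem_unitGroup {g h : M} (hg : IsInverse g h p₀ p₀) : g ∈ unitGroup p₀ :=
  ⟨⟨hg.qx, hg.xp⟩, h, ⟨hg.py, hg.yq⟩, hg.xy, hg.yx⟩

theorem bundle_mul_unitGroup (η : bundle p₀) {g : M} (hg : g ∈ unitGroup p₀) :
    ∃ h, IsInverse g h p₀ p₀ ∧ IsInverse (η.1 * g) (h * pinv η.1) p₀ (bundleProj η).1 := by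
  obtain ⟨h1, h, h2, h3, h4⟩ := hg
  have hp := (isInverse_bundle η).hp
  have hi : IsInverse g h p₀ p₀ := ⟨hp, hp, h4, h3, h1.2, h2.1⟩
  exact ⟨h, hi, (isInverse_bundle η).mul hi⟩

/-- The bijection of `P₀ / G₀` with the orbit. -/
noncomputable def baseMap (p₀ : M) : Quotient (bundleSetoid p₀) → orbit p₀ :=
  Quotient.lift bundleProj (by
    rintro η η' ⟨g, hg, h⟩
    obtain ⟨k, -, hk⟩ := bundle_mul_unitGroup η hg
    rw [← h] at hk
    exact Subtype.ext (hk.leftSupport_eq.symm.trans rfl))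

/-- The group acts transitively on the fibres of the left support, by `g = η⁻¹ η'`. -/
theorem exists_mul_of_bundleProj_eq {η η' : bundle p₀} (h : bundleProj η = bundleProj η') :
    pinv η.1 * η'.1 ∈ unitGroup p₀ ∧ η'.1 = η.1 * (pinv η.1 * η'.1) := by
  have h1 := isInverse_bundle η
  have h2 := isInverse_bundle η'
  rw [← h] at h2
  exact ⟨(h1.symm.mul h2).mem_unitGroup, by rw [← mul_assoc, h1.xy, h2.qx]⟩

theorem bundleProj_surjective : Function.Surjective (bundleProj (p₀ := p₀)) := by
  intro q
  obtain ⟨x, y, h⟩ := mem_orbit_iff.1 q.2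
  exact ⟨⟨x, h.mem_bundle⟩, Subtype.ext h.leftSupport_eq⟩

theorem bijective_baseMap : Function.Bijective (baseMap p₀) := by
  refine ⟨?_, fun q => ?_⟩
  · intro a b
    refine Quotient.inductionOn₂ a b fun η η' h => ?_
    obtain ⟨h1, h2⟩ := exists_mul_of_bundleProj_eq (η := η) (η' := η') h
    exact Quotient.sound ⟨_, h1, h2⟩
  · obtain ⟨η, rfl⟩ := bundleProj_surjective q
    exact ⟨cls η, rfl⟩

/-- The bijection of `(P₀ × P₀) / G₀` with the set of arrows. -/
noncomputable def arrowMap (p₀ : M) : Quotient (pairSetoid p₀) → arrows p₀ :=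
  Quotient.lift (fun z => pairArrow z.1 z.2) (by
    rintro ⟨η, ξ⟩ ⟨η', ξ'⟩ ⟨g, hg, h, h'⟩
    obtain ⟨k, hk, -⟩ := bundle_mul_unitGroup η hg
    have h1 : pinv ξ'.1 = k * pinv ξ.1 := by
      rw [h']
      exact ((isInverse_bundle ξ).mul hk).pinv_eq
    refine Subtype.ext ?_
    change η.1 * pinv ξ.1 = η'.1 * pinv ξ'.1
    dsimp only at h
    rw [h, h1, mul_assoc, ← mul_assoc g, hk.xy, (isInverse_bundle ξ).py])

theorem bijective_arrowMap : Function.Bijective (arrowMap p₀) := by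
  refine ⟨?_, fun x => ?_⟩
  · intro a b
    refine Quotient.inductionOn₂ a b ?_
    rintro ⟨η, ξ⟩ ⟨η', ξ'⟩ (h : pairArrow η ξ = pairArrow η' ξ')
    have h1 : bundleProj ξ = bundleProj ξ' := by rw [← src_pairArrow η ξ, h, src_pairArrow]
    obtain ⟨h2, h3⟩ := exists_mul_of_bundleProj_eq h1
    refine Quotient.sound ⟨_, h2, ?_, h3⟩
    have h4 : η.1 * pinv ξ.1 = η'.1 * pinv ξ'.1 := congrArg Subtype.val h
    change η'.1 = η.1 * (pinv ξ.1 * ξ'.1)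
    rw [← mul_assoc, h4, mul_assoc, (isInverse_bundle ξ').yx, bundle_mul]
  · obtain ⟨ξ, hξ⟩ := bundleProj_surjective (src x)
    have h1 := isInverse_bundle ξ
    rw [hξ] at h1
    refine ⟨pairCls ⟨x.1 * ξ.1, ((isInverse_arrow x).mul h1).mem_bundle⟩ ξ, Subtype.ext ?_⟩
    change x.1 * ξ.1 * pinv ξ.1 = x.1
    rw [mul_assoc, h1.xy, (isInverse_arrow x).xp]

/-- Composable classes have representatives sharing their middle element: the second pair is
adjusted by the group element joining the two middle entries. -/
theorem exists_mul_gaugeGroupoid (a b : Quotient (pairSetoid p₀))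
    (h : (gaugeGroupoid p₀).src a = (gaugeGroupoid p₀).tgt b) :
    ∃ η ξ κ : bundle p₀, a = pairCls η ξ ∧ b = pairCls ξ κ ∧
      (gaugeGroupoid p₀).mul a b = pairCls η κ := by
  revert h
  refine Quotient.inductionOn₂ a b ?_
  rintro ⟨η, ξ⟩ ⟨lam, κ⟩ (h : cls ξ = cls lam)
  obtain ⟨g, hg, hξ⟩ := Quotient.exact h.symm
  obtain ⟨k, -, hk⟩ := bundle_mul_unitGroup κ hg
  refine ⟨η, ξ, ⟨κ.1 * g, hk.mem_bundle⟩, rfl, Quotient.sound ⟨g, hg, hξ, rfl⟩, ?_⟩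
  exact gaugeGroupoid_mul η ξ lam κ _ hg hξ rfl

section Quotients

variable {𝒬₀ : BanachAtlas (Quotient (bundleSetoid p₀))}
  {𝒬₁ : BanachAtlas (Quotient (pairSetoid p₀))}

theorem isIso_arrowMap (h₀ : IsQuotientManifold (bundleAtlas p₀) (bundleSetoid p₀) 𝒬₀)
    (h₁ : IsQuotientManifold (prodAtlas (bundleAtlas p₀) (bundleAtlas p₀)) (pairSetoid p₀) 𝒬₁) :
    GroupoidMaps.IsIso (gaugeGroupoid p₀) 𝒬₀ 𝒬₁ (groupoid p₀) (orbitAtlas p₀) (arrowAtlas p₀)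
      (arrowMap p₀) (baseMap p₀) := by
  refine ⟨h₁.biholomorphic (isBanachManifold_bundleAtlas.prodAtlas isBanachManifold_bundleAtlas)
      isBanachManifold_arrowAtlas isSubmersion_pairArrow bijective_arrowMap fun _ => rfl,
    h₀.biholomorphic isBanachManifold_bundleAtlas isBanachManifold_orbitAtlas
      isSubmersion_bundleProj bijective_baseMap fun _ => rfl, ?_, ?_, ?_, ?_, ?_⟩
  · exact fun a => Quotient.inductionOn a fun z => src_pairArrow z.1 z.2
  · exact fun a => Quotient.inductionOn a fun z => tgt_pairArrow z.1 z.2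
  · exact fun a => Quotient.inductionOn a fun η => pairArrow_self η
  · refine fun a => Quotient.inductionOn a fun z => Subtype.ext ?_
    exact (isInverse_pairArrow z.1 z.2).pinv_eq.symm
  · intro a b h
    obtain ⟨η, ξ, κ, rfl, rfl, hm⟩ := exists_mul_gaugeGroupoid a b h
    rw [hm]
    refine Subtype.ext ?_
    have h1 : src (pairArrow η ξ) = tgt (pairArrow ξ κ) := by rw [src_pairArrow, tgt_pairArrow]
    refine Eq.trans ?_ (groupoid_mul_coe h1).symm
    change η.1 * pinv κ.1 = η.1 * pinv ξ.1 * (ξ.1 * pinv κ.1)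
    rw [mul_assoc, ← mul_assoc _ ξ.1, (isInverse_bundle ξ).yx, (isInverse_bundle κ).py]

theorem isBanachLieGroupoid_gaugeGroupoid
    (h₀ : IsQuotientManifold (bundleAtlas p₀) (bundleSetoid p₀) 𝒬₀)
    (h₁ : IsQuotientManifold (prodAtlas (bundleAtlas p₀) (bundleAtlas p₀)) (pairSetoid p₀) 𝒬₁) :
    (gaugeGroupoid p₀).IsBanachLieGroupoid 𝒬₀ 𝒬₁ := by
  refine (isIso_arrowMap h₀ h₁).isBanachLieGroupoid h₀.1 h₁.1 isBanachLieGroupoid_groupoid ?_ ?_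
  · intro a b h
    obtain ⟨η, ξ, κ, rfl, rfl, hm⟩ := exists_mul_gaugeGroupoid a b h
    rw [hm]
    rfl
  · intro a b h
    obtain ⟨η, ξ, κ, rfl, rfl, hm⟩ := exists_mul_gaugeGroupoid a b h
    rw [hm]
    rfl

end Quotients

end PartialInv

namespace PartialInv

variable {M : Type u} [CStarAlgebra M] {p₀ : M}

/-! ## The bundle of left ideals `M q` -/

/-- The pairs `(q, A)` of a point `q` of the orbit and an element `A` of `M q`. -/
def idealBundle (p₀ : M) : Type u := {t : orbit p₀ × M // t.2 * t.1.1 = t.2}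

/-- The pair `(q, A q)`. -/
def idealPt (q : orbit p₀) (A : M) : idealBundle p₀ :=
  ⟨(q, A * q.1), by rw [mul_assoc, (orbit_idem q).eq]⟩

/-- The fibre coordinate `A σ_p(q)`. -/
noncomputable def idealCoord (p q : orbit p₀) (A : M) : corner 1 p.1 :=
  toCorner IsIdempotentElem.one (orbit_idem p) (A * sigma p.1 q.1)

theorem idealCoord_coe {p q : orbit p₀} (h : Splits p.1 q.1) (A : M) :
    (idealCoord p q A : M) = A * sigma p.1 q.1 := by
  rw [idealCoord, toCorner_coe, one_mul, mul_assoc, (isInverse_sigma h).xp]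

theorem mul_eq_idealCoord_mul {p q : orbit p₀} (h : Splits p.1 q.1) (A : M) :
    A * q.1 = (idealCoord p q A).1 * (p.1 * q.1) := by
  rw [idealCoord_coe h, mul_assoc, (isInverse_sigma h).xy]

theorem idealCoord_mul {p q : orbit p₀} (h : Splits p.1 q.1) (A : M) :
    idealCoord p q (A * q.1) = idealCoord p q A := by
  refine Subtype.ext ?_
  rw [idealCoord_coe h, idealCoord_coe h, mul_assoc, (isInverse_sigma h).qx]

theorem idealCoord_change {p p' q : orbit p₀} (h : Splits p.1 q.1) (h' : Splits p'.1 q.1) (A : M) :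
    idealCoord p' q A = toCorner IsIdempotentElem.one (orbit_idem p')
      ((idealCoord p q A).1 * pinv (p'.1 * (p.1 + (baseChart p q).1))) := by
  rw [idealCoord_coe h, add_baseChart h, mul_assoc,
    ← h'.sigma_eq (orbit_proj p') (isInverse_sigma h)]
  rfl

/-- The atlas of the bundle of the left ideals `M q`. -/
noncomputable def idealAtlas (p₀ : M) : BanachAtlas (idealBundle p₀) where
  ι := orbit p₀
  E p := corner (1 - p.1) p.1 × corner 1 p.1
  source p := {t | Splits p.1 t.1.1.1}
  chart p t := (baseChart p t.1.1, idealCoord p t.1.1 t.1.2)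
  chartAt t := t.1.1

/-- The chart indexed by `p`. -/
noncomputable def idealChart (p : orbit p₀) (t : idealBundle p₀) :
    corner (1 - p.1) p.1 × corner 1 p.1 :=
  (baseChart p t.1.1, idealCoord p t.1.1 t.1.2)

theorem idealChart_image (p : orbit p₀) (S : Set (orbit p₀)) (hS : ∀ q ∈ S, Splits p.1 q.1) :
    idealChart p '' {t | t.1.1 ∈ S} = (baseChart p '' S) ×ˢ Set.univ := by
  apply Set.Subset.antisymm
  · rintro _ ⟨t, ht, rfl⟩
    exact ⟨⟨t.1.1, ht, rfl⟩, trivial⟩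
  · rintro ⟨_, B⟩ ⟨⟨q, hq, rfl⟩, -⟩
    have h := hS q hq
    -- The element of `M q` with coordinate `B` is `B σ_p(q)⁻¹ = B p q`.
    refine ⟨idealPt q (B.1 * (p.1 * q.1)), hq, Prod.ext rfl (Subtype.ext ?_)⟩
    change (idealCoord p q (B.1 * (p.1 * q.1) * q.1)).1 = B.1
    rw [idealCoord_mul h, idealCoord_coe h, mul_assoc, (isInverse_sigma h).yx, B.2.2]

theorem idealChart_injOn (p : orbit p₀) :
    Set.InjOn (idealChart p) {t | Splits p.1 t.1.1.1} := by
  rintro ⟨⟨q, A⟩, hA⟩ (hq : Splits p.1 q.1) ⟨⟨q', A'⟩, hA'⟩ hq' h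
  obtain rfl : q = q' := baseChart_injOn p hq hq' (congrArg Prod.fst h)
  have h1 : idealCoord p q A = idealCoord p q A' := congrArg Prod.snd h
  refine Subtype.ext (Prod.ext rfl ?_)
  dsimp only at hA hA' ⊢
  rw [← hA, ← hA', mul_eq_idealCoord_mul hq, h1, ← mul_eq_idealCoord_mul hq]

theorem isBanachManifold_idealAtlas : (idealAtlas p₀).IsBanachManifold := by
  have hopen : ∀ p p' : orbit p₀,
      IsOpen (idealChart p '' {t | t.1.1 ∈ {q : orbit p₀ | Splits p.1 q.1 ∧ Splits p'.1 q.1}}) := by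
    intro p p'
    rw [idealChart_image p _ fun q hq => hq.1]
    exact (isOpen_baseChart_image p p').prod isOpen_univ
  refine ⟨fun t => splits_self (orbit_proj t.1.1), idealChart_injOn, hopen, ?_, ?_⟩
  · intro (p : orbit p₀) (p' : orbit p₀)
    refine ⟨fun z : corner (1 - p.1) p.1 × corner 1 p.1 => (slope p' (p.1 + z.1.1),
      toCorner IsIdempotentElem.one (orbit_idem p') (z.2.1 * pinv (p'.1 * (p.1 + z.1.1)))), ?_, ?_⟩
    · rintro _ ⟨t, ht, rfl⟩
      have hF : AnalyticAt ℂ (fun z : corner (1 - p.1) p.1 × corner 1 p.1 => p.1 + z.1.1)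
        (idealChart p t) := (analyticAt_add_corner _).comp analyticAt_fst
      have hB : AnalyticAt ℂ (fun z : corner (1 - p.1) p.1 × corner 1 p.1 => z.2.1)
        (idealChart p t) := (analyticAt_corner_coe _).comp analyticAt_snd
      have hz := Splits.isInverse_add (q := t.1.1) ht.1 ht.2
      have hm : ∀ᶠ z : corner (1 - p.1) p.1 × corner 1 p.1 in 𝓝 (idealChart p t),
          (p.1 + z.1.1) * p.1 = p.1 + z.1.1 :=
        Filter.Eventually.of_forall fun z => add_corner_mul (orbit_idem p) z.1
      have h1 := (analyticAt_slope p' hF hz hm).prod (analyticAt_toCorner IsIdempotentElem.one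
        (orbit_idem p') (hB.mul (analyticAt_pinv_mul p' hF hz hm)))
      exact h1
    · rintro t ht
      have h1 : baseChart p' t.1.1 = slope p' (p.1 + (baseChart p t.1.1).1) := by
        rw [add_baseChart ht.1]
        exact baseChart_eq_slope ht.2 (isInverse_sigma ht.1)
      exact Prod.ext h1.symm (idealCoord_change ht.1 ht.2 t.1.2).symm
  · have hopen' : ∀ p : orbit p₀, IsOpen (idealChart p '' {t | Splits p.1 t.1.1.1}) := fun p => by
      simpa using hopen p p
    -- The bundle is separated by its map to `M × M`: `Q` computes `q` from the base coordinate and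
    -- `B p q` returns the fibre element.
    refine t2_of_injective hopen' (F := fun t => ((t.1.1 : M), t.1.2)) ?_ ?_
    · intro t t' h
      obtain ⟨h1, h2⟩ := Prod.ext_iff.1 h
      exact Subtype.ext (Prod.ext (Subtype.ext h1) h2)
    · intro (p : orbit p₀) t ht
      let Q : corner (1 - p.1) p.1 × corner 1 p.1 → M := fun z => (p.1 + z.1.1) *
        Ring.inverse (star (p.1 + z.1.1) * (p.1 + z.1.1) + (1 - p.1)) * star (p.1 + z.1.1)
      have hQ : ∀ t : idealBundle p₀, Splits p.1 t.1.1.1 → Q (idealChart p t) = t.1.1.1 := by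
        intro t ht
        change (p.1 + (baseChart p t.1.1).1) * Ring.inverse
          (star (p.1 + (baseChart p t.1.1).1) * (p.1 + (baseChart p t.1.1).1) + (1 - p.1)) *
            star (p.1 + (baseChart p t.1.1).1) = _
        rw [add_baseChart ht, (isInverse_sigma ht).star_mul_self_isUnit.2]
      have hc : ContinuousAt Q (idealChart p t) := by
        have h1 := continuousAt_leftSupport (y := p.1 * t.1.1.1) (p := p.1) (q := t.1.1.1)
          (F := fun z : corner (1 - p.1) p.1 × corner 1 p.1 => p.1 + z.1.1) (e := idealChart p t)
          (by fun_prop) (by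
            change IsInverse (p.1 + (baseChart p t.1.1).1) _ _ _
            rw [add_baseChart ht]
            exact isInverse_sigma ht)
        exact h1
      have hB : ContinuousAt (fun z : corner (1 - p.1) p.1 × corner 1 p.1 => z.2.1)
        (idealChart p t) := by fun_prop
      refine ⟨fun z => (Q z, z.2.1 * (p.1 * Q z)), hc.prodMk (hB.mul (continuousAt_const.mul hc)),
        Filter.Eventually.of_forall ?_⟩
      rintro _ t' ht' rfl
      refine Prod.ext (hQ t' ht').symm ?_
      change t'.1.2 = (idealCoord p t'.1.1 t'.1.2).1 * (p.1 * Q (idealChart p t'))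
      rw [hQ t' ht', ← mul_eq_idealCoord_mul ht', t'.2]

/-! ## The quotient of the tangent bundle -/

/-- The map `(ϑ, η) ↦ ϑ η⁻¹`. -/
noncomputable def tangentProj (t : (bundleAtlas p₀).TangentTotal) : idealBundle p₀ :=
  ⟨(bundleProj t.1, (show corner 1 p₀ from t.2).1 * pinv t.1.1), by
    rw [mul_assoc, (isInverse_bundle t.1).yq]⟩

theorem tangentCoord_bundleAtlas (η : bundle p₀) (v : (bundleAtlas p₀).TangentAt η) :
    (bundleAtlas p₀).tangentCoord PUnit.unit η v = v :=
  isBanachManifold_bundleAtlas.tangentCoord_chartAt η v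

theorem idealCoord_pinv {p : orbit p₀} {η : bundle p₀} (h : Splits p.1 (bundleProj η).1)
    (v : corner 1 p₀) : idealCoord p (bundleProj η) (v.1 * pinv η.1) =
      toCorner IsIdempotentElem.one (orbit_idem p) (v.1 * pinv (p.1 * η.1)) := by
  have h1 := isInverse_bundle η
  rw [idealCoord, h.sigma_eq (orbit_proj p) h1, mul_assoc, ← mul_assoc _ η.1, h1.yx,
    (isInverse_mul_bundle h).py]

theorem isSubmersion_tangentProj :
    IsSubmersion (bundleAtlas p₀).tangentAtlas (idealAtlas p₀) tangentProj := by
  refine isSubmersion_of_sections isBanachManifold_bundleAtlas.tangentAtlas ?_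
  rintro ⟨η, (v : corner 1 p₀)⟩
  have h := splits_self (orbit_proj (bundleProj η))
  set q : orbit p₀ := bundleProj η with hq
  have hη := isInverse_bundle η
  rw [← hq] at hη
  let g : corner 1 p₀ × corner 1 p₀ → corner (1 - q.1) q.1 × corner 1 q.1 := fun z =>
    (slope q z.1.1, toCorner IsIdempotentElem.one (orbit_idem q) (z.2.1 * pinv (q.1 * z.1.1)))
  -- The base point is lifted to `(q + a) η`. Since the fibre coordinate is `B = A (q + a)`, the
  -- vector `A (q + a) η` is `B η`.
  let s : corner (1 - q.1) q.1 × corner 1 q.1 → corner 1 p₀ × corner 1 p₀ := fun z =>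
    (toBundle η ((q.1 + z.1.1) * η.1), toBundle η (z.2.1 * η.1))
  have hr : Represents (bundleAtlas p₀).tangentAtlas (idealAtlas p₀) tangentProj Set.univ
      ⟨η, v⟩ PUnit.unit q g := by
    have e : (bundleAtlas p₀).tangentAtlas.chart PUnit.unit ⟨η, v⟩ = (bundlePt η, v) :=
      Prod.ext rfl (tangentCoord_bundleAtlas η v)
    refine ⟨trivial, h, Prod.fst ⁻¹' {x | ∀ η' : bundle p₀, bundlePt η' = x →
      Splits q.1 (bundleProj η').1}, ?_, ?_⟩
    · have h1 := continuousAt_fst.preimage_mem_nhds (x := (bundlePt η, v)) (eventually_splits h)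
      rw [e]
      exact h1
    · rintro ⟨η', (v' : corner 1 p₀)⟩ - hN
      have h1 : Splits q.1 (bundleProj η').1 := hN η' rfl
      refine ⟨h1, ?_⟩
      have e' : (bundleAtlas p₀).tangentAtlas.chart PUnit.unit ⟨η', v'⟩ = (bundlePt η', v') :=
        Prod.ext rfl (tangentCoord_bundleAtlas η' v')
      rw [e']
      exact Prod.ext (baseChart_eq_slope h1 (isInverse_bundle η')).symm (idealCoord_pinv h1 v').symm
  have hg : AnalyticAt ℂ g (bundlePt η, v) := by
    have hx : AnalyticAt ℂ (fun z : corner 1 p₀ × corner 1 p₀ => z.1.1) (bundlePt η, v) :=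
      (analyticAt_corner_coe _).comp analyticAt_fst
    have hv : AnalyticAt ℂ (fun z : corner 1 p₀ × corner 1 p₀ => z.2.1) (bundlePt η, v) :=
      (analyticAt_corner_coe _).comp analyticAt_snd
    have hm := Filter.Eventually.of_forall (f := 𝓝 (bundlePt η, v))
      fun z : corner 1 p₀ × corner 1 p₀ => z.1.2.2
    exact (analyticAt_slope q hx (isInverse_mul_bundle h) hm).prod (analyticAt_toCorner _ _
      (hv.mul (analyticAt_pinv_mul q hx (isInverse_mul_bundle h) hm)))
  have hs : ∀ z, AnalyticAt ℂ s z := fun z =>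
    (((toBundle η).analyticAt _).comp (((analyticAt_add_corner _).comp analyticAt_fst).mul
      analyticAt_const)).prod (((toBundle η).analyticAt _).comp
        (((analyticAt_corner_coe _).comp analyticAt_snd).mul analyticAt_const))
  have hs0 : s (baseChart q q, idealCoord q q (v.1 * pinv η.1)) = (bundlePt η, v) := by
    have z1 : (baseChart q q).1 = 0 := by rw [baseChart_self]; rfl
    refine Prod.ext (Subtype.ext ?_) (Subtype.ext ?_)
    · change (toBundle η ((q.1 + (baseChart q q).1) * η.1)).1 = η.1
      rw [toBundle_mul_coe, z1, add_zero, hη.qx]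
    · change (toBundle η ((idealCoord q q (v.1 * pinv η.1)).1 * η.1)).1 = v.1
      rw [toBundle_mul_coe, idealCoord_coe h, sigma_self (orbit_proj q), mul_assoc, hη.qx,
        mul_assoc, hη.yx, v.2.2]
  have hgs : ∀ z, g (s z) = z := by
    intro z
    refine Prod.ext ?_ (Subtype.ext ?_)
    · change slope q (toBundle η ((q.1 + z.1.1) * η.1)).1 = z.1
      rw [toBundle_mul_coe]
      exact slope_add_mul z.1 hη
    · change (toCorner _ _ ((toBundle η (z.2.1 * η.1)).1 *
        pinv (q.1 * (toBundle η ((q.1 + z.1.1) * η.1)).1)) : corner _ _).1 = z.2.1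
      rw [toBundle_mul_coe, toBundle_mul_coe, toCorner_coe, one_mul, ← mul_assoc q.1,
        mul_add_corner (orbit_idem q), hη.qx, mul_assoc z.2.1, hη.pinv.xy, z.2.2.2, z.2.2.2]
  have e : (bundleAtlas p₀).tangentAtlas.chart PUnit.unit ⟨η, v⟩ = (bundlePt η, v) :=
    Prod.ext rfl (tangentCoord_bundleAtlas η v)
  refine ⟨g, s, hr, ?_, (hs _).differentiableAt, hs0.trans e.symm,
    Filter.Eventually.of_forall hgs⟩
  have h2 := e ▸ hg
  exact h2

/-- The bijection of `T P₀ / G₀` with the bundle of left ideals. -/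
noncomputable def tangentBij (p₀ : M) : Quotient (tangentSetoid p₀) → idealBundle p₀ :=
  Quotient.lift tangentProj (by
    rintro ⟨η, v⟩ ⟨η', v'⟩ ⟨g, hg, h, h'⟩
    obtain ⟨k, hk, hk'⟩ := bundle_mul_unitGroup η hg
    dsimp only at h h'
    rw [← h] at hk'
    refine Subtype.ext (Prod.ext (Subtype.ext (hk'.leftSupport_eq.symm.trans rfl)) ?_)
    change (show corner 1 p₀ from v).1 * pinv η.1 = (show corner 1 p₀ from v').1 * pinv η'.1
    rw [h', hk'.pinv_eq, mul_assoc, ← mul_assoc g, hk.xy, (isInverse_bundle η).py])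

/-- The element `ϑ η⁻¹` of `M q` is a complete invariant of a class over `q`, because two base
points over `q` differ by exactly one group element. -/
theorem bijective_tangentBij : Function.Bijective (tangentBij p₀) := by
  refine ⟨?_, ?_⟩
  · intro a b
    refine Quotient.inductionOn₂ a b ?_
    rintro ⟨η, (v : corner 1 p₀)⟩ ⟨η', (v' : corner 1 p₀)⟩ h
    have h0 : bundleProj η = bundleProj η' := congrArg (fun t : idealBundle p₀ => t.1.1) h
    have h1 : v.1 * pinv η.1 = v'.1 * pinv η'.1 := congrArg (fun t : idealBundle p₀ => t.1.2) h
    obtain ⟨h2, h3⟩ := exists_mul_of_bundleProj_eq h0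
    refine Quotient.sound ⟨_, h2, h3, ?_⟩
    change v'.1 = v.1 * (pinv η.1 * η'.1)
    rw [← mul_assoc, h1, mul_assoc, (isInverse_bundle η').yx, v'.2.2]
  · rintro ⟨⟨q, A⟩, hA⟩
    obtain ⟨η, rfl⟩ := bundleProj_surjective q
    refine ⟨tangentCls η (toBundle η (A * η.1)), Subtype.ext (Prod.ext rfl ?_)⟩
    change (toBundle η (A * η.1)).1 * pinv η.1 = A
    rw [toBundle_mul_coe, mul_assoc, (isInverse_bundle η).xy, hA]

end PartialInv

namespace PartialInv

variable {M : Type u} [CStarAlgebra M] {p₀ : M} {i : orbit p₀ × orbit p₀}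

/-! ## The tangent maps of `ζ ↦ ζ ξ⁻¹` -/

/-- The derivative of `x ↦ pairChart i x y` in the direction `v`. -/
noncomputable def pairDeriv (i : orbit p₀ × orbit p₀) (x y v : M) : arrowModel i :=
  (toCorner (orbit_idem' i.1) (orbit_idem i.1)
    (v * pinv (i.1.1 * x) - x * (pinv (i.1.1 * x) * (i.1.1 * v) * pinv (i.1.1 * x))),
    toCorner (orbit_idem i.1) (orbit_idem i.2) (i.1.1 * v * pinv (i.2.1 * y)), 0)

/-- With `y` fixed the source coordinate is constant, and the slope is differentiated by the rule
for inverses. -/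
theorem hasFDerivAt_pairChart {η : bundle p₀} (h : Splits i.1.1 (bundleProj η).1) (y : M) :
    ∃ L : corner 1 p₀ →L[ℂ] arrowModel i,
      HasFDerivAt (fun x : corner 1 p₀ => pairChart i x.1 y) L (bundlePt η) ∧
      ∀ v, L v = pairDeriv i η.1 y v.1 := by
  have h1 : HasFDerivAt (fun x : corner 1 p₀ => x.1) (corner 1 p₀).subtypeL (bundlePt η) :=
    (corner 1 p₀).subtypeL.hasFDerivAt
  have h2 : HasFDerivAt (fun x : corner 1 p₀ => i.1.1 * x.1) (i.1.1 • (corner 1 p₀).subtypeL)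
    (bundlePt η) := h1.const_mul i.1.1
  obtain ⟨L, hL, hLv⟩ := hasFDerivAt_pinv h2 (isInverse_mul_bundle h)
    (Filter.Eventually.of_forall fun x => ⟨by rw [← mul_assoc, (orbit_idem i.1).eq],
      by rw [mul_assoc, x.2.2]⟩)
  have h3 := (toCorner (orbit_idem' i.1) (orbit_idem i.1)).hasFDerivAt.comp (bundlePt η)
    (h1.mul' hL)
  have h4 := (toCorner (orbit_idem i.1) (orbit_idem i.2)).hasFDerivAt.comp (bundlePt η)
    (h2.mul_const' (pinv (i.2.1 * y)))
  refine ⟨_, h3.prodMk (h4.prodMk (hasFDerivAt_const (slope i.2 y) _)), fun v => ?_⟩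
  refine Prod.ext (Subtype.ext ?_) (Prod.ext (Subtype.ext ?_) rfl)
  · change (toCorner (orbit_idem' i.1) (orbit_idem i.1)
      (η.1 * L v + v.1 * pinv (i.1.1 * η.1)) : M) = (toCorner (orbit_idem' i.1) (orbit_idem i.1)
      (v.1 * pinv (i.1.1 * η.1) - η.1 * (pinv (i.1.1 * η.1) * (i.1.1 * v.1) *
        pinv (i.1.1 * η.1))) : M)
    rw [hLv]
    congr 2
    rw [mul_neg, neg_add_eq_sub]
    rfl
  · rfl

theorem represents_pairArrow_left {η ξ : bundle p₀} (h : Splits i.1.1 (bundleProj η).1)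
    (h' : Splits i.2.1 (bundleProj ξ).1) :
    Represents (bundleAtlas p₀) (arrowAtlas p₀) (fun ζ => pairArrow ζ ξ) Set.univ η PUnit.unit i
      (fun x : corner 1 p₀ => pairChart i x.1 ξ.1) :=
  ⟨trivial, pairArrow_mem_arrowSource h h', _, eventually_splits h, fun η' _ hη' =>
    ⟨pairArrow_mem_arrowSource (hη' η' rfl) h', (arrowChart_pairArrow (hη' η' rfl) h').symm⟩⟩

theorem analyticAt_pairChart_left {η : bundle p₀} (h : Splits i.1.1 (bundleProj η).1) (y : M) :
    AnalyticAt ℂ (fun x : corner 1 p₀ => pairChart i x.1 y) (bundlePt η) :=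
  (analyticAt_slope_bundle h).prod ((analyticAt_toCorner _ _
    ((analyticAt_const.mul (analyticAt_corner_coe _)).mul analyticAt_const)).prod analyticAt_const)

theorem holomorphic_pairArrow_left (ξ : bundle p₀) :
    Holomorphic (bundleAtlas p₀) (arrowAtlas p₀) (fun ζ => pairArrow ζ ξ) := fun η _ =>
  ⟨PUnit.unit, (tgt (pairArrow η ξ), src (pairArrow η ξ)), _,
    represents_pairArrow_left (splits_tgt_pairArrow η ξ) (splits_src_pairArrow η ξ),
    analyticAt_pairChart_left (i := (tgt (pairArrow η ξ), src (pairArrow η ξ)))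
      (splits_tgt_pairArrow η ξ) ξ.1⟩

/-- The vector at the arrow `x`, tangent to the source fibre, whose right translate to the unit at
the target of `x` is given by `A`. -/
noncomputable def arrowVec (x : arrows p₀) (A : M) : arrowModel (tgt x, src x) :=
  (toCorner (orbit_idem' _) (orbit_idem _) A, toCorner (orbit_idem _) (orbit_idem _) (A * x.1), 0)

/-- The image depends only on the arrow and on `v η⁻¹`; this makes the map on classes well defined.
-/
theorem tangentMap_pairArrow (η ξ : bundle p₀) (v : corner 1 p₀) :
    tangentMap (bundleAtlas p₀) (arrowAtlas p₀) (fun ζ => pairArrow ζ ξ) η v =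
      arrowVec (pairArrow η ξ) (v.1 * pinv η.1) := by
  let i : orbit p₀ × orbit p₀ := (tgt (pairArrow η ξ), src (pairArrow η ξ))
  obtain ⟨L, hL, hLv⟩ := hasFDerivAt_pairChart (i := i) (splits_tgt_pairArrow η ξ) ξ.1
  have h1 := Represents.tangentMap_eq isBanachManifold_bundleAtlas
    (represents_pairArrow_left (i := i) (splits_tgt_pairArrow η ξ) (splits_src_pairArrow η ξ))
  have h2 : tangentMap (bundleAtlas p₀) (arrowAtlas p₀) (fun ζ => pairArrow ζ ξ) η v =
    pairDeriv i η.1 ξ.1 v.1 := (congrArg (fun L => L v) (h1.trans hL.fderiv)).trans (hLv v)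
  have e1 : i.1.1 * η.1 = η.1 := by
    change (tgt (pairArrow η ξ)).1 * η.1 = _
    rw [tgt_pairArrow, (isInverse_bundle η).qx]
  have e2 : i.2.1 * ξ.1 = ξ.1 := by
    change (src (pairArrow η ξ)).1 * ξ.1 = _
    rw [src_pairArrow, (isInverse_bundle ξ).qx]
  -- In the preferred chart this kills the term of the derivative of the slope that comes from
  -- differentiating the inverse.
  have e3 : (1 - i.1.1) * η.1 = 0 := by rw [sub_mul, one_mul, e1, sub_self]
  refine h2.trans (Prod.ext (Subtype.ext ?_) (Prod.ext (Subtype.ext ?_) rfl))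
  · change (toCorner (orbit_idem' i.1) (orbit_idem i.1) (v.1 * pinv (i.1.1 * η.1) -
      η.1 * (pinv (i.1.1 * η.1) * (i.1.1 * v.1) * pinv (i.1.1 * η.1))) : M) =
      (toCorner (orbit_idem' i.1) (orbit_idem i.1) (v.1 * pinv η.1) : M)
    rw [toCorner_coe, toCorner_coe, e1, mul_sub (1 - i.1.1), ← mul_assoc (1 - i.1.1) η.1, e3,
      zero_mul, sub_zero]
  · change (toCorner (orbit_idem i.1) (orbit_idem i.2) (i.1.1 * v.1 * pinv (i.2.1 * ξ.1)) : M) =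
      (toCorner (orbit_idem i.1) (orbit_idem i.2) (v.1 * pinv η.1 * (η.1 * pinv ξ.1)) : M)
    rw [toCorner_coe, toCorner_coe, e2, mul_assoc v.1, ← mul_assoc _ η.1, (isInverse_bundle η).yx,
      (isInverse_bundle ξ).py]
    simp only [← mul_assoc, (orbit_idem i.1).eq]

theorem tangentCoord_tangentMap_pairArrow {η ξ : bundle p₀} (h : Splits i.1.1 (bundleProj η).1)
    (h' : Splits i.2.1 (bundleProj ξ).1) (v : corner 1 p₀) :
    (arrowAtlas p₀).tangentCoord i (pairArrow η ξ)
      (tangentMap (bundleAtlas p₀) (arrowAtlas p₀) (fun ζ => pairArrow ζ ξ) η v) =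
      pairDeriv i η.1 ξ.1 v.1 := by
  obtain ⟨L, hL, hLv⟩ := hasFDerivAt_pairChart h ξ.1
  have h1 : @Filter.EventuallyEq (corner 1 p₀) (arrowModel i) (𝓝 (bundlePt η))
      (localExpr (bundleAtlas p₀) (arrowAtlas p₀) (fun ζ => pairArrow ζ ξ) PUnit.unit i)
      (fun x => pairChart i x.1 ξ.1) :=
    (represents_pairArrow_left h h').eventuallyEq_localExpr isBanachManifold_bundleAtlas
  have h2 := Holomorphic.tangentCoord_tangentMap isBanachManifold_bundleAtlas
    isBanachManifold_arrowAtlas (holomorphic_pairArrow_left ξ) (x := η) (i := PUnit.unit) (j := i)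
    trivial (pairArrow_mem_arrowSource h h') v
  have h3 := congrArg (fun L : corner 1 p₀ →L[ℂ] arrowModel i => L v)
    ((h1.fderiv_eq (𝕜 := ℂ)).trans hL.fderiv)
  exact h2.trans ((congrArg _ (tangentCoord_bundleAtlas η v)).trans (h3.trans (hLv v)))

/-- The vector given by `A` at `η ξ⁻¹` is the image of `A η` under the tangent map of `ζ ↦ ζ ξ⁻¹`.
The chain rule then gives its coordinates in every chart without differentiating the transition maps
of the arrows. -/
theorem tangentCoord_arrowVec {η ξ : bundle p₀} (h : Splits i.1.1 (bundleProj η).1)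
    (h' : Splits i.2.1 (bundleProj ξ).1) {x : arrows p₀} (hx : x = pairArrow η ξ) {A : M}
    (hA : A * (bundleProj η).1 = A) :
    (arrowAtlas p₀).tangentCoord i x (arrowVec x A) = pairDeriv i η.1 ξ.1 (A * η.1) := by
  subst hx
  have h1 := tangentCoord_tangentMap_pairArrow h h' (toBundle η (A * η.1))
  rw [tangentMap_pairArrow, toBundle_mul_coe, mul_assoc, (isInverse_bundle η).xy, hA] at h1
  exact h1

/-- In terms of `B = A σ_p(q)` and the base coordinate `a`, the vector has the coordinates `B - (p +
a) p B` and `p B`: polynomial expressions from which `B` can be recovered. -/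
theorem tangentCoord_arrowVec_unit {p q : orbit p₀} (h : Splits p.1 q.1) {A : M}
    (hA : A * q.1 = A) :
    (arrowAtlas p₀).tangentCoord (p, p) ((groupoid p₀).unit q)
      (arrowVec ((groupoid p₀).unit q) A) =
      (toCorner (orbit_idem' p) (orbit_idem p)
        ((idealCoord p q A).1 - (p.1 + (baseChart p q).1) * (p.1 * (idealCoord p q A).1)),
        toCorner (orbit_idem p) (orbit_idem p) (p.1 * (idealCoord p q A).1), 0) := by
  obtain ⟨η, rfl⟩ := bundleProj_surjective q
  have h1 := tangentCoord_arrowVec (i := (p, p)) h h (pairArrow_self η).symm hA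
  refine h1.trans ?_
  rw [pairDeriv, idealCoord_coe h, add_baseChart h,
    h.sigma_eq (orbit_proj p) (isInverse_bundle η)]
  simp only [mul_assoc]
  rfl

/-! ## The isomorphism of the algebroids -/

/-- The vector tangent to the source fibre at the unit at `q` defined by an element of `M q`. -/
noncomputable def idealVec (t : idealBundle p₀) : (arrowAtlas p₀).TangentTotal :=
  ⟨(groupoid p₀).unit t.1.1, arrowVec ((groupoid p₀).unit t.1.1) t.1.2⟩

/-- The element of `M q` defined by a vector at the unit at `q`. -/
noncomputable def vecIdeal (t : (arrowAtlas p₀).TangentTotal) : idealBundle p₀ :=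
  idealPt (tgt t.1) ((show arrowModel (tgt t.1, src t.1) from t.2).1.1 +
    (show arrowModel (tgt t.1, src t.1) from t.2).2.1.1)

/-- The equality of `tgt (unit q)` with `q` is not definitional, so vectors at units are compared
through their components in `M`. -/
theorem arrowVec_unit_coe (q : orbit p₀) (A : M) :
    ((arrowVec ((groupoid p₀).unit q) A).1 : M) = (1 - q.1) * A * q.1 ∧
      ((arrowVec ((groupoid p₀).unit q) A).2.1 : M) = q.1 * A * q.1 := by
  refine ⟨?_, ?_⟩
  · refine (toCorner_coe _ _ _).trans ?_
    rw [tgt_unit]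
  · refine (toCorner_coe _ _ _).trans ?_
    rw [tgt_unit, src_unit]
    change q.1 * (A * q.1) * q.1 = _
    rw [mul_assoc, mul_assoc A, (orbit_idem q).eq, mul_assoc]

theorem vecIdeal_idealVec (t : idealBundle p₀) : vecIdeal (idealVec t) = t := by
  obtain ⟨⟨q, A⟩, hA⟩ := t
  dsimp only at hA
  refine Subtype.ext (Prod.ext (tgt_unit q) ?_)
  change ((arrowVec ((groupoid p₀).unit q) A).1.1 +
    (arrowVec ((groupoid p₀).unit q) A).2.1.1) * (tgt ((groupoid p₀).unit q)).1 = A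
  rw [(arrowVec_unit_coe q A).1, (arrowVec_unit_coe q A).2, tgt_unit, mul_assoc (1 - q.1), hA,
    mul_assoc q.1, hA, ← add_mul, sub_add_cancel, one_mul, hA]

theorem tangentMap_src (x : arrows p₀) (v : arrowModel (tgt x, src x)) :
    tangentMap (arrowAtlas p₀) (orbitAtlas p₀) (groupoid p₀).src x v = v.2.2 := by
  have h1 := Represents.tangentMap_eq isBanachManifold_arrowAtlas
    (represents_src (mem_arrowSource_self x))
  have h2 := (modelSnd (tgt x, src x)).fderiv (x := arrowChart (tgt x, src x) x)
  exact congrArg (fun L => L v) (h1.trans h2)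

theorem idealVec_mem_algebroid (t : idealBundle p₀) :
    idealVec t ∈ (groupoid p₀).algebroid (orbitAtlas p₀) (arrowAtlas p₀) :=
  ⟨⟨t.1.1, rfl⟩, tangentMap_src _ _⟩

theorem idealVec_vecIdeal {t : (arrowAtlas p₀).TangentTotal}
    (ht : t ∈ (groupoid p₀).algebroid (orbitAtlas p₀) (arrowAtlas p₀)) :
    idealVec (vecIdeal t) = t := by
  obtain ⟨x, v⟩ := t
  obtain ⟨⟨q, hq⟩, hv⟩ := ht
  obtain rfl : (groupoid p₀).unit q = x := hq
  change arrowModel (tgt ((groupoid p₀).unit q), src ((groupoid p₀).unit q)) at v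
  have hv' : v.2.2 = 0 := (tangentMap_src _ v).symm.trans hv
  have e : vecIdeal ⟨(groupoid p₀).unit q, v⟩ = idealPt q (v.1.1 + v.2.1.1) := by
    exact Subtype.ext (Prod.ext (tgt_unit q)
      (congrArg (fun r : orbit p₀ => (v.1.1 + v.2.1.1) * r.1) (tgt_unit q)))
  rw [e]
  have ha : ∀ a ∈ corner (1 - (tgt ((groupoid p₀).unit q)).1) (tgt ((groupoid p₀).unit q)).1,
      (1 - q.1) * a = a ∧ a * q.1 = a := by
    rw [tgt_unit]
    exact fun _ h => h
  have hb : ∀ a ∈ corner (tgt ((groupoid p₀).unit q)).1 (src ((groupoid p₀).unit q)).1,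
      q.1 * a = a ∧ a * q.1 = a := by
    rw [tgt_unit, src_unit]
    exact fun _ h => h
  obtain ⟨a1, a2⟩ := ha _ v.1.2
  obtain ⟨b1, b2⟩ := hb _ v.2.1.2
  have a3 : q.1 * v.1.1 = 0 := by rwa [sub_mul, one_mul, sub_eq_self] at a1
  refine congrArg (Sigma.mk ((groupoid p₀).unit q)) ?_
  refine Prod.ext (Subtype.ext ?_) (Prod.ext (Subtype.ext ?_) hv'.symm)
  · refine ((arrowVec_unit_coe q _).1).trans ?_
    change (1 - q.1) * ((v.1.1 + v.2.1.1) * q.1) * q.1 = v.1.1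
    rw [mul_assoc, mul_assoc _ q.1 q.1, (orbit_idem q).eq, add_mul, a2, b2, mul_add, a1,
      sub_mul, one_mul, b1, sub_self, add_zero]
  · refine ((arrowVec_unit_coe q _).2).trans ?_
    change q.1 * ((v.1.1 + v.2.1.1) * q.1) * q.1 = v.2.1.1
    rw [mul_assoc, mul_assoc _ q.1 q.1, (orbit_idem q).eq, add_mul, a2, b2, mul_add, a3, b1,
      zero_add]

theorem holomorphic_idealVec :
    Holomorphic (idealAtlas p₀) (arrowAtlas p₀).tangentAtlas idealVec := by
  intro t _
  set p : orbit p₀ := t.1.1 with hp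
  let g : corner (1 - p.1) p.1 × corner 1 p.1 → arrowModel (p, p) × arrowModel (p, p) := fun z =>
    ((z.1, ⟨p.1, orbit_idem p, orbit_idem p⟩, z.1),
      (toCorner (orbit_idem' p) (orbit_idem p) (z.2.1 - (p.1 + z.1.1) * (p.1 * z.2.1)),
        toCorner (orbit_idem p) (orbit_idem p) (p.1 * z.2.1), 0))
  have h0 := splits_self (orbit_proj p)
  have hg : AnalyticAt ℂ g (idealChart p t) := by
    have hS : AnalyticAt ℂ (fun z : corner (1 - p.1) p.1 × corner 1 p.1 => p.1 + z.1.1)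
      (idealChart p t) := (analyticAt_add_corner _).comp analyticAt_fst
    have hB : AnalyticAt ℂ (fun z : corner (1 - p.1) p.1 × corner 1 p.1 => z.2.1)
      (idealChart p t) := (analyticAt_corner_coe _).comp analyticAt_snd
    have hpB := (analyticAt_const (v := p.1)).mul hB
    exact (analyticAt_fst.prod (analyticAt_const.prod analyticAt_fst)).prod
      ((analyticAt_toCorner _ _ (hB.sub (hS.mul hpB))).prod
        ((analyticAt_toCorner _ _ hpB).prod analyticAt_const))
  refine ⟨p, (p, p), g, ⟨h0, unit_mem_arrowSource h0, Set.univ, Filter.univ_mem, ?_⟩, hg⟩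
  rintro t' ⟨ht', -⟩ -
  exact ⟨unit_mem_arrowSource ht', Prod.ext (arrowChart_unit ht').symm
    (tangentCoord_arrowVec_unit ht' t'.2).symm⟩

theorem holomorphicOn_vecIdeal :
    HolomorphicOn (arrowAtlas p₀).tangentAtlas (idealAtlas p₀) vecIdeal
      ((groupoid p₀).algebroid (orbitAtlas p₀) (arrowAtlas p₀)) := by
  intro t ht
  obtain ⟨s, rfl⟩ : ∃ s, idealVec s = t := ⟨_, idealVec_vecIdeal ht⟩
  set p : orbit p₀ := s.1.1 with hp
  -- Adding `p + a` times the middle component to the first one undoes `B ↦ (B - (p + a) p B, p B)`.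
  -- The formula makes sense for all tangent vectors, so it extends the inverse off the algebroid.
  let g : arrowModel (p, p) × arrowModel (p, p) → corner (1 - p.1) p.1 × corner 1 p.1 := fun z =>
    (z.1.1, toCorner IsIdempotentElem.one (orbit_idem p)
      (z.2.1.1 + (p.1 + z.1.1.1) * z.2.2.1.1))
  have h0 := splits_self (orbit_proj p)
  have hg : ∀ z, AnalyticAt ℂ g z := by
    intro z
    have h1 : AnalyticAt ℂ (fun z : arrowModel (p, p) × arrowModel (p, p) => z.2.1.1) z :=
      (analyticAt_corner_coe z.2.1).comp (f := fun z : arrowModel (p, p) × arrowModel (p, p) =>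
        z.2.1) (analyticAt_fst.comp analyticAt_snd)
    have h2 : AnalyticAt ℂ (fun z : arrowModel (p, p) × arrowModel (p, p) => z.2.2.1.1) z :=
      (analyticAt_model_mid z.2).comp analyticAt_snd
    have h3 : AnalyticAt ℂ (fun z : arrowModel (p, p) × arrowModel (p, p) => p.1 + z.1.1.1) z :=
      (analyticAt_model_fst z.1).comp analyticAt_fst
    exact (analyticAt_fst.comp analyticAt_fst).prod (analyticAt_toCorner _ _ (h1.add (h3.mul h2)))
  refine ⟨(p, p), p, g, ⟨unit_mem_arrowSource h0, ?_, Set.univ, Filter.univ_mem, ?_⟩, hg _⟩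
  · rw [vecIdeal_idealVec]
    exact h0
  rintro t' ⟨hsrc, ht'⟩ -
  obtain ⟨s', rfl⟩ : ∃ s, idealVec s = t' := ⟨_, idealVec_vecIdeal ht'⟩
  have h : Splits p.1 s'.1.1.1 := by
    have h1 : Splits p.1 (tgt ((groupoid p₀).unit s'.1.1)).1 := hsrc.1
    rwa [tgt_unit] at h1
  rw [vecIdeal_idealVec]
  refine ⟨h, ?_⟩
  have e : (arrowAtlas p₀).tangentAtlas.chart (p, p) (idealVec s') =
      ((baseChart p s'.1.1, ⟨p.1, orbit_idem p, orbit_idem p⟩, baseChart p s'.1.1), _) :=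
    Prod.ext (arrowChart_unit h) (tangentCoord_arrowVec_unit h s'.2)
  refine (congrArg g e).trans (Prod.ext rfl (Subtype.ext ?_))
  set B : corner 1 p.1 := idealCoord p s'.1.1 s'.1.2
  set a := baseChart p s'.1.1
  change (toCorner _ _ ((toCorner _ _ (B.1 - (p.1 + a.1) * (p.1 * B.1)) : corner _ _).1 +
    (p.1 + a.1) * (toCorner _ _ (p.1 * B.1) : corner _ _).1) : corner _ _).1 = B.1
  have hpp : p.1 * p.1 = p.1 := (orbit_idem p).eq
  have hBp : B.1 * p.1 = B.1 := B.2.2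
  have hpa : p.1 * a.1 = 0 := by
    have h1 := a.2.1
    rwa [sub_mul, one_mul, sub_eq_self] at h1
  rw [toCorner_coe, toCorner_coe, toCorner_coe, one_mul, ← mul_assoc p.1 p.1, hpp,
    mul_assoc p.1 B.1, hBp, mul_assoc (1 - p.1), sub_mul B.1, hBp, mul_assoc _ _ p.1,
    mul_assoc _ _ p.1, hBp, sub_mul 1 p.1, one_mul, mul_sub p.1, ← mul_assoc p.1 (p.1 + a.1),
    mul_add p.1 p.1, hpp, hpa, add_zero, ← mul_assoc p.1 p.1, hpp, sub_self, sub_zero,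
    sub_add_cancel, hBp]

/-- The isomorphism of the algebroids. -/
noncomputable def algebroidMap (t : Quotient (tangentSetoid p₀)) : (arrowAtlas p₀).TangentTotal :=
  idealVec (tangentBij p₀ t)

theorem algebroidMap_cls (η : bundle p₀) (v : corner 1 p₀) :
    algebroidMap (tangentCls η v) = ⟨(groupoid p₀).unit (bundleProj η),
      arrowVec ((groupoid p₀).unit (bundleProj η)) (v.1 * pinv η.1)⟩ := rfl

theorem algebroidMap_eq_tangentTotalMap (η : bundle p₀) (v : (bundleAtlas p₀).TangentAt η) :
    algebroidMap (tangentCls η v) =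
      tangentTotalMap (bundleAtlas p₀) (arrowAtlas p₀) (fun ξ => pairArrow ξ η) ⟨η, v⟩ := by
  refine (algebroidMap_cls η v).trans ?_
  rw [← pairArrow_self]
  exact congrArg (Sigma.mk (pairArrow η η)) (tangentMap_pairArrow η η v).symm

theorem range_algebroidMap : Set.range (algebroidMap (p₀ := p₀)) =
    (groupoid p₀).algebroid (orbitAtlas p₀) (arrowAtlas p₀) := by
  apply Set.Subset.antisymm
  · rintro _ ⟨t, rfl⟩
    exact idealVec_mem_algebroid _
  · intro t ht
    obtain ⟨s, hs⟩ := bijective_tangentBij.2 (vecIdeal t)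
    exact ⟨s, (congrArg idealVec hs).trans (idealVec_vecIdeal ht)⟩

section Quotients

variable {𝒬₀ : BanachAtlas (Quotient (bundleSetoid p₀))}
  {𝒬₁ : BanachAtlas (Quotient (pairSetoid p₀))} {𝒬₂ : BanachAtlas (Quotient (tangentSetoid p₀))}

theorem biholomorphic_tangentBij
    (h₂ : IsQuotientManifold (bundleAtlas p₀).tangentAtlas (tangentSetoid p₀) 𝒬₂) :
    Biholomorphic 𝒬₂ (idealAtlas p₀) (tangentBij p₀) :=
  h₂.biholomorphic isBanachManifold_bundleAtlas.tangentAtlas isBanachManifold_idealAtlas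
    isSubmersion_tangentProj bijective_tangentBij fun _ => rfl

theorem holomorphic_algebroidMap
    (h₂ : IsQuotientManifold (bundleAtlas p₀).tangentAtlas (tangentSetoid p₀) 𝒬₂) :
    Holomorphic 𝒬₂ (arrowAtlas p₀).tangentAtlas algebroidMap :=
  holomorphic_idealVec.comp isBanachManifold_idealAtlas (biholomorphic_tangentBij h₂).1

theorem exists_inverse_algebroidMap
    (h₂ : IsQuotientManifold (bundleAtlas p₀).tangentAtlas (tangentSetoid p₀) 𝒬₂) :
    ∃ Ψ : (arrowAtlas p₀).TangentTotal → Quotient (tangentSetoid p₀),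
      Function.LeftInverse Ψ algebroidMap ∧ HolomorphicOn (arrowAtlas p₀).tangentAtlas 𝒬₂ Ψ
        ((groupoid p₀).algebroid (orbitAtlas p₀) (arrowAtlas p₀)) := by
  obtain ⟨-, e, he, -, hol⟩ := biholomorphic_tangentBij h₂
  refine ⟨e ∘ vecIdeal, fun t => ?_, HolomorphicOn.comp isBanachManifold_idealAtlas hol
    holomorphicOn_vecIdeal (Set.mapsTo_univ _ _)⟩
  exact (congrArg e (vecIdeal_idealVec _)).trans (he t)

/-- The target of `ξ η⁻¹` is the left support of `ξ`; the chain rule applied to the two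
factorisations of this map gives the identity. -/
theorem anchor_algebroidMap
    (h₀ : IsQuotientManifold (bundleAtlas p₀) (bundleSetoid p₀) 𝒬₀)
    (hφ : Holomorphic 𝒬₀ (orbitAtlas p₀) (baseMap p₀))
    (η : bundle p₀) (v : (bundleAtlas p₀).TangentAt η) :
    tangentTotalMap (arrowAtlas p₀) (orbitAtlas p₀) (groupoid p₀).tgt
      (algebroidMap (tangentCls η v)) =
      tangentTotalMap 𝒬₀ (orbitAtlas p₀) (baseMap p₀)
        (tangentTotalMap (bundleAtlas p₀) 𝒬₀ cls ⟨η, v⟩) := by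
  rw [algebroidMap_eq_tangentTotalMap, ← Holomorphic.tangentTotalMap_comp
    isBanachManifold_bundleAtlas isBanachManifold_arrowAtlas isBanachManifold_orbitAtlas
    isSubmersion_tgt.1 (holomorphic_pairArrow_left η)]
  have h1 : (groupoid p₀).tgt ∘ (fun ξ => pairArrow ξ η) = baseMap p₀ ∘ cls :=
    funext fun ξ => tgt_pairArrow ξ η
  rw [h1]
  exact Holomorphic.tangentTotalMap_comp isBanachManifold_bundleAtlas h₀.1
    isBanachManifold_orbitAtlas hφ h₀.2.1 _

end Quotients

end PartialInv

namespace BanachAtlas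

/-! ## Vector fields -/

/-- The Lie brackets of related vector fields are related. -/
theorem lieBracket_of_related {E F : Type*} [NormedAddCommGroup E] [NormedSpace ℝ E]
    [NormedAddCommGroup F] [NormedSpace ℝ F] {f : E → F} {V₁ V₂ : E → E} {W₁ W₂ : F → F} {x : E}
    (hf : ContDiffAt ℝ 2 f x) (hV₁ : DifferentiableAt ℝ V₁ x) (hV₂ : DifferentiableAt ℝ V₂ x)
    (hW₁ : DifferentiableAt ℝ W₁ (f x)) (hW₂ : DifferentiableAt ℝ W₂ (f x))
    (h₁ : ∀ᶠ y in 𝓝 x, W₁ (f y) = fderiv ℝ f y (V₁ y))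
    (h₂ : ∀ᶠ y in 𝓝 x, W₂ (f y) = fderiv ℝ f y (V₂ y)) :
    VectorField.lieBracket ℝ W₁ W₂ (f x) =
      fderiv ℝ f x (VectorField.lieBracket ℝ V₁ V₂ x) := by
  have hd : DifferentiableAt ℝ f x := hf.differentiableAt (by norm_num)
  have key : ∀ {V : E → E} {W : F → F}, DifferentiableAt ℝ W (f x) →
      (∀ᶠ y in 𝓝 x, W (f y) = fderiv ℝ f y (V y)) → ∀ v,
        fderiv ℝ (fun y => fderiv ℝ f y (V y)) x v = fderiv ℝ W (f x) (fderiv ℝ f x v) := by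
    intro V W hW h v
    have h3 : (fun y => fderiv ℝ f y (V y)) =ᶠ[𝓝 x] W ∘ f := h.mono fun y hy => hy.symm
    rw [h3.fderiv_eq, fderiv_comp x hW hd]
    rfl
  -- The second derivative of `f` contributes symmetrically to both terms of the bracket and
  -- cancels, so only the derivatives of the relations remain. No invertibility of `f` is involved.
  rw [VectorField.fderiv_apply_lieBracket hf (by simp) hV₂ hV₁, key hW₁ h₁, key hW₂ h₂,
    ← h₁.self_of_nhds, ← h₂.self_of_nhds]
  rfl

variable {X : Type u} {𝒜 : BanachAtlas X}

theorem IsBanachManifold.fieldExpr_chart (h𝒜 : 𝒜.IsBanachManifold) (ξ : ∀ x, 𝒜.TangentAt x)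
    {i : 𝒜.ι} {x : X} (hx : x ∈ 𝒜.source i) :
    𝒜.fieldExpr ξ i (𝒜.chart i x) = 𝒜.tangentCoord i x (ξ x) := by
  have h : Function.Injective fun x : 𝒜.source i => 𝒜.chart i x := fun a b hab =>
    Subtype.ext (h𝒜.injOn i a.2 b.2 hab)
  exact h.extend_apply (fun x : 𝒜.source i => 𝒜.tangentCoord i x (ξ x)) 0 ⟨x, hx⟩

end BanachAtlas

namespace PartialInv

variable {M : Type u} [CStarAlgebra M] {p₀ : M} {U : Set (orbit p₀)}

/-! ## The sections of the Atiyah algebroid -/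

section Atiyah

variable {ϑ : ∀ η, (bundleAtlas p₀).TangentAt η}

/-- The value of a vector field at a point, in `M p₀`. -/
def fieldPt (ϑ : ∀ η, (bundleAtlas p₀).TangentAt η) (η : bundle p₀) : corner 1 p₀ := ϑ η

/-- The vector field in the coordinates of `M p₀`. -/
noncomputable def bundleField (ϑ : ∀ η, (bundleAtlas p₀).TangentAt η) :
    corner 1 p₀ → corner 1 p₀ :=
  (bundleAtlas p₀).fieldExpr ϑ PUnit.unit

theorem bundleField_bundlePt (ϑ : ∀ η, (bundleAtlas p₀).TangentAt η) (η : bundle p₀) :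
    bundleField ϑ (bundlePt η) = fieldPt ϑ η :=
  (isBanachManifold_bundleAtlas.fieldExpr_chart ϑ (i := PUnit.unit) (x := η) trivial).trans
    (tangentCoord_bundleAtlas η (ϑ η))

theorem eventually_exists_bundlePt (hU : (orbitAtlas p₀).IsOpenSet U) {η : bundle p₀}
    (hη : bundleProj η ∈ U) :
    ∀ᶠ x in 𝓝 (bundlePt η), ∃ η' : bundle p₀, bundlePt η' = x ∧ bundleProj η' ∈ U := by
  have h := splits_self (orbit_proj (bundleProj η))
  have h1 : bundlePt '' Set.univ ∈ 𝓝 (bundlePt η) :=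
    isBanachManifold_bundleAtlas.image_mem_nhds (i := PUnit.unit) (x := η) trivial
  have h2 : IsOpen (baseChart (bundleProj η) '' (U ∩ {q | Splits (bundleProj η).1 q.1})) :=
    hU (bundleProj η)
  have h3 : slope (bundleProj η) (bundlePt η).1 = baseChart (bundleProj η) (bundleProj η) :=
    (baseChart_eq_slope h (isInverse_bundle η)).symm
  filter_upwards [h1, eventually_splits h, (analyticAt_slope_bundle h).continuousAt.preimage_mem_nhds
    (h2.mem_nhds ⟨bundleProj η, ⟨hη, h⟩, h3.symm⟩)]
  rintro _ ⟨η', -, rfl⟩ hs ⟨q, hq, hqs⟩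
  refine ⟨η', rfl, ?_⟩
  have h4 : baseChart (bundleProj η) q = baseChart (bundleProj η) (bundleProj η') :=
    hqs.trans (baseChart_eq_slope (hs η' rfl) (isInverse_bundle η')).symm
  rw [← baseChart_injOn _ hq.2 (hs η' rfl) h4]
  exact hq.1

/-- The single chart of `P₀` reduces smoothness of a vector field to that of a function with values
in `M p₀`. -/
theorem realSmoothOn_bundle_iff (hU : (orbitAtlas p₀).IsOpenSet U) :
    RealSmoothOn (bundleAtlas p₀) (bundleAtlas p₀).tangentAtlas (fun η => ⟨η, ϑ η⟩)
      {η | bundleProj η ∈ U} ↔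
    ∀ η, bundleProj η ∈ U → ContDiffAt ℝ ∞ (bundleField ϑ) (bundlePt η) := by
  constructor
  · intro h η hη
    obtain ⟨g, ⟨-, -, N, hN, hr⟩, hg⟩ := h.exists_represents isBanachManifold_bundleAtlas
      isBanachManifold_bundleAtlas.tangentAtlas (x := η) hη (i := PUnit.unit) (j := PUnit.unit)
      trivial trivial
    change corner 1 p₀ → corner 1 p₀ × corner 1 p₀ at g
    have hg' : ContDiffAt ℝ ∞ g (bundlePt η) := hg
    have h1 : ContDiffAt ℝ ∞ (fun x => (g x).2) (bundlePt η) :=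
      contDiff_snd.contDiffAt.comp (bundlePt η) hg'
    refine h1.congr_of_eventuallyEq ?_
    filter_upwards [eventually_exists_bundlePt hU hη, hN]
    rintro _ ⟨η', rfl, hη'⟩ hN'
    have h2 := congrArg Prod.snd (hr η' ⟨trivial, hη'⟩ hN').2
    exact (bundleField_bundlePt ϑ η').trans
      ((tangentCoord_bundleAtlas η' (ϑ η')).symm.trans h2.symm)
  · intro h η hη
    have h1 : ContDiffAt ℝ ∞ (fun x => (x, bundleField ϑ x)) (bundlePt η) :=
      contDiffAt_id.prodMk (h η hη)
    refine ⟨PUnit.unit, PUnit.unit, fun x : corner 1 p₀ => (x, bundleField ϑ x), ⟨trivial, trivial,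
      Set.univ, Filter.univ_mem, fun η' _ _ => ⟨trivial, Prod.ext rfl ?_⟩⟩, h1⟩
    exact (bundleField_bundlePt ϑ η').trans (tangentCoord_bundleAtlas η' (ϑ η')).symm

theorem IsAtiyahSection.contDiffAt (hU : (orbitAtlas p₀).IsOpenSet U) (h : IsAtiyahSection U ϑ)
    {η : bundle p₀} (hη : bundleProj η ∈ U) : ContDiffAt ℝ ∞ (bundleField ϑ) (bundlePt η) :=
  (realSmoothOn_bundle_iff hU).1 h.1 η hη

/-- By invariance `ϑ(η) η⁻¹` is constant along the fibres, so it defines a section of the bundle of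
left ideals. -/
theorem IsAtiyahSection.fieldPt_mul_pinv (h : IsAtiyahSection U ϑ) {η η' : bundle p₀}
    (hη : bundleProj η ∈ U) (he : bundleProj η = bundleProj η') :
    (fieldPt ϑ η').1 * pinv η'.1 = (fieldPt ϑ η).1 * pinv η.1 := by
  obtain ⟨h1, h2⟩ := exists_mul_of_bundleProj_eq he
  have h3 : (fieldPt ϑ η').1 = (fieldPt ϑ η).1 * (pinv η.1 * η'.1) := h.2 η η' hη _ h1 h2
  have h4 := isInverse_bundle η'
  rw [← he] at h4
  rw [h3, mul_assoc, mul_assoc (pinv η.1), h4.xy, (isInverse_bundle η).yq]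

end Atiyah

/-! ## The sections of the algebroid -/

section Algebroid

variable {ϑ : ∀ η, (bundleAtlas p₀).TangentAt η}
  {X : ∀ q, (arrowAtlas p₀).TangentAt ((groupoid p₀).unit q)}

theorem carriesSection_iff : CarriesSection algebroidMap U ϑ X ↔ ∀ η, bundleProj η ∈ U →
    X (bundleProj η) = arrowVec ((groupoid p₀).unit (bundleProj η))
      ((fieldPt ϑ η).1 * pinv η.1) := by
  constructor
  · intro h η hη
    exact (eq_of_heq (Sigma.mk.inj_iff.1 (h η hη)).2).symm
  · intro h η hη
    exact congrArg (Sigma.mk ((groupoid p₀).unit (bundleProj η))) (h η hη).symm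

theorem CarriesSection.isAlgebroidSection (hU : (orbitAtlas p₀).IsOpenSet U)
    (h : IsAtiyahSection U ϑ) (hX : CarriesSection algebroidMap U ϑ X) :
    IsAlgebroidSection U X := by
  have hX' := carriesSection_iff.1 hX
  refine ⟨fun q hq => ?_, fun q hq => ?_⟩
  · obtain ⟨η, rfl⟩ := bundleProj_surjective q
    set p : orbit p₀ := bundleProj η with hp
    have hη := isInverse_bundle η
    rw [← hp] at hη
    -- A local section of `P₀` through `η`; along it the ideal coordinate of `ϑ(η') η'⁻¹` is the
    -- smooth function `ϑ(c(a)) η⁻¹`.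
    let c : corner (1 - p.1) p.1 → corner 1 p₀ := fun a => toBundle η ((p.1 + a.1) * η.1)
    let B : corner (1 - p.1) p.1 → M := fun a => (bundleField ϑ (c a)).1 * pinv η.1
    let g : corner (1 - p.1) p.1 → arrowModel (p, p) × arrowModel (p, p) := fun a =>
      ((a, ⟨p.1, orbit_idem p, orbit_idem p⟩, a),
        (toCorner (orbit_idem' p) (orbit_idem p) (B a - (p.1 + a.1) * (p.1 * B a)),
          toCorner (orbit_idem p) (orbit_idem p) (p.1 * B a), 0))
    have h0 := splits_self (orbit_proj p)
    have hc0 : c (baseChart p p) = bundlePt η := by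
      refine Subtype.ext ?_
      change (toBundle η ((p.1 + (baseChart p p).1) * η.1)).1 = η.1
      have z1 : (baseChart p p).1 = 0 := by rw [baseChart_self]; rfl
      rw [toBundle_mul_coe, z1, add_zero, hη.qx]
    have hS : ContDiffAt ℝ ∞ (fun a : corner (1 - p.1) p.1 => p.1 + a.1) (baseChart p p) :=
      ((analyticAt_add_corner _).restrictScalars (𝕜 := ℝ)).contDiffAt
    have hc : ContDiffAt ℝ ∞ c (baseChart p p) :=
      ((((toBundle η).analyticAt _).comp ((analyticAt_add_corner _).mul
        analyticAt_const)).restrictScalars (𝕜 := ℝ)).contDiffAt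
    have hB : ContDiffAt ℝ ∞ B (baseChart p p) := by
      have h1 := h.contDiffAt hU hq
      rw [← hc0] at h1
      have h2 : ContDiffAt ℝ ∞ (fun x : corner 1 p₀ => x.1) (bundleField ϑ (c (baseChart p p))) :=
        ((analyticAt_corner_coe _).restrictScalars (𝕜 := ℝ)).contDiffAt
      exact (h2.comp (baseChart p p) (h1.comp (baseChart p p) hc)).mul contDiffAt_const
    have ht : ∀ {a b : M} (ha : IsIdempotentElem a) (hb : IsIdempotentElem b)
        {F : corner (1 - p.1) p.1 → M}, ContDiffAt ℝ ∞ F (baseChart p p) →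
        ContDiffAt ℝ ∞ (fun x => toCorner ha hb (F x)) (baseChart p p) := fun ha hb F hF =>
      ((toCorner ha hb).restrictScalars ℝ).contDiff.contDiffAt.comp _ hF
    have hg : ContDiffAt ℝ ∞ g (baseChart p p) :=
      (contDiffAt_id.prodMk (contDiffAt_const.prodMk contDiffAt_id)).prodMk
        ((ht _ _ (hB.sub (hS.mul (contDiffAt_const.mul hB)))).prodMk
          ((ht _ _ (contDiffAt_const.mul hB)).prodMk contDiffAt_const))
    refine ⟨p, (p, p), g, ⟨h0, unit_mem_arrowSource h0, Set.univ, Filter.univ_mem, ?_⟩, hg⟩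
    rintro q' ⟨hs, hq'⟩ -
    have hs : Splits p.1 q'.1 := hs
    refine ⟨unit_mem_arrowSource hs, ?_⟩
    have hi : IsInverse ((p.1 + (baseChart p q').1) * η.1) (pinv η.1 * (p.1 * q'.1)) p₀ q'.1 := by
      rw [add_baseChart hs]
      exact (isInverse_sigma hs).mul hη
    let η' : bundle p₀ := ⟨_, hi.mem_bundle⟩
    have e1 : bundleProj η' = q' := Subtype.ext hi.leftSupport_eq
    have e2 : c (baseChart p q') = bundlePt η' := Subtype.ext (toBundle_mul_coe _ _)
    have e3 : B (baseChart p q') = (idealCoord p q' ((fieldPt ϑ η').1 * pinv η'.1)).1 := by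
      change (bundleField ϑ (c (baseChart p q'))).1 * pinv η.1 = _
      rw [e2, bundleField_bundlePt, idealCoord_coe hs, hi.pinv_eq, mul_assoc, mul_assoc (pinv η.1),
        (isInverse_sigma hs).yx, hη.yq]
    have hA : (fieldPt ϑ η').1 * pinv η'.1 * q'.1 = (fieldPt ϑ η').1 * pinv η'.1 := by
      rw [mul_assoc, hi.pinv.yq]
    have e4 : X q' = arrowVec ((groupoid p₀).unit q') ((fieldPt ϑ η').1 * pinv η'.1) := by
      have h1 := hX' η' (by rw [e1]; exact hq')
      rwa [e1] at h1
    refine Prod.ext (arrowChart_unit hs).symm ?_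
    change (toCorner (orbit_idem' p) (orbit_idem p)
      (B (baseChart p q') - (p.1 + (baseChart p q').1) * (p.1 * B (baseChart p q'))),
        toCorner (orbit_idem p) (orbit_idem p) (p.1 * B (baseChart p q')), 0) =
      (arrowAtlas p₀).tangentCoord (p, p) ((groupoid p₀).unit q') (X q')
    rw [e3, e4]
    exact (tangentCoord_arrowVec_unit hs hA).symm
  · obtain ⟨η, rfl⟩ := bundleProj_surjective q
    rw [hX' η hq]
    exact ⟨⟨bundleProj η, rfl⟩, tangentMap_src _ _⟩

theorem IsAtiyahSection.exists_carriesSection (hU : (orbitAtlas p₀).IsOpenSet U)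
    (h : IsAtiyahSection U ϑ) : ∃ X, IsAlgebroidSection U X ∧ CarriesSection algebroidMap U ϑ X := by
  -- An arbitrary choice of representatives suffices, since invariance makes the value independent
  -- of it.
  choose s hs using bundleProj_surjective (p₀ := p₀)
  let X : ∀ q, (arrowAtlas p₀).TangentAt ((groupoid p₀).unit q) := fun q =>
    arrowVec ((groupoid p₀).unit q) ((fieldPt ϑ (s q)).1 * pinv (s q).1)
  have hX : CarriesSection algebroidMap U ϑ X := by
    refine carriesSection_iff.2 fun η hη => ?_
    change arrowVec _ _ = _
    rw [h.fieldPt_mul_pinv hη (hs (bundleProj η)).symm]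
  exact ⟨X, hX.isAlgebroidSection hU h, hX⟩

/-- The section of the bundle of left ideals defined by a section of the algebroid. -/
noncomputable def sectionIdeal (X : ∀ q, (arrowAtlas p₀).TangentAt ((groupoid p₀).unit q))
    (q : orbit p₀) : idealBundle p₀ :=
  vecIdeal ⟨(groupoid p₀).unit q, X q⟩

theorem sectionIdeal_fst (X : ∀ q, (arrowAtlas p₀).TangentAt ((groupoid p₀).unit q))
    (q : orbit p₀) : (sectionIdeal X q).1.1 = q := tgt_unit q

theorem sectionIdeal_mul (X : ∀ q, (arrowAtlas p₀).TangentAt ((groupoid p₀).unit q))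
    (q : orbit p₀) : (sectionIdeal X q).1.2 * q.1 = (sectionIdeal X q).1.2 := by
  have h := (sectionIdeal X q).2
  rwa [sectionIdeal_fst] at h

theorem IsAlgebroidSection.eq_arrowVec (h : IsAlgebroidSection U X) {q : orbit p₀} (hq : q ∈ U) :
    X q = arrowVec ((groupoid p₀).unit q) (sectionIdeal X q).1.2 := by
  have h1 := idealVec_vecIdeal (h.2 q hq)
  have h2 : sectionIdeal X q = ⟨(q, (sectionIdeal X q).1.2), sectionIdeal_mul X q⟩ :=
    Subtype.ext (Prod.ext (sectionIdeal_fst X q) rfl)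
  change idealVec (sectionIdeal X q) = _ at h1
  rw [h2] at h1
  exact (eq_of_heq (Sigma.mk.inj_iff.1 h1).2).symm

theorem IsAlgebroidSection.exists_carriesSection (hU : (orbitAtlas p₀).IsOpenSet U)
    (h : IsAlgebroidSection U X) : ∃ ϑ, IsAtiyahSection U ϑ ∧ CarriesSection algebroidMap U ϑ X := by
  -- The field is forced: `ϑ(η) = A η`, where `A` in `M q` is the element given by `X` at the
  -- projection `q` of `η`.
  let ϑ : ∀ η, (bundleAtlas p₀).TangentAt η := fun η =>
    toBundle η ((sectionIdeal X (bundleProj η)).1.2 * η.1)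
  have hϑ : ∀ η, (fieldPt ϑ η).1 = (sectionIdeal X (bundleProj η)).1.2 * η.1 := fun η =>
    toBundle_mul_coe η _
  refine ⟨ϑ, ⟨(realSmoothOn_bundle_iff hU).2 fun η hη => ?_, ?_⟩,
    carriesSection_iff.2 fun η hη => ?_⟩
  · set p : orbit p₀ := bundleProj η with hp
    have h0 := splits_self (orbit_proj p)
    have h0' : Splits p.1 (bundleProj η).1 := h0
    obtain ⟨g, ⟨-, -, N, hN, hr⟩, hg⟩ := h.1.exists_represents isBanachManifold_orbitAtlas
      isBanachManifold_arrowAtlas.tangentAtlas (x := p) hη (i := p) (j := (p, p)) h0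
      (unit_mem_arrowSource h0)
    change corner (1 - p.1) p.1 → arrowModel (p, p) × arrowModel (p, p) at g
    have hg' : ContDiffAt ℝ ∞ g (baseChart p p) := hg
    -- The ideal coordinate of `A`, recovered smoothly from the tangent coordinates of `X`.
    let B : corner (1 - p.1) p.1 → M := fun a => (g a).2.1.1 + (p.1 + a.1) * (g a).2.2.1.1
    -- Since `A η' = A σ_p(q') (p q') η'`, the field is `B (p η')`, a formula that is smooth near
    -- `η` in `M p₀`.
    let V : corner 1 p₀ → corner 1 p₀ := fun x => toBundle η (B (slope p x.1) * (p.1 * x.1))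
    have e0 : baseChart p p = slope p η.1 := baseChart_eq_slope h0' (isInverse_bundle η)
    have hB : ContDiffAt ℝ ∞ B (baseChart p p) := by
      have k1 : ContDiffAt ℝ ∞ (fun a : corner (1 - p.1) p.1 => p.1 + a.1) (baseChart p p) :=
        ((analyticAt_add_corner _).restrictScalars (𝕜 := ℝ)).contDiffAt
      have k2 : ContDiffAt ℝ ∞ (fun z : arrowModel (p, p) × arrowModel (p, p) => z.2.1.1)
          (g (baseChart p p)) :=
        (((analyticAt_corner_coe _).comp (f := fun z : arrowModel (p, p) × arrowModel (p, p) =>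
          z.2.1) (analyticAt_fst.comp analyticAt_snd)).restrictScalars (𝕜 := ℝ)).contDiffAt
      have k3 : ContDiffAt ℝ ∞ (fun z : arrowModel (p, p) × arrowModel (p, p) => z.2.2.1.1)
          (g (baseChart p p)) :=
        (((analyticAt_model_mid _).comp (f := fun z : arrowModel (p, p) × arrowModel (p, p) =>
          z.2) analyticAt_snd).restrictScalars (𝕜 := ℝ)).contDiffAt
      exact (k2.comp (baseChart p p) hg').add (k1.mul (k3.comp (baseChart p p) hg'))
    have hV : ContDiffAt ℝ ∞ V (bundlePt η) := by
      rw [e0] at hB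
      have k1 : ContDiffAt ℝ ∞ (fun x : corner 1 p₀ => slope p x.1) (bundlePt η) :=
        ((analyticAt_slope_bundle h0').restrictScalars (𝕜 := ℝ)).contDiffAt
      have k2 : ContDiffAt ℝ ∞ (fun x : corner 1 p₀ => p.1 * x.1) (bundlePt η) :=
        ((analyticAt_const.mul (analyticAt_corner_coe _)).restrictScalars (𝕜 := ℝ)).contDiffAt
      have k3 : ContDiffAt ℝ ∞ (fun x => B (slope p x.1)) (bundlePt η) :=
        ContDiffAt.comp (g := B) (bundlePt η) hB k1
      exact ((toBundle η).restrictScalars ℝ).contDiff.contDiffAt.comp _ (k3.mul k2)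
    refine hV.congr_of_eventuallyEq ?_
    have hN' : (fun x : corner 1 p₀ => slope p x.1) ⁻¹' N ∈ 𝓝 (bundlePt η) := by
      refine (analyticAt_slope_bundle h0').continuousAt.preimage_mem_nhds ?_
      change N ∈ 𝓝 (slope p η.1)
      rw [← e0]
      exact hN
    filter_upwards [eventually_exists_bundlePt hU hη, eventually_splits h0', hN']
    rintro _ ⟨η', rfl, hη'⟩ hs hx
    have hs := hs η' rfl
    set q' : orbit p₀ := bundleProj η' with hq'
    have hi := isInverse_bundle η'
    rw [← hq'] at hi
    have e1 : slope p (bundlePt η').1 = baseChart p q' := (baseChart_eq_slope hs hi).symm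
    have hx' : baseChart p q' ∈ N := e1 ▸ hx
    have e2 : g (baseChart p q') = ((groupoid p₀).unit q' |> arrowChart (p, p),
        (arrowAtlas p₀).tangentCoord (p, p) ((groupoid p₀).unit q') (X q')) :=
      (hr q' ⟨hs, hη'⟩ hx').2
    have e3 : (g (baseChart p q')).2 = _ := (congrArg Prod.snd e2).trans
      ((congrArg _ (h.eq_arrowVec hη')).trans
        (tangentCoord_arrowVec_unit hs (sectionIdeal_mul X q')))
    set A := (sectionIdeal X q').1.2 with hA
    have hpp : p.1 * p.1 = p.1 := (orbit_idem p).eq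
    have hBp : (idealCoord p q' A).1 * p.1 = (idealCoord p q' A).1 := (idealCoord p q' A).2.2
    have e4 : B (baseChart p q') = (idealCoord p q' A).1 := by
      change (g (baseChart p q')).2.1.1 + (p.1 + (baseChart p q').1) *
        (g (baseChart p q')).2.2.1.1 = _
      rw [e3]
      change (toCorner _ _ _ : corner _ _).1 + (p.1 + (baseChart p q').1) *
        (toCorner _ _ _ : corner _ _).1 = _
      rw [toCorner_coe, toCorner_coe, ← mul_assoc p.1 p.1, hpp,
        mul_assoc p.1 _ p.1, hBp, mul_assoc (1 - p.1), sub_mul _ _ p.1, hBp, mul_assoc _ _ p.1,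
        mul_assoc _ _ p.1, hBp, sub_mul 1 p.1, one_mul, mul_sub p.1,
        ← mul_assoc p.1 (p.1 + _), mul_add_corner (orbit_idem p), ← mul_assoc p.1 p.1, hpp,
        sub_self, sub_zero, sub_add_cancel]
    refine (bundleField_bundlePt ϑ η').trans (Subtype.ext ?_)
    change (fieldPt ϑ η').1 = (toBundle η (B (slope p (bundlePt η').1) * (p.1 * η'.1))).1
    rw [e1, e4, hϑ, toBundle_coe (by rw [mul_assoc, mul_assoc, bundle_mul]), idealCoord_coe hs,
      mul_assoc A, ← hi.qx, ← mul_assoc p.1, ← mul_assoc (sigma p.1 q'.1), (isInverse_sigma hs).xy]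
  · intro η η' hη g hg hg'
    obtain ⟨k, -, hk⟩ := bundle_mul_unitGroup η hg
    rw [← hg'] at hk
    have e : bundleProj η' = bundleProj η := Subtype.ext hk.leftSupport_eq
    change (fieldPt ϑ η').1 = (fieldPt ϑ η).1 * g
    rw [hϑ, hϑ, e, hg', mul_assoc]
  · rw [hϑ, mul_assoc, (isInverse_bundle η).xy, sectionIdeal_mul]
    exact h.eq_arrowVec hη

end Algebroid

end PartialInv

namespace PartialInv

variable {M : Type u} [CStarAlgebra M] {p₀ : M} {U : Set (orbit p₀)}

/-! ## Right translations -/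

/-- The right multiplication by `g` in the coordinates of the arrows with the same source. -/
noncomputable def mulRightModel (i : orbit p₀ × orbit p₀) (q : orbit p₀) (g : arrows p₀) :
    arrowModel i →L[ℂ] arrowModel (q, src g) :=
  ((toCorner (orbit_idem' q) (orbit_idem q)).comp ((Submodule.subtypeL _).comp
    (ContinuousLinearMap.fst ℂ _ _))).prod
  (((toCorner (orbit_idem q) (orbit_idem (src g))).comp
    (((ContinuousLinearMap.mul ℂ M).flip g.1).comp ((Submodule.subtypeL _).comp
      ((ContinuousLinearMap.fst ℂ _ _).comp (ContinuousLinearMap.snd ℂ _ _))))).prod 0)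

theorem mulRightModel_apply (i : orbit p₀ × orbit p₀) (q : orbit p₀) (g : arrows p₀)
    (z : arrowModel i) : mulRightModel i q g z =
      (toCorner (orbit_idem' q) (orbit_idem q) z.1.1,
        toCorner (orbit_idem q) (orbit_idem (src g)) (z.2.1.1 * g.1), 0) := rfl

/-- In its own preferred chart `g` has middle coordinate `g` and source coordinate `0`. On a source
fibre right translation is therefore the restriction of a linear map of the model space. -/
theorem arrowChart_mul_right {i : orbit p₀ × orbit p₀} {q : orbit p₀} {g x : arrows p₀}
    (h1 : i.1 = q) (h2 : i.2 = tgt g) (hx : x ∈ arrowSource i) (h : src x = tgt g) :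
    arrowChart (q, src g) ((groupoid p₀).mul x g) = mulRightModel i q g (arrowChart i x) := by
  obtain ⟨a, b⟩ := i
  dsimp only at h1 h2
  subst h1 h2
  have hg : g ∈ arrowSource (tgt g, src g) := mem_arrowSource_self g
  rw [arrowChart_mul (i := (a, tgt g)) h hx hg, mulRightModel_apply]
  refine Prod.ext (toCorner_of_mem _ _ _).symm (Prod.ext (Subtype.ext ?_) ?_)
  · change (toCorner _ _ ((arrowChart (a, tgt g) x).2.1.1 * (middle (tgt g) (src g) g).1) :
      corner _ _).1 = (toCorner _ _ ((arrowChart (a, tgt g) x).2.1.1 * g.1) : corner _ _).1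
    rw [middle_coe hg, sigma_self (orbit_proj (src g)), mul_assoc, (isInverse_arrow g).xp,
      (isInverse_arrow g).qx]
  · exact baseChart_self (src g)

theorem mulRightModel_arrowVec (g : arrows p₀) (A : M) :
    mulRightModel (tgt ((groupoid p₀).unit (tgt g)), src ((groupoid p₀).unit (tgt g))) (tgt g) g
      (arrowVec ((groupoid p₀).unit (tgt g)) A) = arrowVec g A := by
  obtain ⟨h1, h2⟩ := arrowVec_unit_coe (tgt g) A
  rw [mulRightModel_apply]
  refine Prod.ext (Subtype.ext ?_) (Prod.ext (Subtype.ext ?_) rfl)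
  · change (toCorner _ _ (arrowVec ((groupoid p₀).unit (tgt g)) A).1.1 : corner _ _).1 =
      (toCorner _ _ A : corner _ _).1
    rw [toCorner_coe, toCorner_coe, h1]
    change (1 - (tgt g).1) * ((1 - (tgt g).1) * A * (tgt g).1) * (tgt g).1 =
      (1 - (tgt g).1) * A * (tgt g).1
    rw [mul_assoc, mul_assoc _ (tgt g).1, (orbit_idem (tgt g)).eq, ← mul_assoc, ← mul_assoc,
      (orbit_idem' (tgt g)).eq]
  · change (toCorner _ _ ((arrowVec ((groupoid p₀).unit (tgt g)) A).2.1.1 * g.1) : corner _ _).1 =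
      (toCorner _ _ (A * g.1) : corner _ _).1
    rw [toCorner_coe, toCorner_coe, h2, mul_assoc _ (tgt g).1, (isInverse_arrow g).qx]
    simp only [← mul_assoc, (orbit_idem (tgt g)).eq]

theorem rightTranslate_arrowVec (g : arrows p₀) (A : M) :
    (groupoid p₀).rightTranslate (arrowAtlas p₀) g (arrowVec ((groupoid p₀).unit (tgt g)) A) =
      arrowVec g A := by
  set w : arrows p₀ := (groupoid p₀).unit (tgt g) with hw
  let i : orbit p₀ × orbit p₀ := (tgt w, src w)
  have e1 : i.1 = tgt g := tgt_unit (tgt g)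
  have e2 : i.2 = tgt g := src_unit (tgt g)
  have hwi : w ∈ arrowSource i := mem_arrowSource_self w
  have hws : src w = tgt g := e2
  let f : arrowModel i → arrowModel (tgt g, src g) :=
    localExpr (arrowAtlas p₀) (arrowAtlas p₀) (fun h => (groupoid p₀).mul h g) i (tgt g, src g)
  let T : Set (arrowModel i) := arrowChart i '' {h | h ∈ arrowSource i ∧ src h = tgt g}
  let G := mulRightModel i (tgt g) g
  have hfG : Set.EqOn f G T := by
    rintro _ ⟨h, ⟨hi, hs⟩, rfl⟩
    exact (isBanachManifold_arrowAtlas.localExpr_chart (ℬ := arrowAtlas p₀)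
      (fun h => (groupoid p₀).mul h g) (i := i) (tgt g, src g) hi).trans
        (arrowChart_mul_right e1 e2 hi hs)
  have hwT : arrowChart i w ∈ T := ⟨w, ⟨hwi, hws⟩, rfl⟩
  have h1 : fderivWithin ℂ f T (arrowChart i w) = fderivWithin ℂ G T (arrowChart i w) :=
    fderivWithin_congr' hfG hwT
  have hG : HasFDerivWithinAt G G T (arrowChart i w) := G.hasFDerivWithinAt
  let v : arrowModel i := arrowVec w A
  -- A derivative within `T` is determined only on the tangent cone, as the source coordinate is
  -- frozen on `T`. The vector `v` has source component `0`, so small multiples of it stay in `T`.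
  have hv : v ∈ tangentConeAt ℂ T (arrowChart i w) := by
    refine mem_tangentConeAt_of_add_smul_mem (l := 𝓝[≠] (0 : ℂ)) (c := id) Filter.tendsto_id ?_
    have hc : ContinuousAt (fun t : ℂ => arrowChart i w + t • v) 0 := by fun_prop
    have hn : arrowChart i '' arrowSource i ∈ 𝓝 (arrowChart i w + (0 : ℂ) • v) := by
      rw [zero_smul, add_zero]
      exact isBanachManifold_arrowAtlas.image_mem_nhds (i := i) hwi
    filter_upwards [mem_nhdsWithin_of_mem_nhds (hc hn)]
    rintro t ⟨h, hi, ht⟩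
    refine ⟨h, ⟨hi, ?_⟩, ht⟩
    have h3 : baseChart i.2 (src h) = baseChart i.2 (src w) := by
      have h4 : (arrowChart i h).2.2 = (arrowChart i w + t • v).2.2 := congrArg (fun z => z.2.2) ht
      have h5 : (arrowChart i w + t • v).2.2 = (arrowChart i w).2.2 + t • (0 : corner _ _) := rfl
      rw [smul_zero, add_zero] at h5
      exact h4.trans h5
    exact (baseChart_injOn i.2 hi.2 hwi.2 h3).trans hws
  have h2 := (hG.differentiableWithinAt.hasFDerivWithinAt.unique_on hG) hv
  exact (congrArg (fun L : arrowModel i →L[ℂ] arrowModel (tgt g, src g) => L v) h1).trans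
    (h2.trans (mulRightModel_arrowVec g A))

/-! ## The brackets -/

section Bracket

variable {ϑ ϑ₁ ϑ₂ : ∀ η, (bundleAtlas p₀).TangentAt η}
  {X X₁ X₂ : ∀ q, (arrowAtlas p₀).TangentAt ((groupoid p₀).unit q)}

theorem CarriesSection.rightInvariantField_eq (h : CarriesSection algebroidMap U ϑ X)
    {η : bundle p₀} (hη : bundleProj η ∈ U) {x : arrows p₀} (hx : tgt x = bundleProj η) :
    (groupoid p₀).rightInvariantField (arrowAtlas p₀) X x =
      arrowVec x ((fieldPt ϑ η).1 * pinv η.1) := by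
  have h1 : X (tgt x) = arrowVec ((groupoid p₀).unit (tgt x)) ((fieldPt ϑ η).1 * pinv η.1) := by
    rw [hx]
    exact carriesSection_iff.1 h η hη
  exact (congrArg ((groupoid p₀).rightTranslate (arrowAtlas p₀) x) h1).trans
    (rightTranslate_arrowVec x _)

/-- The right invariant vector field in a chart. -/
noncomputable def arrowField (X : ∀ q, (arrowAtlas p₀).TangentAt ((groupoid p₀).unit q))
    (i : orbit p₀ × orbit p₀) : arrowModel i → arrowModel i :=
  (arrowAtlas p₀).fieldExpr ((groupoid p₀).rightInvariantField (arrowAtlas p₀) X) i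

/-- The central relation: for each fixed `ξ`, the map `ζ ↦ ζ ξ⁻¹` carries the invariant field to the
right invariant field. -/
theorem CarriesSection.arrowField_pairChart (h : CarriesSection algebroidMap U ϑ X)
    {i : orbit p₀ × orbit p₀} {η ξ : bundle p₀} (hη : bundleProj η ∈ U)
    (h1 : Splits i.1.1 (bundleProj η).1) (h2 : Splits i.2.1 (bundleProj ξ).1) :
    arrowField X i (pairChart i η.1 ξ.1) = pairDeriv i η.1 ξ.1 (fieldPt ϑ η).1 := by
  rw [← arrowChart_pairArrow h1 h2]
  refine (isBanachManifold_arrowAtlas.fieldExpr_chart _ (i := i)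
    (pairArrow_mem_arrowSource h1 h2)).trans ?_
  rw [h.rightInvariantField_eq hη (tgt_pairArrow η ξ)]
  refine (tangentCoord_arrowVec h1 h2 rfl ?_).trans ?_
  · rw [mul_assoc, (isInverse_bundle η).yq]
  · rw [mul_assoc, (isInverse_bundle η).yx, (fieldPt ϑ η).2.2]

theorem contDiffAt_pairDeriv {E : Type*} [NormedAddCommGroup E] [NormedSpace ℝ E]
    {i : orbit p₀ × orbit p₀} {η ξ : bundle p₀} (h1 : Splits i.1.1 (bundleProj η).1)
    (h2 : Splits i.2.1 (bundleProj ξ).1) {F G V : E → corner 1 p₀} {e : E}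
    (hF : ContDiffAt ℝ ∞ F e) (hG : ContDiffAt ℝ ∞ G e) (hV : ContDiffAt ℝ ∞ V e)
    (hFe : F e = bundlePt η) (hGe : G e = bundlePt ξ) :
    ContDiffAt ℝ ∞ (fun z => pairDeriv i (F z).1 (G z).1 (V z).1) e := by
  have hc : ∀ {F : E → corner 1 p₀}, ContDiffAt ℝ ∞ F e → ContDiffAt ℝ ∞ (fun z => (F z).1) e :=
    fun hF => ((corner 1 p₀).subtypeL.restrictScalars ℝ).contDiff.contDiffAt.comp e hF
  have ht : ∀ {a b : M} (ha : IsIdempotentElem a) (hb : IsIdempotentElem b)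
      {F : E → M}, ContDiffAt ℝ ∞ F e → ContDiffAt ℝ ∞ (fun x => toCorner ha hb (F x)) e :=
    fun ha hb F hF => ((toCorner ha hb).restrictScalars ℝ).contDiff.contDiffAt.comp e hF
  have hp : ∀ {p : orbit p₀} {η : bundle p₀} {F : E → corner 1 p₀},
      Splits p.1 (bundleProj η).1 → ContDiffAt ℝ ∞ F e → F e = bundlePt η →
      ContDiffAt ℝ ∞ (fun z => pinv (p.1 * (F z).1)) e := by
    intro p η F h hF hFe
    have k1 : ContDiffAt ℝ ∞ (fun x : corner 1 p₀ => pinv (p.1 * x.1)) (bundlePt η) :=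
      ((analyticAt_pinv_mul p (analyticAt_corner_coe (bundlePt η)) (isInverse_mul_bundle h)
        (eventually_bundle_mul _)).restrictScalars (𝕜 := ℝ)).contDiffAt
    rw [← hFe] at k1
    exact ContDiffAt.comp (g := fun x : corner 1 p₀ => pinv (p.1 * x.1)) e k1 hF
  have k1 := hp h1 hF hFe
  have k2 := hp h2 hG hGe
  have k3 := contDiffAt_const (c := i.1.1) |>.mul (hc hV)
  exact (ht _ _ (((hc hV).mul k1).sub ((hc hF).mul ((k1.mul k3).mul k1)))).prodMk
    ((ht _ _ (k3.mul k2)).prodMk contDiffAt_const)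

/-- The relation gives the field only at points written as `η ξ⁻¹`; a smooth local section of `(η,
ξ) ↦ η ξ⁻¹` supplies such a form on a full neighbourhood, with both entries varying. -/
theorem CarriesSection.contDiffAt_arrowField (hU : (orbitAtlas p₀).IsOpenSet U)
    (hϑ : IsAtiyahSection U ϑ) (h : CarriesSection algebroidMap U ϑ X) {η : bundle p₀}
    (hη : bundleProj η ∈ U) {i : orbit p₀ × orbit p₀} (e1 : i.1 = bundleProj η)
    (e2 : i.2 = bundleProj η) : ContDiffAt ℝ ∞ (arrowField X i) (pairChart i η.1 η.1) := by
  have h1 : Splits i.1.1 (bundleProj η).1 := e1 ▸ splits_self (orbit_proj i.1)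
  have h2 : Splits i.2.1 (bundleProj η).1 := e2 ▸ splits_self (orbit_proj i.2)
  obtain ⟨s, hs, hs0, hsr⟩ := exists_section_pairChart η η e1 e2
  rw [arrowChart_pairArrow h1 h2] at hs hs0 hsr
  have hsc : ContDiffAt ℝ ∞ s (pairChart i η.1 η.1) := (hs.restrictScalars (𝕜 := ℝ)).contDiffAt
  have hF : ContDiffAt ℝ ∞ (fun z => (s z).1) (pairChart i η.1 η.1) :=
    contDiff_fst.contDiffAt.comp _ hsc
  have hG : ContDiffAt ℝ ∞ (fun z => (s z).2) (pairChart i η.1 η.1) :=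
    contDiff_snd.contDiffAt.comp _ hsc
  have hFe : (s (pairChart i η.1 η.1)).1 = bundlePt η := congrArg Prod.fst hs0
  have hGe : (s (pairChart i η.1 η.1)).2 = bundlePt η := congrArg Prod.snd hs0
  have hV : ContDiffAt ℝ ∞ (fun z => bundleField ϑ (s z).1) (pairChart i η.1 η.1) := by
    have k := hϑ.contDiffAt hU hη
    rw [← hFe] at k
    exact ContDiffAt.comp (g := bundleField ϑ) _ k hF
  refine (contDiffAt_pairDeriv h1 h2 hF hG hV hFe hGe).congr_of_eventuallyEq ?_
  have t1 : Filter.Tendsto (fun z => (s z).1) (𝓝 (pairChart i η.1 η.1)) (𝓝 (bundlePt η)) := by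
    have := hF.continuousAt.tendsto
    rwa [hFe] at this
  have t2 : Filter.Tendsto (fun z => (s z).2) (𝓝 (pairChart i η.1 η.1)) (𝓝 (bundlePt η)) := by
    have := hG.continuousAt.tendsto
    rwa [hGe] at this
  filter_upwards [hsr, t1.eventually (eventually_exists_bundlePt hU hη),
    t1.eventually (eventually_splits h1), t2.eventually (eventually_exists_bundlePt hU hη),
    t2.eventually (eventually_splits h2)]
  rintro z hz ⟨a, ha, haU⟩ hsa ⟨b, hb, -⟩ hsb
  have k := h.arrowField_pairChart haU (hsa a ha) (hsb b hb)
  rw [← bundleField_bundlePt, ha] at k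
  change arrowField X i (pairChart i (bundlePt a).1 (bundlePt b).1) =
    pairDeriv i (bundlePt a).1 (bundlePt b).1 _ at k
  rwa [ha, hb, hz] at k

theorem bundleField_fieldBracket (η : bundle p₀) :
    fieldPt ((bundleAtlas p₀).fieldBracket ϑ₁ ϑ₂) η =
      VectorField.lieBracket ℝ (bundleField ϑ₁) (bundleField ϑ₂) (bundlePt η) := rfl

theorem IsAtiyahSection.fieldBracket (hU : (orbitAtlas p₀).IsOpenSet U)
    (h₁ : IsAtiyahSection U ϑ₁) (h₂ : IsAtiyahSection U ϑ₂) :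
    IsAtiyahSection U ((bundleAtlas p₀).fieldBracket ϑ₁ ϑ₂) := by
  refine ⟨(realSmoothOn_bundle_iff hU).2 fun η hη => ?_, fun η η' hη g hg hg' => ?_⟩
  · have k : ContDiffAt ℝ ∞ (VectorField.lieBracket ℝ (bundleField ϑ₁) (bundleField ϑ₂))
        (bundlePt η) :=
      (h₁.contDiffAt hU hη).lieBracket_vectorField (h₂.contDiffAt hU hη) (by simp)
    refine k.congr_of_eventuallyEq ?_
    filter_upwards [eventually_exists_bundlePt hU hη]
    rintro _ ⟨η', rfl, -⟩
    exact bundleField_bundlePt _ η'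
  · let f : corner 1 p₀ →L[ℝ] corner 1 p₀ := ((toBundle η).restrictScalars ℝ).comp
      ((((ContinuousLinearMap.mul ℂ M).flip g).comp (corner 1 p₀).subtypeL).restrictScalars ℝ)
    have hf : ∀ x, (f x).1 = x.1 * g := fun x =>
      toBundle_coe (η := η) (x := x.1 * g) (by rw [mul_assoc, hg.1.2])
    have hfη : f (bundlePt η) = bundlePt η' := Subtype.ext ((hf _).trans hg'.symm)
    obtain ⟨k, -, hk⟩ := bundle_mul_unitGroup η hg
    rw [← hg'] at hk
    have hη' : bundleProj η' ∈ U := by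
      have e : bundleProj η' = bundleProj η := Subtype.ext hk.leftSupport_eq
      rwa [e]
    have hrel : ∀ {ϑ : ∀ η, (bundleAtlas p₀).TangentAt η}, IsAtiyahSection U ϑ →
        ∀ᶠ x in 𝓝 (bundlePt η), bundleField ϑ (f x) = fderiv ℝ f x (bundleField ϑ x) := by
      intro ϑ hϑ
      filter_upwards [eventually_exists_bundlePt hU hη]
      rintro _ ⟨ζ, rfl, hζ⟩
      obtain ⟨k, -, hk⟩ := bundle_mul_unitGroup ζ hg
      let ζ' : bundle p₀ := ⟨ζ.1 * g, hk.mem_bundle⟩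
      have e : f (bundlePt ζ) = bundlePt ζ' := Subtype.ext (hf _)
      rw [f.fderiv, e, bundleField_bundlePt, bundleField_bundlePt]
      exact Subtype.ext ((hϑ.2 ζ ζ' hζ g hg rfl).trans (hf _).symm)
    have hd : ∀ {ϑ : ∀ η, (bundleAtlas p₀).TangentAt η}, IsAtiyahSection U ϑ →
        ∀ {η}, bundleProj η ∈ U → DifferentiableAt ℝ (bundleField ϑ) (bundlePt η) :=
      fun hϑ η hη => (hϑ.contDiffAt hU hη).differentiableAt (by simp)
    have key := lieBracket_of_related (f := f) (x := bundlePt η) f.contDiff.contDiffAt (hd h₁ hη)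
      (hd h₂ hη) (hfη ▸ hd h₁ hη') (hfη ▸ hd h₂ hη') (hrel h₁) (hrel h₂)
    rw [hfη, f.fderiv] at key
    exact (congrArg Subtype.val key).trans (hf _)

theorem CarriesSection.algebroidBracket (hU : (orbitAtlas p₀).IsOpenSet U)
    (h₁ : IsAtiyahSection U ϑ₁) (h₂ : IsAtiyahSection U ϑ₂)
    (hX₁ : CarriesSection algebroidMap U ϑ₁ X₁) (hX₂ : CarriesSection algebroidMap U ϑ₂ X₂) :
    CarriesSection algebroidMap U ((bundleAtlas p₀).fieldBracket ϑ₁ ϑ₂)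
      ((groupoid p₀).algebroidBracket (arrowAtlas p₀) X₁ X₂) := by
  refine carriesSection_iff.2 fun η hη => ?_
  set ϑ : ∀ η, (bundleAtlas p₀).TangentAt η := (bundleAtlas p₀).fieldBracket ϑ₁ ϑ₂ with hϑ
  let Z := (arrowAtlas p₀).fieldBracket ((groupoid p₀).rightInvariantField (arrowAtlas p₀) X₁)
    ((groupoid p₀).rightInvariantField (arrowAtlas p₀) X₂)
  -- The unit equals `η η⁻¹` only propositionally and the tangent spaces depend on it, so the arrow
  -- is generalised before being replaced.
  suffices h : ∀ x : arrows p₀, pairArrow η η = x →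
      Z x = arrowVec x ((fieldPt ϑ η).1 * pinv η.1) from h _ (pairArrow_self η)
  rintro _ rfl
  let i : orbit p₀ × orbit p₀ := (tgt (pairArrow η η), src (pairArrow η η))
  have e1 : i.1 = bundleProj η := tgt_pairArrow η η
  have e2 : i.2 = bundleProj η := src_pairArrow η η
  have s1 : Splits i.1.1 (bundleProj η).1 := splits_tgt_pairArrow η η
  have s2 : Splits i.2.1 (bundleProj η).1 := splits_src_pairArrow η η
  -- The map `ζ ↦ ζ η⁻¹` in coordinates, sending `η` to the unit; it relates both pairs of fields.
  let f : corner 1 p₀ → arrowModel i := fun x => pairChart i x.1 η.1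
  have hf : ContDiffAt ℝ 2 f (bundlePt η) :=
    ((analyticAt_pairChart_left s1 η.1).restrictScalars (𝕜 := ℝ)).contDiffAt
  have hfd : ∀ ζ : bundle p₀, Splits i.1.1 (bundleProj ζ).1 → ∀ v : corner 1 p₀,
      fderiv ℝ f (bundlePt ζ) v = pairDeriv i ζ.1 η.1 v.1 := by
    intro ζ hζ v
    obtain ⟨L, hL, hLv⟩ := hasFDerivAt_pairChart hζ η.1
    rw [(hL.restrictScalars ℝ).fderiv]
    exact hLv v
  have hrel : ∀ {ϑ : ∀ η, (bundleAtlas p₀).TangentAt η}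
      {X : ∀ q, (arrowAtlas p₀).TangentAt ((groupoid p₀).unit q)},
      CarriesSection algebroidMap U ϑ X → ∀ᶠ x in 𝓝 (bundlePt η),
        arrowField X i (f x) = fderiv ℝ f x (bundleField ϑ x) := by
    intro ϑ X hX
    filter_upwards [eventually_exists_bundlePt hU hη, eventually_splits s1]
    rintro _ ⟨ζ, rfl, hζ⟩ hs
    rw [hfd ζ (hs ζ rfl), bundleField_bundlePt]
    exact hX.arrowField_pairChart hζ (hs ζ rfl) s2
  have key := lieBracket_of_related hf ((h₁.contDiffAt hU hη).differentiableAt (by simp))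
    ((h₂.contDiffAt hU hη).differentiableAt (by simp))
    ((hX₁.contDiffAt_arrowField hU h₁ hη e1 e2).differentiableAt (by simp))
    ((hX₂.contDiffAt_arrowField hU h₂ hη e1 e2).differentiableAt (by simp)) (hrel hX₁) (hrel hX₂)
  rw [← bundleField_fieldBracket, hfd η s1] at key
  have hc : arrowChart i (pairArrow η η) = f (bundlePt η) := arrowChart_pairArrow s1 s2
  have hZ : Z (pairArrow η η) =
      VectorField.lieBracket ℝ (arrowField X₁ i) (arrowField X₂ i) (f (bundlePt η)) := by
    rw [← hc]
    rfl
  -- In the preferred chart coordinates are the vector itself, so the derivative of `f` on the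
  -- bracket is the vector given by `ϑ(η) η⁻¹`, where `ϑ` is the bracket on `P₀`.
  have ht := tangentCoord_tangentMap_pairArrow s1 s2 (fieldPt ϑ η)
  rw [tangentMap_pairArrow] at ht
  have ht' := isBanachManifold_arrowAtlas.tangentCoord_chartAt (pairArrow η η)
    (arrowVec (pairArrow η η) ((fieldPt ϑ η).1 * pinv η.1))
  exact hZ.trans (key.trans (ht.symm.trans ht'))

end Bracket

theorem isAlgebroidIso_algebroidMap {𝒬₀ : BanachAtlas (Quotient (bundleSetoid p₀))}
    {𝒬₂ : BanachAtlas (Quotient (tangentSetoid p₀))}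
    (h₀ : IsQuotientManifold (bundleAtlas p₀) (bundleSetoid p₀) 𝒬₀)
    (h₂ : IsQuotientManifold (bundleAtlas p₀).tangentAtlas (tangentSetoid p₀) 𝒬₂)
    (hφ : Holomorphic 𝒬₀ (orbitAtlas p₀) (baseMap p₀)) :
    IsAlgebroidIso p₀ 𝒬₀ 𝒬₂ (baseMap p₀) algebroidMap where
  injective := fun s t h => bijective_tangentBij.1 (by
    rw [← vecIdeal_idealVec (tangentBij p₀ s), ← vecIdeal_idealVec (tangentBij p₀ t)]
    exact congrArg vecIdeal h)
  range_eq := range_algebroidMap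
  holomorphic := holomorphic_algebroidMap h₂
  inverse_holomorphic := exists_inverse_algebroidMap h₂
  fibre_linear := fun η => ⟨pairArrow η η, pairArrow_self η,
    tangentMap (bundleAtlas p₀) (arrowAtlas p₀) (fun ξ => pairArrow ξ η) η,
    fun v => algebroidMap_eq_tangentTotalMap η v⟩
  anchor := anchor_algebroidMap h₀ hφ
  exists_section := fun _ hU _ h => h.exists_carriesSection hU
  exists_field := fun _ hU _ h => h.exists_carriesSection hU
  bracket := fun _ hU _ _ _ _ h₁ h₂ _ _ hX₁ hX₂ =>
    ⟨h₁.fieldBracket hU h₂, (hX₁.algebroidBracket hU h₁ h₂ hX₂).isAlgebroidSection hU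
      (h₁.fieldBracket hU h₂), hX₁.algebroidBracket hU h₁ h₂ hX₂⟩

end PartialInv

/-! ### The groupoid, the gauge groupoid and the algebroids together -/

theorem mainTheorem1 {M : Type u} [CStarAlgebra M] [WStarAlgebra M] (p₀ : M)
    (hp₀ : IsStarProjection p₀) :
    -- `G_{p₀}(M) ⇉ L_{p₀}(M)` is a transitive Banach-Lie groupoid, and `P₀` is open in `M p₀`
    (groupoid p₀).IsBanachLieGroupoid (orbitAtlas p₀) (arrowAtlas p₀) ∧
    (groupoid p₀).IsTransitive ∧
    (bundleAtlas p₀).IsBanachManifold ∧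
    -- the quotient manifolds `P₀ / G₀`, `(P₀ × P₀) / G₀` and `T P₀ / G₀` exist
    (∃ 𝒬₀, IsQuotientManifold (bundleAtlas p₀) (bundleSetoid p₀) 𝒬₀) ∧
    (∃ 𝒬₁, IsQuotientManifold (prodAtlas (bundleAtlas p₀) (bundleAtlas p₀)) (pairSetoid p₀) 𝒬₁) ∧
    (∃ 𝒬₂, IsQuotientManifold (bundleAtlas p₀).tangentAtlas (tangentSetoid p₀) 𝒬₂) ∧
    ∀ 𝒬₀ 𝒬₁ 𝒬₂,
      IsQuotientManifold (bundleAtlas p₀) (bundleSetoid p₀) 𝒬₀ →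
      IsQuotientManifold (prodAtlas (bundleAtlas p₀) (bundleAtlas p₀)) (pairSetoid p₀) 𝒬₁ →
      IsQuotientManifold (bundleAtlas p₀).tangentAtlas (tangentSetoid p₀) 𝒬₂ →
      -- with these structures the gauge groupoid is a Banach-Lie groupoid, isomorphic to
      -- `G_{p₀}(M) ⇉ L_{p₀}(M)` by `⟨η, ξ⟩ ↦ η ξ⁻¹` and `[η] ↦ η η⁻¹`
      (gaugeGroupoid p₀).IsBanachLieGroupoid 𝒬₀ 𝒬₁ ∧
      ∃ (φ : Quotient (pairSetoid p₀) → arrows p₀) (φ₀ : Quotient (bundleSetoid p₀) → orbit p₀),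
        (∀ η ξ : bundle p₀, (φ (pairCls η ξ)).1 = η.1 * pinv ξ.1) ∧
        (∀ η : bundle p₀, (φ₀ (cls η)).1 = η.1 * pinv η.1) ∧
        GroupoidMaps.IsIso (gaugeGroupoid p₀) 𝒬₀ 𝒬₁
          (groupoid p₀) (orbitAtlas p₀) (arrowAtlas p₀) φ φ₀ ∧
        -- the Atiyah algebroid is isomorphic to the algebroid of `G_{p₀}(M) ⇉ L_{p₀}(M)`, by the
        -- map induced by `φ`: the class of a vector `ϑ` tangent to `P₀` at `η` is mapped to the
        -- image of `ϑ` under the tangent map at `η` of `ξ ↦ φ ⟨ξ, η⟩ = ξ η⁻¹`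
        ∃ Φ : Quotient (tangentSetoid p₀) → (arrowAtlas p₀).TangentTotal,
          (∀ (η : bundle p₀) (ϑ : (bundleAtlas p₀).TangentAt η), Φ (tangentCls η ϑ) =
            tangentTotalMap (bundleAtlas p₀) (arrowAtlas p₀) (fun ξ => φ (pairCls ξ η)) ⟨η, ϑ⟩) ∧
          IsAlgebroidIso p₀ 𝒬₀ 𝒬₂ φ₀ Φ := by
  refine ⟨isBanachLieGroupoid_groupoid, isTransitive_groupoid, isBanachManifold_bundleAtlas,
    exists_isQuotientManifold isBanachManifold_orbitAtlas isSubmersion_bundleProj bijective_baseMap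
      fun _ => rfl,
    exists_isQuotientManifold isBanachManifold_arrowAtlas isSubmersion_pairArrow bijective_arrowMap
      fun _ => rfl,
    exists_isQuotientManifold isBanachManifold_idealAtlas isSubmersion_tangentProj
      bijective_tangentBij fun _ => rfl, fun 𝒬₀ 𝒬₁ 𝒬₂ h₀ h₁ h₂ => ?_⟩
  have hiso := isIso_arrowMap h₀ h₁
  exact ⟨isBanachLieGroupoid_gaugeGroupoid h₀ h₁, arrowMap p₀, baseMap p₀, fun _ _ => rfl,
    fun η => (isInverse_bundle η).xy.symm, hiso, algebroidMap, algebroidMap_eq_tangentTotalMap,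
    isAlgebroidIso_algebroidMap h₀ h₂ hiso.base_biholomorphic.1⟩
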